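/- For $n\ge 1$, $\lambda\in\mathbb R$ and $k\in\mathbb Z$ let $P\subseteq \mathrm{GL}(n,\mathbb C)$ be the subgroup of block matrices $\begin{pmatrix} w & a\\ 0 & g\end{pmatrix}$ with $w\in\mathbb C^\times$, $g\in\mathrm{GL}(n-1,\mathbb C)$ and $a$ a row vector in $\mathbb C^{n-1}$, let $\chi_{i\lambda,k}\begin{pmatrix} w & a\\ 0 & g\end{pmatrix}=|w|^{i\lambda}\left(\frac{w}{|w|}\right)^k$, and let $\pi^{\mathrm{GL}(n,\mathbb C)}_{i\lambda,k}=\mathrm{Ind}_P^{\mathrm{GL}(n,\mathbb C)}(\chi_{i\lambda,k})$ be the unitary principal series representation (normalized parabolic induction): $\mathrm{GL}(n,\mathbb C)$ acts by $(\pi(h)F)(x)=F(h^{-1}x)$ on the Hilbert space of (classes of) measurable functions $F$ on $\mathrm{GL}(n,\mathbb C)$ with $F(xp)=\delta_P(p)^{-1/2}\chi_{i\lambda,k}(p)^{-1}F(x)$ for $p\in P$, where $\delta_P$ is the modular function, and $\|F\|^2=\int_{\mathrm U(n)}|F(u)|^2\,du<\infty$. (For $n=1$ this is the character $\chi_{i\lambda,k}$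 of $\mathrm{GL}(1,\mathbb C)=\mathbb C^\times$.) **Theorem.** Let $p,q\ge 1$, $\lambda\in\mathbb R$, $k\in\mathbb Z$. The restriction of the representation $\pi^{\mathrm{GL}(p+q,\mathbb C)}_{i\lambda,k}$ to the subgroup $H_1=\mathrm{GL}(p,\mathbb C)\times\mathrm{GL}(q,\mathbb C)$ of block diagonal matrices is unitarily equivalent to $$\sum_{k'\in\mathbb Z}{}^{\oplus}\int_{\mathbb R}^{\oplus}\pi^{\mathrm{GL}(p,\mathbb C)}_{i\lambda',k'}\otimes\pi^{\mathrm{GL}(q,\mathbb C)}_{i(\lambda-\lambda'),k-k'}\,d\lambda',$$ a Hilbert space direct sum of direct integrals with respect to Lebesgue measure $d\lambda'$, where $\otimes$ is the outer (Hilbert space) tensor product and, for each $k'$, the Hilbert spaces of the representations under the integral are identified, for varying $\lambda'$, through restriction of functions to the maximal compact subgroups $\mathrm U(p)$ and $\mathrm U(q)$; with respect to this identification the representations form a measurable field. -/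

import Mathlib

open MeasureTheory UniformSpace
open scoped TensorProduct ENNReal InnerProductSpace

namespace GLBranching

noncomputable section

/-! ### Unitary representations -/

/-- A unitary representation of `G` on `H`: a homomorphism from `G` to the group of surjective
linear isometries of `H`. -/
abbrev UnitaryRep (G H : Type*) [Group G] [NormedAddCommGroup H] [InnerProductSpace ℂ H] :=
  G →* (H ≃ₗᵢ[ℂ] H)

section general

variable {G H H' : Type*} [Group G]
  [NormedAddCommGroup H] [InnerProductSpace ℂ H]
  [NormedAddCommGroup H'] [InnerProductSpace ℂ H']

/-- Unitary equivalence: there is a unitary intertwining operator. -/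
def UnitarilyEquivalent (π : UnitaryRep G H) (τ : UnitaryRep G H') : Prop :=
  ∃ T : H ≃ₗᵢ[ℂ] H', ∀ g v, T (π g v) = τ g (T v)

/-- Transport of a unitary representation along an isometric isomorphism: `g ↦ U π(g) U⁻¹`. -/
def transport (U : H ≃ₗᵢ[ℂ] H') (π : UnitaryRep G H) : UnitaryRep G H' where
  toFun g := (U.symm.trans (π g)).trans U
  map_one' := by ext v; simp
  map_mul' g h := by ext v; simp

end general

/-- A multiplicative family of linear isometries consists of isometric isomorphisms. -/
def ofIsometries {G V : Type*} [Group G] [SeminormedAddCommGroup V] [InnerProductSpace ℂ V]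
    (act : G → V →ₗᵢ[ℂ] V) (one : ∀ v, act 1 v = v)
    (mul : ∀ g h v, act (g * h) v = act g (act h v)) : G →* (V ≃ₗᵢ[ℂ] V) where
  toFun g :=
    { toLinearEquiv := LinearEquiv.ofLinearMap (act g).toLinearMap (act g⁻¹).toLinearMap
        (by ext v; simpa [one] using (mul g g⁻¹ v).symm)
        (by ext v; simpa [one] using (mul g⁻¹ g v).symm)
      norm_map' := (act g).norm_map }
  map_one' := by ext v; exact one v
  map_mul' g h := by ext v; exact mul g h v

/-- The linear isometry between the Hausdorff completions extending a given one. -/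
def completionMap {V W : Type*} [SeminormedAddCommGroup V] [InnerProductSpace ℂ V]
    [SeminormedAddCommGroup W] [InnerProductSpace ℂ W] (f : V →ₗᵢ[ℂ] W) :
    Completion V →ₗᵢ[ℂ] Completion W where
  toLinearMap := f.toContinuousLinearMap.completion.toLinearMap
  norm_map' x := by
    change ‖Completion.map f x‖ = ‖x‖
    induction x using Completion.induction_on with
    | hp => exact isClosed_eq (by fun_prop) (by fun_prop)
    | ih x =>
      rw [Completion.map_coe f.isometry.uniformContinuous, Completion.norm_coe,
        Completion.norm_coe, f.norm_map]

@[simp] theorem completionMap_coe {V W : Type*} [SeminormedAddCommGroup V]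
    [InnerProductSpace ℂ V] [SeminormedAddCommGroup W] [InnerProductSpace ℂ W]
    (f : V →ₗᵢ[ℂ] W) (x : V) : completionMap f (x : Completion V) = (f x : Completion W) :=
  Completion.map_coe f.isometry.uniformContinuous x

/-- The isometric isomorphism between the Hausdorff completions extending a given one. -/
def completionCongr {V W : Type*} [SeminormedAddCommGroup V] [InnerProductSpace ℂ V]
    [SeminormedAddCommGroup W] [InnerProductSpace ℂ W] (f : V ≃ₗᵢ[ℂ] W) :
    Completion V ≃ₗᵢ[ℂ] Completion W where
  toLinearEquiv := LinearEquiv.ofLinearMap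
    (completionMap f.toLinearIsometry).toLinearMap
    (completionMap f.symm.toLinearIsometry).toLinearMap
    (by
      ext x
      change completionMap _ (completionMap _ x) = x
      induction x using Completion.induction_on with
      | hp => exact isClosed_eq ((LinearIsometry.continuous _).comp
          (LinearIsometry.continuous _)) continuous_id
      | ih x => simp)
    (by
      ext x
      change completionMap _ (completionMap _ x) = x
      induction x using Completion.induction_on with
      | hp => exact isClosed_eq ((LinearIsometry.continuous _).comp
          (LinearIsometry.continuous _)) continuous_id
      | ih x => simp)
  norm_map' := (completionMap f.toLinearIsometry).norm_map

@[simp] theorem completionCongr_coe {V W : Type*} [SeminormedAddCommGroup V]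
    [InnerProductSpace ℂ V] [SeminormedAddCommGroup W] [InnerProductSpace ℂ W]
    (f : V ≃ₗᵢ[ℂ] W) (x : V) : completionCongr f (x : Completion V) = (f x : Completion W) :=
  completionMap_coe f.toLinearIsometry x

/-- The unitary representation on the completion of a (semi-)inner product space defined by a
group of linear isometries of the latter. -/
def completionRep {G V : Type*} [Group G] [SeminormedAddCommGroup V] [InnerProductSpace ℂ V]
    (ρ : G →* (V ≃ₗᵢ[ℂ] V)) : UnitaryRep G (Completion V) where
  toFun g := completionCongr (ρ g)
  map_one' := by
    ext x
    induction x using Completion.induction_on with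
    | hp => exact isClosed_eq (LinearIsometryEquiv.continuous _) (LinearIsometryEquiv.continuous _)
    | ih x => simp
  map_mul' g h := by
    ext x
    induction x using Completion.induction_on with
    | hp => exact isClosed_eq (LinearIsometryEquiv.continuous _) (LinearIsometryEquiv.continuous _)
    | ih x => simp

section constructions

variable {G G' H H' : Type*} [Group G] [Group G']
  [NormedAddCommGroup H] [InnerProductSpace ℂ H]
  [NormedAddCommGroup H'] [InnerProductSpace ℂ H']

/-- The Hilbert space tensor product: the completion of the algebraic tensor product with
`⟪v ⊗ w, v' ⊗ w'⟫ = ⟪v, v'⟫ ⟪w, w'⟫`. -/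
abbrev HilbertTensor (H H' : Type*) [NormedAddCommGroup H] [InnerProductSpace ℂ H]
    [NormedAddCommGroup H'] [InnerProductSpace ℂ H'] := Completion (H ⊗[ℂ] H')

/-- The outer tensor product of unitary representations of `G` and `G'`, a unitary representation
of `G × G'` with `(g, g') (v ⊗ w) = g v ⊗ g' w`. -/
def outerTensor (π : UnitaryRep G H) (τ : UnitaryRep G' H') :
    UnitaryRep (G × G') (HilbertTensor H H') :=
  completionRep
    { toFun := fun g => TensorProduct.congrIsometry (π g.1) (τ g.2)
      map_one' := by
        ext x
        induction x with
        | zero => simp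
        | tmul x y =>
          change (π (1 : G × G').1 x) ⊗ₜ[ℂ] (τ (1 : G × G').2 y) = x ⊗ₜ[ℂ] y
          simp
        | add x y hx hy => rw [map_add, map_add, hx, hy]
      map_mul' := fun g h => by
        ext x
        induction x with
        | zero => simp
        | tmul x y =>
          change (π (g * h).1 x) ⊗ₜ[ℂ] (τ (g * h).2 y) =
            (π g.1 (π h.1 x)) ⊗ₜ[ℂ] (τ g.2 (τ h.2 y))
          simp
        | add x y hx hy => rw [map_add, map_add, hx, hy] }

/-- The Hilbert space direct sum of a family of unitary representations. -/
def hilbertSum {ι : Type*} {E : ι → Type*} [∀ i, NormedAddCommGroup (E i)]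
    [∀ i, InnerProductSpace ℂ (E i)] (τ : ∀ i, UnitaryRep G (E i)) : UnitaryRep G (lp E 2) :=
  ofIsometries
    (fun g =>
      { toFun := fun f => ⟨fun i => τ i g (f i), by
          have h := (memℓp_norm_iff (p := 2) (f := f.1)).2 (lp.memℓp f)
          refine (memℓp_norm_iff (p := 2)).1 ?_
          simpa using h⟩
        map_add' := fun f f' => by ext i; exact map_add (τ i g) (f i) (f' i)
        map_smul' := fun c f => by ext i; exact map_smul (τ i g) c (f i)
        norm_map' := fun f => by simp [lp.norm_eq_tsum_rpow] })
    (fun f => by ext i; simp)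
    (fun g h f => by ext i; simp)

end constructions

section directIntegral

variable {G E X : Type*} [Group G] [NormedAddCommGroup E] [InnerProductSpace ℂ E]
  [MeasurableSpace X]

/-- `x ↦ σ x` is a measurable field of unitary representations on the constant field of Hilbert
spaces with fibre `E`: for every `g` and `v` the section `x ↦ σ x g v` is measurable. -/
def IsMeasurableField (σ : X → UnitaryRep G E) (μ : Measure X) : Prop :=
  ∀ (g : G) (v : E), AEStronglyMeasurable (fun x => σ x g v) μ

theorem IsMeasurableField.apply {σ : X → UnitaryRep G E} {μ : Measure X}
    (h : IsMeasurableField σ μ) (g : G) {f : X → E} (hf : AEStronglyMeasurable f μ) :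
    AEStronglyMeasurable (fun x => σ x g (f x)) μ := by
  have hs : ∀ s : SimpleFunc X E, AEStronglyMeasurable (fun x => σ x g (s x)) μ := by
    intro s
    induction s using SimpleFunc.induction with
    | const c hs =>
      rename_i s
      have : (fun x => σ x g ((SimpleFunc.piecewise s hs (SimpleFunc.const X c)
          (SimpleFunc.const X 0)) x)) = s.indicator (fun x => σ x g c) := by
        ext x
        by_cases hx : x ∈ s <;> simp [hx]
      rw [this]
      exact (h g c).indicator hs
    | add _ h1 h2 =>
      refine (h1.add h2).congr (Filter.Eventually.of_forall fun x => ?_)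
      simp
  have hm := hf.stronglyMeasurable_mk
  have key : AEStronglyMeasurable (fun x => σ x g (hf.mk f x)) μ :=
    aestronglyMeasurable_of_tendsto_ae Filter.atTop (fun n => hs (hm.approx n))
      (Filter.Eventually.of_forall fun x =>
        ((σ x g).continuous.tendsto _).comp (hm.tendsto_approx x))
  refine key.congr ?_
  filter_upwards [hf.ae_eq_mk] with x hx
  rw [hx]

/-- The direct integral `∫^⊕ σ x dμ(x)` of a measurable field of unitary representations on the
constant field with fibre `E`: it acts on `L²(X, μ; E)` by `(g f)(x) = σ x g (f x)`. -/
def directIntegral (σ : X → UnitaryRep G E) (μ : Measure X) (h : IsMeasurableField σ μ) :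
    UnitaryRep G (Lp E 2 μ) :=
  have hmem : ∀ (g : G) (f : Lp E 2 μ), MemLp (fun x => σ x g (f x)) 2 μ := fun g f =>
    (Lp.memLp f).congr_norm (h.apply g (Lp.aestronglyMeasurable f))
      (Filter.Eventually.of_forall fun x => by simp)
  let act : G → Lp E 2 μ →ₗᵢ[ℂ] Lp E 2 μ := fun g =>
    { toFun := fun f => (hmem g f).toLp _
      map_add' := fun f f' => by
        ext1
        filter_upwards [(hmem g (f + f')).coeFn_toLp, (hmem g f).coeFn_toLp,
          (hmem g f').coeFn_toLp, Lp.coeFn_add f f',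
          Lp.coeFn_add ((hmem g f).toLp _) ((hmem g f').toLp _)] with x h1 h2 h3 h4 h5
        rw [h1, h5, Pi.add_apply, h2, h3, h4, Pi.add_apply, map_add]
      map_smul' := fun c f => by
        ext1
        filter_upwards [(hmem g (c • f)).coeFn_toLp, (hmem g f).coeFn_toLp,
          Lp.coeFn_smul c f, Lp.coeFn_smul c ((hmem g f).toLp _)] with x h1 h2 h3 h4
        rw [h1, RingHom.id_apply, h4, Pi.smul_apply, h2, h3, Pi.smul_apply, map_smul]
      norm_map' := fun f => by
        change ‖(hmem g f).toLp _‖ = ‖f‖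
        rw [Lp.norm_toLp, Lp.norm_def]
        congr 1
        exact eLpNorm_congr_norm_ae (Filter.Eventually.of_forall fun x => by simp) }
  have hact : ∀ (g : G) (f : Lp E 2 μ), act g f =ᵐ[μ] fun x => σ x g (f x) := fun g f =>
    (hmem g f).coeFn_toLp
  have hmul : ∀ (g g' : G) (f : Lp E 2 μ), act g (act g' f) = act (g * g') f := fun g g' f => by
    ext1
    filter_upwards [hact g (act g' f), hact g' f, hact (g * g') f] with x h1 h2 h3
    rw [h1, h2, h3, map_mul]; rfl
  have hone : ∀ f : Lp E 2 μ, act 1 f = f := fun f => by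
    ext1
    filter_upwards [hact 1 f] with x h1
    rw [h1, map_one]; rfl
  ofIsometries act hone (fun g g' f => (hmul g g' f).symm)

theorem directIntegral_apply (σ : X → UnitaryRep G E) (μ : Measure X)
    (h : IsMeasurableField σ μ) (g : G) (f : Lp E 2 μ) :
    directIntegral σ μ h g f =ᵐ[μ] fun x => σ x g (f x) :=
  MemLp.coeFn_toLp ((Lp.memLp f).congr_norm (h.apply g (Lp.aestronglyMeasurable f))
      (Filter.Eventually.of_forall fun x => by simp))

end directIntegral

/-! ### Invariant integration -/

instance instMeasurableSpaceMatrix (n : ℕ) : MeasurableSpace (Matrix (Fin n) (Fin n) ℂ) :=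
  inferInstanceAs (MeasurableSpace (Fin n → Fin n → ℂ))

instance instBorelSpaceMatrix (n : ℕ) : BorelSpace (Matrix (Fin n) (Fin n) ℂ) :=
  inferInstanceAs (BorelSpace (Fin n → Fin n → ℂ))

instance instSecondCountableMatrix (n : ℕ) :
    SecondCountableTopology (Matrix (Fin n) (Fin n) ℂ) :=
  inferInstanceAs (SecondCountableTopology (Fin n → Fin n → ℂ))

instance instCompactSpaceUnitaryGroup (n : ℕ) :
    CompactSpace (Matrix.unitaryGroup (Fin n) ℂ) := by
  refine isCompact_iff_compactSpace.1 ?_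
  have h1 : IsCompact (Set.pi Set.univ fun _ : Fin n => Set.pi Set.univ fun _ : Fin n =>
      Metric.closedBall (0 : ℂ) 1) :=
    isCompact_univ_pi fun _ => isCompact_univ_pi fun _ => isCompact_closedBall _ _
  refine h1.of_isClosed_subset (isClosed_unitary (R := Matrix (Fin n) (Fin n) ℂ)) ?_
  intro U hU i _ j _
  simpa using entry_norm_bound_of_unitary hU i j

/-- The normalized Haar measure of the compact group `U(n)`. -/
def haarU (n : ℕ) : Measure (Matrix.unitaryGroup (Fin n) ℂ) := Measure.haarMeasure ⊤

instance (n : ℕ) : (haarU n).IsHaarMeasure := by unfold haarU; infer_instance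
instance (n : ℕ) : IsProbabilityMeasure (haarU n) :=
  ⟨by simpa [haarU] using Measure.haarMeasure_self (K₀ := (⊤ : TopologicalSpace.PositiveCompacts (Matrix.unitaryGroup (Fin n) ℂ)))⟩
instance (n : ℕ) : (haarU n).IsMulRightInvariant :=
  ⟨fun g => by
    have h1 : IsProbabilityMeasure (Measure.map (· * g) (haarU n)) :=
      Measure.isProbabilityMeasure_map (measurable_mul_const g).aemeasurable
    exact Measure.isHaarMeasure_eq_of_isProbabilityMeasure _ _⟩
instance instSecondCountableU (n : ℕ) : SecondCountableTopology (Matrix.unitaryGroup (Fin n) ℂ) := 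
  TopologicalSpace.Subtype.secondCountableTopology _

section analysis
variable {n : ℕ}

theorem measurable_mulVec (A : Matrix (Fin n) (Fin n) ℂ) :
    Measurable fun z : Fin n → ℂ => A.mulVec z :=
  (Continuous.matrix_mulVec continuous_const continuous_id).measurable

theorem lintegral_mulVec {A : Matrix (Fin n) (Fin n) ℂ} (hA : A.det ≠ 0)
    {ψ : (Fin n → ℂ) → ℝ≥0∞} (hψ : Measurable ψ) :
    ‖A.det‖ₑ ^ 2 * ∫⁻ z, ψ (A.mulVec z) = ∫⁻ z, ψ z := by
  set f : (Fin n → ℂ) →ₗ[ℝ] (Fin n → ℂ) := (Matrix.toLin' A).restrictScalars ℝ with hf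
  have hdet : LinearMap.det f = ‖A.det‖ ^ 2 := by
    rw [hf, LinearMap.det_restrictScalars, Algebra.norm_complex_eq, LinearMap.det_toLin']
    simp [Complex.normSq_eq_norm_sq]
  have h0 : LinearMap.det f ≠ 0 := by rw [hdet]; simpa using hA
  have hm := Measure.map_linearMap_addHaar_eq_smul_addHaar (volume : Measure (Fin n → ℂ)) h0
  have hfm : Measurable f := measurable_mulVec A
  have : ∫⁻ z, ψ (A.mulVec z) = ∫⁻ z, ψ z ∂(Measure.map f volume) :=
    (lintegral_map hψ hfm).symm
  rw [this, hm, lintegral_smul_measure, smul_eq_mul, ← mul_assoc, hdet]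
  have : ‖A.det‖ₑ ^ 2 * ENNReal.ofReal |(‖A.det‖ ^ 2)⁻¹| = 1 := by
    have hp : 0 < ‖A.det‖ ^ 2 := by positivity
    rw [abs_of_pos (by positivity), ENNReal.ofReal_inv_of_pos hp, ENNReal.ofReal_pow (norm_nonneg _),
      ofReal_norm]
    refine ENNReal.mul_inv_cancel ?_ ?_
    · simpa using hA
    · simp
  rw [this, one_mul]

/-- The Euclidean norm on `ℂⁿ`. -/
def euclNorm (z : Fin n → ℂ) : ℝ := ‖(WithLp.toLp 2 z : EuclideanSpace ℂ (Fin n))‖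

theorem euclNorm_smul (c : ℂ) (z : Fin n → ℂ) : euclNorm (c • z) = ‖c‖ * euclNorm z := by
  simp [euclNorm, norm_smul]

theorem continuous_euclNorm : Continuous (euclNorm : (Fin n → ℂ) → ℝ) :=
  continuous_norm.comp (PiLp.continuous_toLp 2 _)

theorem euclNorm_pos {z : Fin n → ℂ} (hz : z ≠ 0) : 0 < euclNorm z := by
  simpa [euclNorm] using hz

theorem euclNorm_unitary (U : Matrix.unitaryGroup (Fin n) ℂ) (z : Fin n → ℂ) :
    euclNorm ((U : Matrix (Fin n) (Fin n) ℂ).mulVec z) = euclNorm z := by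
  have h : ∀ w : Fin n → ℂ, ((euclNorm w ^ 2 : ℝ) : ℂ) = star w ⬝ᵥ w := fun w => by
    simp [euclNorm, EuclideanSpace.norm_sq_eq, dotProduct, Complex.conj_mul']
  have h2 : euclNorm ((U : Matrix (Fin n) (Fin n) ℂ).mulVec z) ^ 2 = euclNorm z ^ 2 := by
    have : ((euclNorm ((U : Matrix (Fin n) (Fin n) ℂ).mulVec z) ^ 2 : ℝ) : ℂ)
        = ((euclNorm z ^ 2 : ℝ) : ℂ) := by
      rw [h, h, Matrix.star_mulVec, Matrix.dotProduct_mulVec, Matrix.vecMul_vecMul,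
        ← Matrix.star_eq_conjTranspose, Unitary.coe_star_mul_self, Matrix.vecMul_one]
    exact_mod_cast this
  exact (pow_left_inj₀ (norm_nonneg _) (norm_nonneg _) two_ne_zero).1 h2

/-- The spherical shell `1 ≤ |z| < 2`. -/
def shell (n : ℕ) : Set (Fin n → ℂ) := {z | 1 ≤ euclNorm z ∧ euclNorm z < 2}

theorem measurableSet_shell : MeasurableSet (shell n) :=
  (measurableSet_le measurable_const continuous_euclNorm.measurable).inter
    (measurableSet_lt continuous_euclNorm.measurable measurable_const)

open Classical in
theorem tsum_shell {z : Fin n → ℂ} (hz : z ≠ 0) :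
    ∑' j : ℤ, (shell n).indicator (1 : (Fin n → ℂ) → ℝ≥0∞) ((2 : ℂ) ^ j • z) = 1 := by
  obtain ⟨m, hm⟩ := exists_mem_Ico_zpow (euclNorm_pos hz) (one_lt_two)
  have key : ∀ j : ℤ, (2 : ℂ) ^ j • z ∈ shell n ↔ j = -m := by
    intro j
    have h2 : (0 : ℝ) < 2 ^ j := by positivity
    simp only [shell, Set.mem_ofPred_eq, euclNorm_smul, norm_zpow, Complex.norm_ofNat]
    constructor
    · rintro ⟨h3, h4⟩
      have h5 : (2 : ℝ) ^ (0 : ℤ) < 2 ^ (j + (m + 1)) := by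
        rw [zpow_zero, zpow_add₀ two_ne_zero]
        exact h3.trans_lt (mul_lt_mul_of_pos_left hm.2 h2)
      have h6 : (2 : ℝ) ^ (j + m) < 2 ^ (1 : ℤ) := by
        rw [zpow_one, zpow_add₀ two_ne_zero]
        exact (mul_le_mul_of_nonneg_left hm.1 h2.le).trans_lt h4
      have h5' := (zpow_lt_zpow_iff_right₀ (one_lt_two (α := ℝ))).1 h5
      have h6' := (zpow_lt_zpow_iff_right₀ (one_lt_two (α := ℝ))).1 h6
      omega
    · rintro rfl
      have e1 : (2 : ℝ) ^ (-m) * 2 ^ m = 1 := by rw [← zpow_add₀ two_ne_zero]; simp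
      have e2 : (2 : ℝ) ^ (-m) * 2 ^ (m + 1) = 2 := by rw [← zpow_add₀ two_ne_zero]; simp
      exact ⟨e1 ▸ mul_le_mul_of_nonneg_left hm.1 h2.le,
        lt_of_lt_of_eq (mul_lt_mul_of_pos_left hm.2 h2) e2⟩
  rw [tsum_eq_single (-m)]
  · rw [Set.indicator_of_mem ((key _).2 rfl)]; rfl
  · intro j hj
    exact Set.indicator_of_notMem (fun h => hj ((key j).1 h)) _

/-- Invariance of the integral over the shell of a function homogeneous of degree `-2n`. -/
theorem lintegral_shell_mulVec {A : Matrix (Fin n) (Fin n) ℂ} (hA : A.det ≠ 0)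
    {φ : (Fin n → ℂ) → ℝ≥0∞} (hφ : Measurable φ)
    (hom : ∀ (c : ℂ) (z : Fin n → ℂ), c ≠ 0 → ‖c‖ₑ ^ (2 * n) * φ (c • z) = φ z) :
    ∫⁻ z, (shell n).indicator 1 (A.mulVec z) * φ z = ∫⁻ z, (shell n).indicator 1 z * φ z := by
  have hind : Measurable ((shell n).indicator (1 : (Fin n → ℂ) → ℝ≥0∞)) :=
    measurable_one.indicator measurableSet_shell
  have hAm := measurable_mulVec A
  have hne : ∀ z, z ∈ shell n → z ≠ 0 := by
    rintro z hz rfl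
    have := hz.1
    simp [euclNorm] at this
    linarith
  have e1 : ∀ z, (shell n).indicator (1 : (Fin n → ℂ) → ℝ≥0∞) z * φ z
      = ∑' j : ℤ, (shell n).indicator 1 z * (shell n).indicator 1 ((2 : ℂ) ^ j • A.mulVec z)
          * φ z := by
    intro z
    by_cases hz : z ∈ shell n
    · have : A.mulVec z ≠ 0 := fun h => hne z hz (Matrix.eq_zero_of_mulVec_eq_zero hA h)
      rw [ENNReal.tsum_mul_right, ENNReal.tsum_mul_left, tsum_shell this, mul_one]
    · simp [hz]
  have e2 : ∀ z, (shell n).indicator (1 : (Fin n → ℂ) → ℝ≥0∞) (A.mulVec z) * φ z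
      = ∑' j : ℤ, (shell n).indicator 1 ((2 : ℂ) ^ (-j) • z) * (shell n).indicator 1 (A.mulVec z)
          * φ z := by
    intro z
    by_cases hz : A.mulVec z ∈ shell n
    · have h0 : z ≠ 0 := fun h => hne _ hz (by simp [h])
      rw [ENNReal.tsum_mul_right, ENNReal.tsum_mul_right,
        show ∑' j : ℤ, (shell n).indicator (1 : (Fin n → ℂ) → ℝ≥0∞) ((2 : ℂ) ^ (-j) • z) = 1 from
          ((Equiv.neg ℤ).tsum_eq
            (fun j => (shell n).indicator (1 : (Fin n → ℂ) → ℝ≥0∞) ((2 : ℂ) ^ j • z))).trans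
            (tsum_shell h0), one_mul]
    · simp [hz]
  have hsm : ∀ j : ℤ, Measurable fun z : Fin n → ℂ => (2 : ℂ) ^ j • z := fun j =>
    (continuous_const_smul _).measurable
  simp_rw [e1, e2]
  rw [lintegral_tsum, lintegral_tsum]
  · congr 1
    ext j
    have hc : (2 : ℂ) ^ (-j) ≠ 0 := zpow_ne_zero _ two_ne_zero
    have hB : (Matrix.scalar (Fin n) ((2 : ℂ) ^ (-j))).det ≠ 0 := by
      simpa [Matrix.scalar_apply] using fun h => absurd h (zpow_ne_zero j (two_ne_zero (α := ℂ)))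
    rw [← lintegral_mulVec hB (ψ := fun z => (shell n).indicator 1 z *
      (shell n).indicator 1 ((2 : ℂ) ^ j • A.mulVec z) * φ z)
      ((hind.mul (hind.comp ((hsm j).comp hAm))).mul hφ), ← lintegral_const_mul]
    · congr 1
      ext z
      have e3 : (Matrix.scalar (Fin n) ((2 : ℂ) ^ (-j))).mulVec z = (2 : ℂ) ^ (-j) • z := by
        ext i; simp [Matrix.scalar_apply, Matrix.mulVec_diagonal]
      have e4 : (2 : ℂ) ^ j • A.mulVec ((2 : ℂ) ^ (-j) • z) = A.mulVec z := by
        rw [Matrix.mulVec_smul, smul_smul, ← zpow_add₀ two_ne_zero]; simp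
      rw [e3, e4, ← hom _ z hc]
      have e5 : (Matrix.scalar (Fin n) ((2 : ℂ) ^ (-j))).det = ((2 : ℂ) ^ (-j)) ^ n := by simp
      rw [e5, enorm_pow, ← pow_mul, mul_comm n 2]
      ring
    · have := measurable_mulVec (Matrix.scalar (Fin n) ((2 : ℂ) ^ (-j)))
      exact ((hind.comp this).mul (hind.comp ((hsm j).comp (hAm.comp this)))).mul (hφ.comp this)
  · intro j
    exact ((hind.mul (hind.comp ((hsm j).comp hAm))).mul hφ).aemeasurable
  · intro j
    exact (((hind.comp (hsm _)).mul (hind.comp hAm)).mul hφ).aemeasurable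


/-- The column of index `0` of a matrix. -/
def col0 [NeZero n] (A : Matrix (Fin n) (Fin n) ℂ) : Fin n → ℂ := fun i => A i 0

theorem col0_mul [NeZero n] (A B : Matrix (Fin n) (Fin n) ℂ) :
    col0 (A * B) = A.mulVec (col0 B) := rfl

theorem measurable_col0 [NeZero n] :
    Measurable fun u : Matrix.unitaryGroup (Fin n) ℂ => col0 (u : Matrix (Fin n) (Fin n) ℂ) := by
  have : Continuous fun u : Matrix.unitaryGroup (Fin n) ℂ =>
      col0 (u : Matrix (Fin n) (Fin n) ℂ) :=
    continuous_pi fun i => continuous_subtype_val.matrix_elem i 0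
  exact this.measurable

/-- Transitivity of the unitary group on the unit sphere. -/
theorem exists_unitary_col0 [NeZero n] (z : Fin n → ℂ) (hz : z ≠ 0) :
    ∃ v : Matrix.unitaryGroup (Fin n) ℂ,
      z = (euclNorm z : ℂ) • col0 (v : Matrix (Fin n) (Fin n) ℂ) := by
  have hN := euclNorm_pos hz
  set w : EuclideanSpace ℂ (Fin n) := WithLp.toLp 2 ((euclNorm z : ℂ)⁻¹ • z) with hw
  have hw1 : ‖w‖ = 1 := by
    have := euclNorm_smul (euclNorm z : ℂ)⁻¹ z
    rw [norm_inv, Complex.norm_real, Real.norm_of_nonneg hN.le, inv_mul_cancel₀ hN.ne'] at this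
    exact this
  obtain ⟨b, hb⟩ := Orthonormal.exists_orthonormalBasis_extension_of_card_eq (𝕜 := ℂ)
    (E := EuclideanSpace ℂ (Fin n)) (ι := Fin n) (by simp) (v := fun _ => w) (s := {0})
    ⟨fun i => hw1, fun i j hij => (hij (Subsingleton.elim i j)).elim⟩
  refine ⟨⟨(EuclideanSpace.basisFun (Fin n) ℂ).toBasis.toMatrix b,
    (EuclideanSpace.basisFun (Fin n) ℂ).toMatrix_orthonormalBasis_mem_unitary b⟩, ?_⟩
  ext i
  have h0 : b 0 = w := hb 0 rfl
  simp only [col0, Pi.smul_apply, smul_eq_mul, Module.Basis.toMatrix_apply, h0]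
  have : (EuclideanSpace.basisFun (Fin n) ℂ).toBasis.repr w i = (euclNorm z : ℂ)⁻¹ * z i := by
    simp [hw]
  rw [this, mul_inv_cancel_left₀ (by exact_mod_cast hN.ne')]

/-- The integral of `|z|^{-2n}` over the shell. -/
def shellConst (n : ℕ) : ℝ≥0∞ :=
  ∫⁻ z : Fin n → ℂ, (shell n).indicator 1 z * (‖euclNorm z‖ₑ ^ (2 * n))⁻¹

theorem shell_ne_zero {z : Fin n → ℂ} (hz : z ∈ shell n) : z ≠ 0 := by
  rintro rfl
  have := hz.1
  simp [euclNorm] at this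
  linarith

theorem one_le_enorm_euclNorm {z : Fin n → ℂ} (hz : z ∈ shell n) : 1 ≤ ‖euclNorm z‖ₑ := by
  rw [← ofReal_norm, Real.norm_of_nonneg (show 0 ≤ euclNorm z from norm_nonneg _),
    ← ENNReal.ofReal_one]
  exact ENNReal.ofReal_le_ofReal hz.1

theorem shellConst_ne_top (n : ℕ) : shellConst n ≠ ∞ := by
  have h1 : shellConst n ≤ volume (shell n) := by
    rw [← lintegral_indicator_one measurableSet_shell]
    refine lintegral_mono fun z => ?_
    by_cases hz : z ∈ shell n
    · simp only [hz, Set.indicator_of_mem, Pi.one_apply, one_mul, ENNReal.inv_le_one]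
      exact one_le_pow₀ (one_le_enorm_euclNorm hz)
    · simp [hz]
  have h2 : shell n ⊆ Metric.closedBall 0 2 := by
    intro z hz
    rw [mem_closedBall_zero_iff, pi_norm_le_iff_of_nonneg (by norm_num)]
    intro i
    exact (PiLp.norm_apply_le (WithLp.toLp 2 z : EuclideanSpace ℂ (Fin n)) i).trans hz.2.le
  exact ((h1.trans (measure_mono h2)).trans_lt measure_closedBall_lt_top).ne

theorem shellConst_ne_zero (n : ℕ) [NeZero n] : shellConst n ≠ 0 := by
  have hm : Measurable fun z : Fin n → ℂ =>
      (shell n).indicator (1 : (Fin n → ℂ) → ℝ≥0∞) z * (‖euclNorm z‖ₑ ^ (2 * n))⁻¹ :=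
    (measurable_one.indicator measurableSet_shell).mul
      ((continuous_euclNorm.measurable.enorm.pow_const _).inv)
  intro h
  rw [shellConst, lintegral_eq_zero_iff hm] at h
  set O : Set (Fin n → ℂ) := {z | 1 < euclNorm z ∧ euclNorm z < 2} with hO
  have hopen : IsOpen O :=
    (isOpen_lt continuous_const continuous_euclNorm).inter
      (isOpen_lt continuous_euclNorm continuous_const)
  have hne : O.Nonempty := by
    refine ⟨Pi.single 0 (3 / 2), ?_⟩
    have : euclNorm (Pi.single 0 (3 / 2) : Fin n → ℂ) = 3 / 2 := by
      simp [euclNorm]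
    rw [hO, Set.mem_ofPred_eq, this]
    norm_num
  refine (hopen.measure_pos volume hne).ne' (measure_mono_null ?_ h)
  intro z hz
  have hz' : z ∈ shell n := ⟨hz.1.le, hz.2⟩
  simp [hz']

/-- Integration in polar coordinates of a function homogeneous of degree `-2n`. -/
theorem lintegral_shell_eq [NeZero n] {φ : (Fin n → ℂ) → ℝ≥0∞} (hφ : Measurable φ)
    (hom : ∀ (c : ℂ) (z : Fin n → ℂ), c ≠ 0 → ‖c‖ₑ ^ (2 * n) * φ (c • z) = φ z) :
    ∫⁻ z, (shell n).indicator 1 z * φ z =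
      shellConst n * ∫⁻ u, φ (col0 (u : Matrix (Fin n) (Fin n) ℂ)) ∂(haarU n) := by
  have hind : Measurable ((shell n).indicator (1 : (Fin n → ℂ) → ℝ≥0∞)) :=
    measurable_one.indicator measurableSet_shell
  have h1 : ∀ u : Matrix.unitaryGroup (Fin n) ℂ,
      ∫⁻ z, (shell n).indicator 1 z * φ ((u : Matrix (Fin n) (Fin n) ℂ).mulVec z) =
        ∫⁻ z, (shell n).indicator 1 z * φ z := by
    intro u
    have hu : ‖(u : Matrix (Fin n) (Fin n) ℂ).det‖ = 1 :=
      CStarRing.norm_of_mem_unitary (Matrix.det_of_mem_unitary u.2)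
    have hd : (u : Matrix (Fin n) (Fin n) ℂ).det ≠ 0 := by
      intro h; rw [h] at hu; simp at hu
    rw [← lintegral_mulVec hd (ψ := fun z => (shell n).indicator 1 z * φ z) (hind.mul hφ)]
    have : ‖(u : Matrix (Fin n) (Fin n) ℂ).det‖ₑ = 1 := by
      rw [← ofReal_norm, hu, ENNReal.ofReal_one]
    rw [this, one_pow, one_mul]
    congr 1
    ext z
    have : (u : Matrix (Fin n) (Fin n) ℂ).mulVec z ∈ shell n ↔ z ∈ shell n := by
      simp only [shell, Set.mem_ofPred_eq, euclNorm_unitary]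
    by_cases hz : z ∈ shell n
    · simp [hz, this.2 hz]
    · simp [hz, mt this.1 hz]
  have hmeas : Measurable fun x : Matrix.unitaryGroup (Fin n) ℂ × (Fin n → ℂ) =>
      (shell n).indicator 1 x.2 * φ ((x.1 : Matrix (Fin n) (Fin n) ℂ).mulVec x.2) := by
    have : Continuous fun x : Matrix.unitaryGroup (Fin n) ℂ × (Fin n → ℂ) =>
        (x.1 : Matrix (Fin n) (Fin n) ℂ).mulVec x.2 :=
      (continuous_subtype_val.comp continuous_fst).matrix_mulVec continuous_snd
    exact (hind.comp measurable_snd).mul (hφ.comp this.measurable)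
  calc ∫⁻ z, (shell n).indicator 1 z * φ z
      = ∫⁻ u : Matrix.unitaryGroup (Fin n) ℂ, (∫⁻ z, (shell n).indicator 1 z *
          φ ((u : Matrix (Fin n) (Fin n) ℂ).mulVec z)) ∂(haarU n) := by simp [h1]
    _ = ∫⁻ z, ∫⁻ u : Matrix.unitaryGroup (Fin n) ℂ, (shell n).indicator 1 z *
          φ ((u : Matrix (Fin n) (Fin n) ℂ).mulVec z) ∂(haarU n) :=
        lintegral_lintegral_swap hmeas.aemeasurable
    _ = ∫⁻ z, (shell n).indicator 1 z * (‖euclNorm z‖ₑ ^ (2 * n))⁻¹ *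
          ∫⁻ u, φ (col0 (u : Matrix (Fin n) (Fin n) ℂ)) ∂(haarU n) := by
        congr 1
        ext z
        by_cases hz : z ∈ shell n
        · obtain ⟨v, hv⟩ := exists_unitary_col0 z (shell_ne_zero hz)
          have hc : (euclNorm z : ℂ) ≠ 0 := by
            exact_mod_cast (euclNorm_pos (shell_ne_zero hz)).ne'
          have hce : ‖(euclNorm z : ℂ)‖ₑ = ‖euclNorm z‖ₑ := by
            rw [← ofReal_norm, ← ofReal_norm, Complex.norm_real]
          have h2 : ∀ u : Matrix.unitaryGroup (Fin n) ℂ,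
              φ ((u : Matrix (Fin n) (Fin n) ℂ).mulVec z) =
                (‖euclNorm z‖ₑ ^ (2 * n))⁻¹ *
                  φ (col0 ((u * v : Matrix.unitaryGroup (Fin n) ℂ) :
                    Matrix (Fin n) (Fin n) ℂ)) := by
            intro u
            have e : (u : Matrix (Fin n) (Fin n) ℂ).mulVec z = (euclNorm z : ℂ) •
                col0 ((u * v : Matrix.unitaryGroup (Fin n) ℂ) : Matrix (Fin n) (Fin n) ℂ) := by
              conv_lhs => rw [hv]
              rw [Matrix.mulVec_smul]; rfl
            rw [e, ← hom _ (col0 _) hc, hce, ← mul_assoc, ENNReal.inv_mul_cancel, one_mul]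
            · exact pow_ne_zero _ (one_pos.trans_le (one_le_enorm_euclNorm hz)).ne'
            · exact ENNReal.pow_ne_top enorm_ne_top
          simp only [hz, Set.indicator_of_mem, Pi.one_apply, one_mul, h2]
          rw [lintegral_mul_right_eq_self (μ := haarU n) (fun u => (‖euclNorm z‖ₑ ^ (2 * n))⁻¹ *
            φ (col0 (u : Matrix (Fin n) (Fin n) ℂ))) v,
            lintegral_const_mul _ (show Measurable fun u : Matrix.unitaryGroup (Fin n) ℂ =>
              φ (col0 (u : Matrix (Fin n) (Fin n) ℂ)) from hφ.comp measurable_col0)]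
        · simp [hz]
    _ = _ := by
        rw [lintegral_mul_const, shellConst]
        exact hind.mul ((continuous_euclNorm.measurable.enorm.pow_const _).inv)

/-- The change of variables `u ↦ A u` on `U(n) / U(n-1)`. -/
theorem lintegral_col0_mul [NeZero n] {A : Matrix (Fin n) (Fin n) ℂ} (hA : A.det ≠ 0)
    {φ : (Fin n → ℂ) → ℝ≥0∞} (hφ : Measurable φ)
    (hom : ∀ (c : ℂ) (z : Fin n → ℂ), c ≠ 0 → ‖c‖ₑ ^ (2 * n) * φ (c • z) = φ z) :
    ‖A.det‖ₑ ^ 2 * ∫⁻ u, φ (col0 (A * (u : Matrix (Fin n) (Fin n) ℂ))) ∂(haarU n) =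
      ∫⁻ u, φ (col0 (u : Matrix (Fin n) (Fin n) ℂ)) ∂(haarU n) := by
  have hind : Measurable ((shell n).indicator (1 : (Fin n → ℂ) → ℝ≥0∞)) :=
    measurable_one.indicator measurableSet_shell
  have hAi : (A⁻¹).det ≠ 0 := by simpa using hA
  have h1 := lintegral_shell_eq (hφ.comp (measurable_mulVec A)) (fun c z hc => by
    simp only [Function.comp_apply, Matrix.mulVec_smul]; exact hom c _ hc)
  have h2 := lintegral_shell_eq hφ hom
  have h3 := lintegral_mulVec hA (ψ := fun z => (shell n).indicator 1 (A⁻¹.mulVec z) * φ z)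
    ((hind.comp (measurable_mulVec _)).mul hφ)
  rw [lintegral_shell_mulVec hAi hφ hom, h2] at h3
  have h4 : ∀ z, A⁻¹.mulVec (A.mulVec z) = z := fun z => by
    rw [Matrix.mulVec_mulVec, Matrix.nonsing_inv_mul _ (isUnit_iff_ne_zero.2 hA),
      Matrix.one_mulVec]
  simp only [h4] at h3
  simp only [Function.comp_apply] at h1
  rw [h1, mul_left_comm] at h3
  exact (ENNReal.mul_right_inj (shellConst_ne_zero n) (shellConst_ne_top n)).1 h3

theorem measurable_mul_left_GL (h : GL (Fin n) ℂ) : Measurable fun g : GL (Fin n) ℂ => h * g := by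
  have h1 : Measurable fun A : Matrix (Fin n) (Fin n) ℂ => (h : Matrix (Fin n) (Fin n) ℂ) * A :=
    (continuous_const.matrix_mul continuous_id).measurable
  exact Measurable.of_comap_le (by
    rw [Units.instMeasurableSpace, MeasurableSpace.comap_comp]
    exact (h1.comp (comap_measurable _)).comap_le)

theorem measurable_toUnits :
    Measurable fun u : Matrix.unitaryGroup (Fin n) ℂ => (Unitary.toUnits u : GL (Fin n) ℂ) :=
  Measurable.of_comap_le (by
    rw [Units.instMeasurableSpace, MeasurableSpace.comap_comp]
    exact measurable_subtype_coe.comap_le)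

theorem eLpNorm_two {f : Matrix.unitaryGroup (Fin n) ℂ → ℂ} :
    eLpNorm f 2 (haarU n) = (∫⁻ u, ‖f u‖ₑ ^ 2 ∂(haarU n)) ^ (1 / 2 : ℝ) := by
  rw [eLpNorm_eq_lintegral_rpow_enorm_toReal two_ne_zero ENNReal.ofNat_ne_top]
  simp

end analysis

/-! ### The unitary principal series of `GL(n, ℂ)` -/

section principalSeries
variable (n : ℕ) [NeZero n]

/-- The maximal parabolic subgroup `P` of `GL(n, ℂ)` of type `(1, n - 1)`: the matrices
`p = (w, a; 0, g)` in block form, `w ∈ GL(1, ℂ)`, `g ∈ GL(n - 1, ℂ)`, `a ∈ ℂⁿ⁻¹`. -/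
def parabolic : Subgroup (GL (Fin n) ℂ) where
  carrier := {p | ∀ i, i ≠ 0 → p i 0 = 0}
  one_mem' i hi := by simp [hi]
  mul_mem' {p r} hp hr i hi := by
    rw [Units.val_mul, Matrix.mul_apply, Finset.sum_eq_single 0]
    · rw [hp i hi, zero_mul]
    · intro j _ hj
      rw [hr j hj, mul_zero]
    · simp
  inv_mem' {p} hp i hi := by
    have key : ∀ i, (p⁻¹ * p : GL (Fin n) ℂ) i 0 = p⁻¹ i 0 * p 0 0 := fun i => by
      rw [Units.val_mul, Matrix.mul_apply, Finset.sum_eq_single 0]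
      · intro j _ hj
        rw [hp j hj, mul_zero]
      · simp
    have h0 := key 0
    have hi' := key i
    rw [inv_mul_cancel] at h0 hi'
    simp only [Units.val_one, Matrix.one_apply_eq, Matrix.one_apply_ne hi] at h0 hi'
    rcases mul_eq_zero.1 hi'.symm with h | h
    · exact h
    · rw [h, mul_zero] at h0
      exact absurd h0 one_ne_zero

variable {n}

/-- The character `χ_{t,k}(p) = |w|^t (w / |w|)^k` of `P`, where `w` is the upper left entry. -/
def chi (t : ℂ) (k : ℤ) (p : GL (Fin n) ℂ) : ℂ :=
  (‖p 0 0‖ : ℂ) ^ t * (p 0 0 / (‖p 0 0‖ : ℂ)) ^ k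

/-- The square root `δ_P^{1/2}` of the modular function `δ_P(p) = |det_ℝ Ad(p)|_𝔫|`. The element
`p = (w, a; 0, g)` acts on `𝔫 ≅ ℂⁿ⁻¹` by `x ↦ w x g⁻¹`, so that
`δ_P(p)^{1/2} = |w|ⁿ⁻¹ / |det g| = |w|ⁿ / |det p|`. -/
def halfModulus (p : GL (Fin n) ℂ) : ℝ := ‖p 0 0‖ ^ n / ‖p.det.val‖

theorem halfModulus_eq {n : ℕ} [NeZero n] (p : GL (Fin n) ℂ) :
    halfModulus p = ‖p 0 0‖ ^ n / ‖(p : Matrix (Fin n) (Fin n) ℂ).det‖ := rfl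

theorem entry_ne_zero {p : GL (Fin n) ℂ} (hp : p ∈ parabolic n) : p 0 0 ≠ 0 := by
  intro h0
  have hcol : col0 (p : Matrix (Fin n) (Fin n) ℂ) = 0 := by
    ext i
    by_cases hi : i = 0
    · rw [hi]; exact h0
    · exact hp i hi
  have h1 := congrFun (col0_mul ((p⁻¹ : GL (Fin n) ℂ) : Matrix (Fin n) (Fin n) ℂ) p) 0
  rw [hcol, Matrix.mulVec_zero, ← Units.val_mul, inv_mul_cancel] at h1
  simp [col0] at h1

theorem norm_chi (lam : ℝ) (k : ℤ) {p : GL (Fin n) ℂ} (hp : p ∈ parabolic n) :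
    ‖chi (Complex.I * lam) k p‖ = 1 := by
  have h0 : 0 < ‖p 0 0‖ := norm_pos_iff.2 (entry_ne_zero hp)
  rw [chi, norm_mul, norm_zpow, norm_div, Complex.norm_cpow_eq_rpow_re_of_pos h0]
  simp [h0.ne']

variable (n)

/-- The functions of the normalized parabolic induction `Ind_P^G(χ_{iλ,k})`: Borel functions
`F : G → ℂ` with `F(gp) = δ_P(p)^{-1/2} χ_{iλ,k}(p)⁻¹ F(g)` that are square integrable on
`K = U(n)`. Equivalently, these are the `L²`-sections over `G/P` of the line bundle
`G ×_P χ_{iλ,k}` tensored with the bundle of half-densities. -/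
def inducedFunctions (lam : ℝ) (k : ℤ) : Submodule ℂ (GL (Fin n) ℂ → ℂ) where
  carrier := {F | Measurable F ∧
    (∀ g, ∀ p ∈ parabolic n,
      F (g * p) = ((halfModulus p : ℂ) * chi (Complex.I * lam) k p)⁻¹ * F g) ∧
    MemLp (fun u : Matrix.unitaryGroup (Fin n) ℂ => F (Unitary.toUnits u)) 2 (haarU n)}
  zero_mem' := ⟨measurable_const, fun g p _ => by simp, MemLp.zero⟩
  add_mem' {F F'} hF hF' := ⟨hF.1.add hF'.1,
    fun g p hp => by simp only [Pi.add_apply]; rw [hF.2.1 g p hp, hF'.2.1 g p hp, mul_add],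
    hF.2.2.add hF'.2.2⟩
  smul_mem' c F hF := ⟨hF.1.const_smul c,
    fun g p hp => by
      simp only [Pi.smul_apply, smul_eq_mul]; rw [hF.2.1 g p hp, mul_left_comm],
    hF.2.2.const_smul c⟩

/-- The space of functions `inducedFunctions`, with the inner product of `L²(K)` below. -/
def IndSpace (lam : ℝ) (k : ℤ) : Type := inducedFunctions n lam k

theorem IndSpace.ext {n : ℕ} [NeZero n] {lam : ℝ} {k : ℤ} {F F' : IndSpace n lam k}
    (h : ∀ g, F.1 g = F'.1 g) : F = F' :=
  Subtype.ext (funext h)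

instance (lam : ℝ) (k : ℤ) : AddCommGroup (IndSpace n lam k) :=
  inferInstanceAs (AddCommGroup (inducedFunctions n lam k))

instance (lam : ℝ) (k : ℤ) : Module ℂ (IndSpace n lam k) :=
  inferInstanceAs (Module ℂ (inducedFunctions n lam k))

variable {n}

/-- Restriction to `K = U(n)`. -/
def restrictK {lam : ℝ} {k : ℤ} : IndSpace n lam k →ₗ[ℂ] Lp ℂ 2 (haarU n) where
  toFun F := F.2.2.2.toLp _
  map_add' F F' := MemLp.toLp_add F.2.2.2 F'.2.2.2
  map_smul' c F := MemLp.toLp_const_smul c F.2.2.2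

instance (lam : ℝ) (k : ℤ) : SeminormedAddCommGroup (IndSpace n lam k) :=
  SeminormedAddCommGroup.induced (IndSpace n lam k) (Lp ℂ 2 (haarU n)) restrictK

instance (lam : ℝ) (k : ℤ) : InnerProductSpace ℂ (IndSpace n lam k) where
  norm_smul_le c F := by
    change ‖restrictK (c • F)‖ ≤ ‖c‖ * ‖restrictK F‖
    rw [map_smul, norm_smul]
  inner F F' := ⟪restrictK F, restrictK F'⟫_ℂ
  norm_sq_eq_re_inner F := norm_sq_eq_re_inner (𝕜 := ℂ) (restrictK F)
  conj_inner_symm F F' := inner_conj_symm (restrictK F) (restrictK F')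
  add_left F F' F'' := by rw [map_add, inner_add_left]
  smul_left F F' c := by rw [map_smul, inner_smul_left]


/-- The growth of an equivariant function along a ratio of first columns. -/
theorem norm_apply_of_col0 {lam : ℝ} {k : ℤ} (F : IndSpace n lam k) {g g' : GL (Fin n) ℂ} {c : ℂ}
    (h : col0 (g : Matrix (Fin n) (Fin n) ℂ) = c • col0 (g' : Matrix (Fin n) (Fin n) ℂ)) :
    ‖F.1 g‖ * (‖c‖ ^ n * ‖(g' : Matrix (Fin n) (Fin n) ℂ).det‖) =
      ‖F.1 g'‖ * ‖(g : Matrix (Fin n) (Fin n) ℂ).det‖ := by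
  set p := g'⁻¹ * g with hp
  have hcol : col0 (p : Matrix (Fin n) (Fin n) ℂ) = c • Pi.single 0 1 := by
    rw [hp, Units.val_mul, col0_mul, h, Matrix.mulVec_smul, ← col0_mul, ← Units.val_mul,
      inv_mul_cancel]
    congr 1
    ext i
    by_cases hi : i = 0
    · subst hi; simp [col0]
    · simp [col0, hi]
  have hP : p ∈ parabolic n := fun i hi => by
    have := congrFun hcol i
    simpa [col0, hi] using this
  have hc : p 0 0 = c := by
    have := congrFun hcol 0
    simpa [col0] using this
  have hc0 : c ≠ 0 := hc ▸ entry_ne_zero hP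
  have hg : g = g' * p := by rw [hp, mul_inv_cancel_left]
  have hd : (p : Matrix (Fin n) (Fin n) ℂ).det ≠ 0 := (Matrix.GeneralLinearGroup.det p).ne_zero
  have hF : F.1 g = ((halfModulus p : ℂ) * chi (Complex.I * lam) k p)⁻¹ * F.1 g' := by
    conv_lhs => rw [hg]
    exact F.2.2.1 g' p hP
  have hdet : (g : Matrix (Fin n) (Fin n) ℂ).det =
      (g' : Matrix (Fin n) (Fin n) ℂ).det * (p : Matrix (Fin n) (Fin n) ℂ).det := by
    conv_lhs => rw [hg]
    rw [Units.val_mul, Matrix.det_mul]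
  rw [hF, hdet, norm_mul, norm_inv, norm_mul, norm_chi lam k hP, mul_one, Complex.norm_real,
    halfModulus_eq, hc, norm_mul]
  have hn1 : ‖c‖ ≠ 0 := norm_ne_zero_iff.2 hc0
  have hn2 := norm_ne_zero_iff.2 hd
  rw [Real.norm_of_nonneg (by positivity)]
  field_simp

/-- An invertible matrix with prescribed column of index `0`. -/
def withCol0 (z : Fin n → ℂ) (hz : z 0 ≠ 0) : GL (Fin n) ℂ :=
  Matrix.GeneralLinearGroup.mkOfDetNeZero ((1 : Matrix (Fin n) (Fin n) ℂ).updateCol 0 z) (by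
    rw [← Matrix.cramer_apply, Matrix.cramer_one]; exact hz)

theorem det_withCol0 (z : Fin n → ℂ) (hz : z 0 ≠ 0) :
    (withCol0 z hz : Matrix (Fin n) (Fin n) ℂ).det = z 0 := by
  change ((1 : Matrix (Fin n) (Fin n) ℂ).updateCol 0 z).det = z 0
  rw [← Matrix.cramer_apply, Matrix.cramer_one]; rfl

theorem col0_withCol0 (z : Fin n → ℂ) (hz : z 0 ≠ 0) :
    col0 (withCol0 z hz : Matrix (Fin n) (Fin n) ℂ) = z := by
  ext i
  change ((1 : Matrix (Fin n) (Fin n) ℂ).updateCol 0 z) i 0 = z i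
  simp

open Classical in
/-- The density on `ℂⁿ ∖ {0}`, homogeneous of degree `-2n`, attached to an element of the induced
space. -/
def density {lam : ℝ} {k : ℤ} (F : IndSpace n lam k) (z : Fin n → ℂ) : ℝ≥0∞ :=
  if hz : z 0 ≠ 0 then (‖F.1 (withCol0 z hz)‖ₑ / ‖z 0‖ₑ) ^ 2 else 0

theorem measurable_density {lam : ℝ} {k : ℤ} (F : IndSpace n lam k) : Measurable (density F) := by
  classical
  have hs : MeasurableSet {z : Fin n → ℂ | z 0 ≠ 0} :=
    (measurableSet_singleton (0 : ℂ)).compl.preimage (measurable_pi_apply 0)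
  refine Measurable.dite (s := {z : Fin n → ℂ | z 0 ≠ 0})
    (f := fun z => (‖F.1 (withCol0 z.1 z.2)‖ₑ / ‖z.1 0‖ₑ) ^ 2) (g := fun _ => 0) ?_
    measurable_const hs
  have h1 : Measurable fun z : {z : Fin n → ℂ | z 0 ≠ 0} => withCol0 z.1 z.2 :=
    Measurable.of_comap_le (by
      rw [Units.instMeasurableSpace, MeasurableSpace.comap_comp]
      have : Measurable fun z : {z : Fin n → ℂ | z 0 ≠ 0} =>
          (1 : Matrix (Fin n) (Fin n) ℂ).updateCol 0 z.1 :=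
        (continuous_const.matrix_updateCol 0 continuous_subtype_val).measurable
      exact this.comap_le)
  exact ((F.2.1.comp h1).enorm.div
    ((measurable_pi_apply 0).comp measurable_subtype_coe).enorm).pow_const 2

theorem density_hom {lam : ℝ} {k : ℤ} (F : IndSpace n lam k) (c : ℂ) (z : Fin n → ℂ)
    (hc : c ≠ 0) : ‖c‖ₑ ^ (2 * n) * density F (c • z) = density F z := by
  by_cases hz : z 0 ≠ 0
  · have hcz : (c • z) 0 ≠ 0 := mul_ne_zero hc hz
    rw [density, density, dif_pos hz, dif_pos hcz]
    have h := norm_apply_of_col0 F (g := withCol0 (c • z) hcz) (g' := withCol0 z hz) (c := c)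
      (by rw [col0_withCol0, col0_withCol0])
    rw [det_withCol0, det_withCol0, Pi.smul_apply, smul_eq_mul, norm_mul] at h
    rw [Pi.smul_apply, smul_eq_mul, pow_mul', ← mul_pow]
    congr 1
    have hc' : ‖c‖ ≠ 0 := norm_ne_zero_iff.2 hc
    have hz' : ‖z 0‖ ≠ 0 := norm_ne_zero_iff.2 hz
    rw [← ofReal_norm, ← ofReal_norm, ← ofReal_norm, ← ofReal_norm, ← ofReal_norm, norm_mul,
      ← ENNReal.ofReal_div_of_pos (by positivity), ← ENNReal.ofReal_div_of_pos (by positivity),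
      ← ENNReal.ofReal_pow (by positivity), ← ENNReal.ofReal_mul (by positivity)]
    congr 1
    field_simp
    have : ‖z 0‖ * (‖F.1 (withCol0 (c • z) hcz)‖ * ‖c‖ ^ n) =
        ‖z 0‖ * (‖F.1 (withCol0 z hz)‖ * ‖c‖) := by linarith
    have := mul_left_cancel₀ hz' this
    linarith
  · have hcz : ¬ (c • z) 0 ≠ 0 := by
      simp only [ne_eq, not_not] at hz
      simp [hz]
    rw [density, density, dif_neg hz, dif_neg hcz, mul_zero]

theorem density_col0 {lam : ℝ} {k : ℤ} (F : IndSpace n lam k) (g : GL (Fin n) ℂ)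
    (hg : g 0 0 ≠ 0) :
    ‖F.1 g‖ₑ ^ 2 = ‖(g : Matrix (Fin n) (Fin n) ℂ).det‖ₑ ^ 2 *
      density F (col0 (g : Matrix (Fin n) (Fin n) ℂ)) := by
  have hz : (col0 (g : Matrix (Fin n) (Fin n) ℂ)) 0 ≠ 0 := hg
  rw [density, dif_pos hz, ← mul_pow]
  congr 1
  have h := norm_apply_of_col0 F (g := g) (g' := withCol0 _ hz) (c := 1)
    (by rw [col0_withCol0, one_smul])
  rw [det_withCol0, norm_one, one_pow, one_mul] at h
  have hz' : ‖col0 (g : Matrix (Fin n) (Fin n) ℂ) 0‖ ≠ 0 := norm_ne_zero_iff.2 hz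
  rw [← ofReal_norm, ← ofReal_norm, ← ofReal_norm, ← ofReal_norm,
    ← ENNReal.ofReal_div_of_pos (by positivity), ← ENNReal.ofReal_mul (by positivity)]
  congr 1
  field_simp
  linarith

/-- A linear form vanishes on a null set of unit vectors. -/
theorem ae_entry_ne_zero (h : GL (Fin n) ℂ) :
    ∀ᵐ u : Matrix.unitaryGroup (Fin n) ℂ ∂(haarU n), (h * Unitary.toUnits u : GL (Fin n) ℂ) 0 0 ≠ 0 := by
  classical
  set f : (Fin n → ℂ) →ₗ[ℝ] ℂ :=
    ((LinearMap.proj 0).comp (Matrix.toLin' (h : Matrix (Fin n) (Fin n) ℂ))).restrictScalars ℝ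
    with hf
  have hfm : Measurable f :=
    (measurable_pi_apply 0).comp (measurable_mulVec (h : Matrix (Fin n) (Fin n) ℂ))
  set φ : (Fin n → ℂ) → ℝ≥0∞ :=
    fun z => {z | f z = 0}.indicator (fun z => (‖euclNorm z‖ₑ ^ (2 * n))⁻¹) z with hφdef
  have hS : MeasurableSet {z | f z = 0} := hfm (measurableSet_singleton 0)
  have hφ : Measurable φ :=
    ((continuous_euclNorm.measurable.enorm.pow_const _).inv).indicator hS
  have hom : ∀ (c : ℂ) (z : Fin n → ℂ), c ≠ 0 → ‖c‖ₑ ^ (2 * n) * φ (c • z) = φ z := by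
    intro c z hc
    have hfc : f (c • z) = c * f z := by
      simp [hf]
    by_cases hz : f z = 0
    · have h1 : c • z ∈ {z | f z = 0} := by
        rw [Set.mem_ofPred_eq, hfc, hz, mul_zero]
      have h2 : z ∈ {z | f z = 0} := hz
      simp only [hφdef, Set.indicator_of_mem h1, Set.indicator_of_mem h2]
      have h3 : ‖euclNorm (c • z)‖ₑ = ‖c‖ₑ * ‖euclNorm z‖ₑ := by
        rw [euclNorm_smul, enorm_mul, ← ofReal_norm, norm_norm, ofReal_norm]
      have hc1 : ‖c‖ₑ ^ (2 * n) ≠ 0 := pow_ne_zero _ (by simpa using hc)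
      have hc2 : ‖c‖ₑ ^ (2 * n) ≠ ∞ := ENNReal.pow_ne_top enorm_ne_top
      rw [h3, mul_pow, ENNReal.mul_inv (Or.inl hc1) (Or.inl hc2), ← mul_assoc,
        ENNReal.mul_inv_cancel hc1 hc2, one_mul]
    · have h1 : c • z ∉ {z | f z = 0} := by
        rw [Set.mem_ofPred_eq, hfc]; exact mul_ne_zero hc hz
      have h2 : z ∉ {z | f z = 0} := hz
      simp only [hφdef, Set.indicator_of_notMem h1, Set.indicator_of_notMem h2, mul_zero]
  have hvol : (volume : Measure (Fin n → ℂ)) {z | f z = 0} = 0 := by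
    refine Measure.addHaar_submodule volume (LinearMap.ker f) ?_
    intro htop
    have : f (((h⁻¹ : GL (Fin n) ℂ) : Matrix (Fin n) (Fin n) ℂ).mulVec (Pi.single 0 1)) = 0 := by
      have : ((h⁻¹ : GL (Fin n) ℂ) : Matrix (Fin n) (Fin n) ℂ).mulVec (Pi.single 0 1) ∈
          LinearMap.ker f := htop ▸ Submodule.mem_top
      exact this
    have h2 : f (((h⁻¹ : GL (Fin n) ℂ) : Matrix (Fin n) (Fin n) ℂ).mulVec (Pi.single 0 1)) = 1 := by
      change ((h : Matrix (Fin n) (Fin n) ℂ).mulVec _) 0 = 1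
      rw [Matrix.mulVec_mulVec, ← Units.val_mul, mul_inv_cancel, Units.val_one, Matrix.one_mulVec]
      simp
    rw [h2] at this
    exact one_ne_zero this
  have h0 : ∫⁻ z, (shell n).indicator 1 z * φ z = 0 := by
    have hm : Measurable fun z : Fin n → ℂ =>
        (shell n).indicator (1 : (Fin n → ℂ) → ℝ≥0∞) z * φ z :=
      (measurable_one.indicator measurableSet_shell).mul hφ
    rw [lintegral_eq_zero_iff hm]
    have : ∀ᵐ z : Fin n → ℂ, f z ≠ 0 := by
      rw [ae_iff]; simpa using hvol
    filter_upwards [this] with z hz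
    have : z ∉ {z | f z = 0} := hz
    simp [hφdef, Set.indicator_of_notMem this]
  have hm' : Measurable fun u : Matrix.unitaryGroup (Fin n) ℂ =>
      φ (col0 (u : Matrix (Fin n) (Fin n) ℂ)) := hφ.comp measurable_col0
  rw [lintegral_shell_eq hφ hom, mul_eq_zero, or_iff_right (shellConst_ne_zero n),
    lintegral_eq_zero_iff hm'] at h0
  filter_upwards [h0] with u hu hz
  have h1 : col0 (u : Matrix (Fin n) (Fin n) ℂ) ∈ {z | f z = 0} := hz
  simp only [hφdef, Set.indicator_of_mem h1, Pi.zero_apply,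
    ENNReal.inv_eq_zero] at hu
  exact ENNReal.pow_ne_top enorm_ne_top hu

/-- Invariance of the norm under left translation. -/
theorem lintegral_translate {lam : ℝ} {k : ℤ} (F : IndSpace n lam k) (h : GL (Fin n) ℂ) :
    ∫⁻ u, ‖F.1 (h * Unitary.toUnits u)‖ₑ ^ 2 ∂(haarU n) =
      ∫⁻ u, ‖F.1 (Unitary.toUnits u)‖ₑ ^ 2 ∂(haarU n) := by
  have key : ∀ h : GL (Fin n) ℂ, ∫⁻ u, ‖F.1 (h * Unitary.toUnits u)‖ₑ ^ 2 ∂(haarU n) =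
      ∫⁻ u, density F (col0 (u : Matrix (Fin n) (Fin n) ℂ)) ∂(haarU n) := by
    intro h
    have hd : (h : Matrix (Fin n) (Fin n) ℂ).det ≠ 0 := (Matrix.GeneralLinearGroup.det h).ne_zero
    rw [← lintegral_col0_mul hd (measurable_density F) (density_hom F), ← lintegral_const_mul]
    · refine lintegral_congr_ae ?_
      filter_upwards [ae_entry_ne_zero h] with u hu
      rw [density_col0 F _ hu, Units.val_mul, Matrix.det_mul]
      have : ‖((Unitary.toUnits u : GL (Fin n) ℂ) : Matrix (Fin n) (Fin n) ℂ).det‖ₑ = 1 := by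
        rw [← ofReal_norm]
        have : ‖(u : Matrix (Fin n) (Fin n) ℂ).det‖ = 1 :=
          CStarRing.norm_of_mem_unitary (Matrix.det_of_mem_unitary u.2)
        rw [show ((Unitary.toUnits u : GL (Fin n) ℂ) : Matrix (Fin n) (Fin n) ℂ) = u from rfl,
          this, ENNReal.ofReal_one]
      rw [enorm_mul, this, mul_one]
      rfl
    · exact (measurable_density F).comp ((measurable_mulVec _).comp measurable_col0)
  rw [key h]
  simpa using (key 1).symm

theorem norm_indSpace {lam : ℝ} {k : ℤ} (F : IndSpace n lam k) :
    ‖F‖ = (eLpNorm (fun u : Matrix.unitaryGroup (Fin n) ℂ => F.1 (Unitary.toUnits u)) 2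
      (haarU n)).toReal :=
  Lp.norm_toLp _ F.2.2.2

theorem eLpNorm_translate {lam : ℝ} {k : ℤ} (F : IndSpace n lam k) (h : GL (Fin n) ℂ) :
    eLpNorm (fun u : Matrix.unitaryGroup (Fin n) ℂ => F.1 (h * Unitary.toUnits u)) 2 (haarU n) =
      eLpNorm (fun u : Matrix.unitaryGroup (Fin n) ℂ => F.1 (Unitary.toUnits u)) 2 (haarU n) := by
  rw [eLpNorm_two, eLpNorm_two, lintegral_translate F h]

/-- The left regular action `(g F)(x) = F(g⁻¹ x)` on the induced space. -/
def leftRegular (lam : ℝ) (k : ℤ) : GL (Fin n) ℂ →* (IndSpace n lam k ≃ₗᵢ[ℂ] IndSpace n lam k) :=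
  let act : GL (Fin n) ℂ → IndSpace n lam k →ₗᵢ[ℂ] IndSpace n lam k := fun g =>
    { toFun := fun F => ⟨fun x => F.1 (g⁻¹ * x), F.2.1.comp (measurable_mul_left_GL g⁻¹),
        fun x p hp => by simpa only [mul_assoc] using F.2.2.1 (g⁻¹ * x) p hp,
        ((F.2.1.comp (measurable_mul_left_GL g⁻¹)).comp measurable_toUnits).aestronglyMeasurable,
        by
          change eLpNorm (fun u => F.1 (g⁻¹ * Unitary.toUnits u)) 2 (haarU n) < ∞
          rw [eLpNorm_translate]; exact F.2.2.2.2⟩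
      map_add' := fun F F' => rfl
      map_smul' := fun c F => rfl
      norm_map' := fun F => by
        rw [norm_indSpace, norm_indSpace]
        exact congrArg ENNReal.toReal (eLpNorm_translate F g⁻¹) }
  ofIsometries act
    (fun F => IndSpace.ext fun x => by
      change F.1 (1⁻¹ * x) = F.1 x
      rw [inv_one, one_mul])
    (fun g h F => IndSpace.ext fun x => by
      change F.1 ((g * h)⁻¹ * x) = F.1 (h⁻¹ * (g⁻¹ * x))
      rw [mul_inv_rev, mul_assoc])

theorem euclNorm_col0_mul (g : GL (Fin n) ℂ) {p : GL (Fin n) ℂ} (hp : p ∈ parabolic n) :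
    euclNorm (col0 ((g * p : GL (Fin n) ℂ) : Matrix (Fin n) (Fin n) ℂ)) =
      ‖p 0 0‖ * euclNorm (col0 (g : Matrix (Fin n) (Fin n) ℂ)) := by
  rw [← euclNorm_smul]
  congr 1
  ext i
  rw [Units.val_mul]
  simp only [col0, Matrix.mul_apply, Pi.smul_apply, smul_eq_mul]
  rw [Finset.sum_eq_single 0]
  · ring
  · intro j _ hj
    rw [hp j hj, mul_zero]
  · simp

theorem euclNorm_col0_pos (g : GL (Fin n) ℂ) :
    0 < euclNorm (col0 (g : Matrix (Fin n) (Fin n) ℂ)) := by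
  refine euclNorm_pos fun h => ?_
  have h1 := congrFun (col0_mul ((g⁻¹ : GL (Fin n) ℂ) : Matrix (Fin n) (Fin n) ℂ) g) 0
  rw [h, Matrix.mulVec_zero, ← Units.val_mul, inv_mul_cancel] at h1
  simp [col0] at h1

theorem euclNorm_col0_unitary (u : Matrix.unitaryGroup (Fin n) ℂ) :
    euclNorm (col0 ((Unitary.toUnits u : GL (Fin n) ℂ) : Matrix (Fin n) (Fin n) ℂ)) = 1 := by
  have h := euclNorm_unitary u (Pi.single 0 1)
  have h1 : (u : Matrix (Fin n) (Fin n) ℂ).mulVec (Pi.single 0 1) =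
      col0 (u : Matrix (Fin n) (Fin n) ℂ) := by
    ext i; simp [col0]
  rw [h1] at h
  exact h.trans (by simp [euclNorm])

theorem measurable_euclNorm_col0 :
    Measurable fun g : GL (Fin n) ℂ => euclNorm (col0 (g : Matrix (Fin n) (Fin n) ℂ)) := by
  have h1 : Measurable fun A : Matrix (Fin n) (Fin n) ℂ => euclNorm (col0 A) := by
    have : Continuous fun A : Matrix (Fin n) (Fin n) ℂ => col0 A :=
      continuous_pi fun i => continuous_id.matrix_elem i 0
    exact (continuous_euclNorm.comp this).measurable
  exact h1.comp (comap_measurable _)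

/-- Multiplication by `g ↦ |g e₁|^{i(λ - λ')}`. -/
def changeParameterLinear (lam lam' : ℝ) (k : ℤ) :
    IndSpace n lam k →ₗᵢ[ℂ] IndSpace n lam' k :=
  have hK : ∀ (F : GL (Fin n) ℂ → ℂ) (u : Matrix.unitaryGroup (Fin n) ℂ),
      (euclNorm (col0 ((Unitary.toUnits u : GL (Fin n) ℂ) : Matrix (Fin n) (Fin n) ℂ)) : ℂ) ^
        (Complex.I * (lam - lam')) * F (Unitary.toUnits u) = F (Unitary.toUnits u) := by
    intro F u
    rw [euclNorm_col0_unitary]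
    simp
  { toFun := fun F => ⟨fun g => (euclNorm (col0 (g : Matrix (Fin n) (Fin n) ℂ)) : ℂ) ^
        (Complex.I * (lam - lam')) * F.1 g,
      ((Complex.measurable_ofReal.comp measurable_euclNorm_col0).pow_const _).mul F.2.1,
      fun g p hp => by
        have hw : 0 < ‖p 0 0‖ := norm_pos_iff.2 (entry_ne_zero hp)
        have hw' : (‖p 0 0‖ : ℂ) ≠ 0 := by exact_mod_cast hw.ne'
        have e1 : (‖p 0 0‖ : ℂ) ^ (Complex.I * lam) =
            (‖p 0 0‖ : ℂ) ^ (Complex.I * lam') * (‖p 0 0‖ : ℂ) ^ (Complex.I * (lam - lam')) := by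
          rw [← Complex.cpow_add _ _ hw']; congr 1; ring
        have e2 : (‖p 0 0‖ : ℂ) ^ (Complex.I * (lam - lam')) ≠ 0 := by
          simp [Complex.cpow_eq_zero_iff, hw']
        have hF : F.1 (g * p) = ((halfModulus p : ℂ) * chi (Complex.I * lam) k p)⁻¹ * F.1 g :=
          F.2.2.1 g p hp
        beta_reduce
        rw [hF, euclNorm_col0_mul g hp, Complex.ofReal_mul,
          Complex.mul_cpow_ofReal_nonneg hw.le (euclNorm_col0_pos g).le, chi, chi, e1]
        simp only [mul_inv]
        field_simp,
      by simpa only [hK] using F.2.2.2⟩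
    map_add' := fun F F' => IndSpace.ext fun g => mul_add _ _ _
    map_smul' := fun c F => IndSpace.ext fun g => mul_left_comm _ _ _
    norm_map' := fun F => by
      rw [norm_indSpace, norm_indSpace]
      congr 2
      ext u
      exact hK F.1 u }

/-- The isometric isomorphism between the induced spaces with parameters `(λ, k)` and `(λ', k)` that
is the identity on restrictions to `K = U(n)`: multiplication by `g ↦ |g e₁|^{i(λ - λ')}`. -/
def changeParameter (lam lam' : ℝ) (k : ℤ) : IndSpace n lam k ≃ₗᵢ[ℂ] IndSpace n lam' k :=
  have hinv : ∀ (l l' : ℝ) (F : IndSpace n l k),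
      changeParameterLinear l' l k (changeParameterLinear l l' k F) = F := by
    intro l l' F
    apply Subtype.ext
    funext g
    have h0 : (euclNorm (col0 (g : Matrix (Fin n) (Fin n) ℂ)) : ℂ) ≠ 0 := by
      exact_mod_cast (euclNorm_col0_pos g).ne'
    change (euclNorm (col0 (g : Matrix (Fin n) (Fin n) ℂ)) : ℂ) ^ (Complex.I * (l' - l)) *
      ((euclNorm (col0 (g : Matrix (Fin n) (Fin n) ℂ)) : ℂ) ^ (Complex.I * (l - l')) * F.1 g) =
        F.1 g
    rw [← mul_assoc, ← Complex.cpow_add _ _ h0,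
      show Complex.I * ((l' : ℂ) - l) + Complex.I * (l - l') = 0 by ring, Complex.cpow_zero,
      one_mul]
  { toLinearEquiv := LinearEquiv.ofLinearMap (changeParameterLinear lam lam' k).toLinearMap
      (changeParameterLinear lam' lam k).toLinearMap
      (LinearMap.ext fun F => hinv lam' lam F) (LinearMap.ext fun F => hinv lam lam' F)
    norm_map' := (changeParameterLinear lam lam' k).norm_map }

variable (n)

/-- The Hilbert space of `π_{iλ,k}`. The completion divides out the functions vanishing almost
everywhere. -/
abbrev PrincipalSeriesSpace (lam : ℝ) (k : ℤ) := Completion (IndSpace n lam k)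

/-- The unitary principal series representation `π_{iλ,k} = Ind_P^G(χ_{iλ,k})` of `G = GL(n, ℂ)`;
for `n = 1` it is the character `χ_{iλ,k}`. -/
def principalSeries (lam : ℝ) (k : ℤ) :
    UnitaryRep (GL (Fin n) ℂ) (PrincipalSeriesSpace n lam k) :=
  completionRep (leftRegular lam k)

/-- The identification of the Hilbert spaces of `π_{iλ,k}` and `π_{0,k}` by restriction to `K`. -/
def trivialization (lam : ℝ) (k : ℤ) :
    PrincipalSeriesSpace n lam k ≃ₗᵢ[ℂ] PrincipalSeriesSpace n 0 k :=
  completionCongr (changeParameter lam 0 k)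

end principalSeries

/-! ### The branching problem -/

/-- The embedding `GL(p, ℂ) × GL(q, ℂ) → GL(p + q, ℂ)` as block diagonal matrices. -/
def blockDiag (p q : ℕ) : GL (Fin p) ℂ × GL (Fin q) ℂ →* GL (Fin (p + q)) ℂ :=
  (Units.map
    { toFun := fun A : Matrix (Fin p) (Fin p) ℂ × Matrix (Fin q) (Fin q) ℂ =>
        Matrix.reindex finSumFinEquiv finSumFinEquiv (Matrix.fromBlocks A.1 0 0 A.2)
      map_one' := by simp
      map_mul' := fun A B => by
        simp [Matrix.submatrix_mul_equiv, Matrix.fromBlocks_multiply] }).comp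
    (MulEquiv.prodUnits (M := Matrix (Fin p) (Fin p) ℂ)
      (N := Matrix (Fin q) (Fin q) ℂ)).symm.toMonoidHom

/-- The field `λ' ↦ π_{iλ',k'} ⊗ π_{i(λ-λ'),k-k'}` of unitary representations of
`GL(p, ℂ) × GL(q, ℂ)`. The fibres are identified with the fixed Hilbert space
`π_{0,k'} ⊗ π_{0,k-k'}` by restriction to `U(p) × U(q)`. -/
def branchingField (p q : ℕ) [NeZero p] [NeZero q] (lam : ℝ) (k k' : ℤ) (lam' : ℝ) :
    UnitaryRep (GL (Fin p) ℂ × GL (Fin q) ℂ)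
      (HilbertTensor (PrincipalSeriesSpace p 0 k') (PrincipalSeriesSpace q 0 (k - k'))) :=
  transport
    (completionCongr (TensorProduct.congrIsometry (trivialization p lam' k')
      (trivialization q (lam - lam') (k - k'))))
    (outerTensor (principalSeries p lam' k') (principalSeries q (lam - lam') (k - k')))

end

end GLBranching

namespace GLBranching

noncomputable section

/-! In the projective space of ℂ^p ⊕ ℂ^q the lines through (x, y) with x and y nonzero form an open
orbit of H₁ with null complement. It fibres over the product of the projective spaces of ℂ^p and
ℂ^q, with fibre ℂˣ = U(1) × ℝ₊, the relative scale of x and y. Fourier series along U(1) give the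
sum over k', the Mellin transform along ℝ₊ gives the integral over λ', and Plancherel's theorem
makes Lebesgue measure the right measure up to a constant.

No intertwining operator is written down. Two total families with the same index set are shown to
have the same matrix coefficients up to one positive constant, and
`unitarilyEquivalent_of_proportional` builds the operator from this. For a Schwartz function φ and
homogeneous functions f₁ on ℂ^p and f₂ on ℂ^q, `targetVec` is φ(λ') times f₁ ⊗ f₂ in the summand k',
and `sourceVec` is the function |y|^(-iλ) f₁(x) f₂(y) φ̂((log |x| - log |y|) / 2π) on ℂ^(p+q).

To compute the coefficients in the source, `lintegral_branch` and `integral_branch` rewrite an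
integral over U(p + q) as one over U(p) × U(q) × ℝ. There the action of (g, h) shifts the real
variable by an amount depending on the unit vectors. Plancherel's formula
(`integral_conj_fourier_mul_translate`) turns the shift s into the phase e^(-isξ), which together
with the power of |y| splits into the twists of the compact pictures with parameters ξ and λ - ξ.
The result is `inner_leftRegular_branchFun_fourier`. Distinct k' do not interact, because the scalar
unitary matrices act by different characters (`sectionCoeff_eq_zero`).

Totality in the target is formal. In the source (`isTotal_sourceVec`) it comes from the
Stone–Weierstrass theorem on the unit sphere: a monomial in the coordinates and their conjugates
factors into a function of x and one of y. If it has the phase of the induced space, it is almost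
everywhere an elementary function with the square integrable profile `branchProfile`; otherwise it
is orthogonal to the induced space. Measurability of the field holds because its matrix coefficients
are continuous in λ', which for unitary operators gives strong continuity
(`continuous_unitary_apply`). -/

/-- Two unitary representations with total families of vectors having the same matrix coefficients
are unitarily equivalent. -/
theorem unitarilyEquivalent_of_matrixCoeff {G H H' ι : Type*} [Group G]
    [NormedAddCommGroup H] [InnerProductSpace ℂ H] [CompleteSpace H]
    [NormedAddCommGroup H'] [InnerProductSpace ℂ H'] [CompleteSpace H']
    (π : UnitaryRep G H) (τ : UnitaryRep G H') (v : ι → H) (w : ι → H')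
    (hv : (Submodule.span ℂ (Set.range v)).topologicalClosure = ⊤)
    (hw : (Submodule.span ℂ (Set.range w)).topologicalClosure = ⊤)
    (h : ∀ g i j, ⟪v i, π g (v j)⟫_ℂ = ⟪w i, τ g (w j)⟫_ℂ) : UnitarilyEquivalent π τ := by
  set a := Finsupp.linearCombination ℂ v
  set b := Finsupp.linearCombination ℂ w
  have ha : DenseRange a := by
    rw [← Submodule.dense_iff_topologicalClosure_eq_top, ← Finsupp.range_linearCombination] at hv
    exact hv
  have hb : DenseRange b := by
    rw [← Submodule.dense_iff_topologicalClosure_eq_top, ← Finsupp.range_linearCombination] at hw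
    exact hw
  have hab : ∀ g x y, ⟪a x, π g (a y)⟫_ℂ = ⟪b x, τ g (b y)⟫_ℂ := by
    intro g x y
    simp only [a, b, Finsupp.linearCombination_apply, Finsupp.sum, map_sum, sum_inner, inner_sum,
      map_smul, inner_smul_left, inner_smul_right, h]
  -- The case g = 1: both maps out of the free space induce the same seminorm, so no linear
  -- independence of the families is needed.
  have hnorm : ∀ x, ‖b (LinearEquiv.refl ℂ _ x)‖ = ‖a x‖ := fun x => by
    have := hab 1 x x
    simp only [map_one, LinearIsometryEquiv.coe_one, id] at this
    rw [LinearEquiv.refl_apply, norm_eq_sqrt_re_inner (𝕜 := ℂ), norm_eq_sqrt_re_inner (𝕜 := ℂ),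
      this]
  set T := (LinearEquiv.refl ℂ (ι →₀ ℂ)).extendOfIsometry a b ha hb hnorm
  have hT : ∀ x, T (a x) = b x := fun x =>
    LinearEquiv.extendOfIsometry_eq (LinearEquiv.refl ℂ (ι →₀ ℂ)) a b ha hb hnorm x
  refine ⟨T, fun g x => ?_⟩
  refine ha.induction_on (p := fun x => T (π g x) = τ g (T x)) x (isClosed_eq
    (T.continuous.comp (π g).continuous) ((τ g).continuous.comp T.continuous)) fun y => ?_
  -- Tested against the dense range of `b`, the intertwining relation becomes equality of matrix
  -- coefficients.
  refine hb.eq_of_inner_right ℂ fun z => ?_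
  rw [hT, ← hab, ← hT, T.inner_map_map]

/-! ### Plancherel's formula -/

/-- Plancherel's formula for a translate. -/
theorem integral_conj_fourier_mul_translate (φ φ' : SchwartzMap ℝ ℂ) (a : ℝ) :
    ∫ τ : ℝ, star (FourierTransform.fourier φ' τ) * FourierTransform.fourier φ (τ + a) =
      ∫ ξ : ℝ, star (φ' ξ) * φ ξ * Complex.exp (-(2 * Real.pi * a * ξ : ℝ) * Complex.I) := by
  set f : ℝ → ℂ := fun ξ => Complex.exp (-(2 * Real.pi * a * ξ : ℝ) * Complex.I) * φ ξ with hf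
  have hfi : Integrable f := by
    refine φ.integrable.bdd_mul (c := 1)
      (Continuous.aestronglyMeasurable (by fun_prop)) (Filter.Eventually.of_forall fun ξ => ?_)
    rw [← Complex.ofReal_neg, Complex.norm_exp_ofReal_mul_I]
  -- Translating a Fourier transform multiplies the original function by a character.
  have hshift : ∀ τ, FourierTransform.fourier φ (τ + a) = FourierTransform.fourier f τ := by
    intro τ
    rw [SchwartzMap.fourier_coe, Real.fourier_eq', Real.fourier_eq']
    congr 1
    ext ξ
    simp only [hf, smul_eq_mul]
    rw [← mul_assoc, ← Complex.exp_add]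
    congr 2
    simp
    ring
  -- The transform is moved from `f`, which need only be integrable, onto the transform of φ', where
  -- Fourier inversion undoes it.
  have key := VectorFourier.integral_sesq_fourierIntegral_eq_neg_flip (innerSL ℂ)
    (L := innerₗ ℝ) Real.continuous_fourierChar continuous_inner hfi
    (FourierTransform.fourier φ').integrable (μ := volume) (ν := volume)
  have key2 : ∫ τ : ℝ, ⟪FourierTransform.fourier f τ, FourierTransform.fourier φ' τ⟫_ℂ =
      ∫ ξ : ℝ, ⟪f ξ, φ' ξ⟫_ℂ := by
    refine key.trans ?_
    congr 1
    ext ξ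
    have : VectorFourier.fourierIntegral Real.fourierChar volume (-(innerₗ ℝ).flip)
        (FourierTransform.fourier φ') ξ = φ' ξ := by
      have h1 : FourierTransformInv.fourierInv (FourierTransform.fourier φ') ξ = φ' ξ := by simp
      rw [← h1, SchwartzMap.fourierInv_coe]
      simp [Real.fourierInv_eq, VectorFourier.fourierIntegral]
    rw [this]; rfl
  -- The pairing is antilinear in its first slot, which is where `f` stands.
  have key3 := congrArg star key2
  rw [← starRingEnd_apply, ← starRingEnd_apply, ← integral_conj, ← integral_conj] at key3
  have hinner : ∀ z w : ℂ, ⟪z, w⟫_ℂ = star z * w := fun z w => by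
    rw [RCLike.inner_apply, mul_comm]; rfl
  simp only [inner_conj_symm] at key3
  simp only [hinner] at key3
  simp only [hshift]
  rw [key3]
  refine integral_congr_ae (Filter.Eventually.of_forall fun ξ => ?_)
  simp only [hf]
  ring

/-! ### Logarithmic polar coordinates -/

/-- Integration of a radial function in logarithmic polar coordinates. -/
theorem lintegral_fun_norm {E : Type*} [NormedAddCommGroup E] [NormedSpace ℝ E]
    [FiniteDimensional ℝ E] [Nontrivial E] [MeasurableSpace E] [BorelSpace E] (μ : Measure E)
    [μ.IsAddHaarMeasure] {H : ℝ → ℝ≥0∞} (hH : Measurable H) :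
    ∫⁻ x, H ‖x‖ ∂μ = μ.toSphere Set.univ *
      ∫⁻ t : ℝ, ENNReal.ofReal (Real.exp t) ^ Module.finrank ℝ E * H (Real.exp t) := by
  have hH1 : Measurable fun r : Set.Ioi (0 : ℝ) => H r := hH.comp measurable_subtype_coe
  have hH2 : Measurable fun x : Metric.sphere (0 : E) 1 × Set.Ioi (0 : ℝ) => H x.2 :=
    hH1.comp measurable_snd
  have h1 : ∫⁻ x, H ‖x‖ ∂μ = ∫⁻ x : ({(0)}ᶜ : Set E), H ‖x.1‖ ∂(μ.comap (↑)) := by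
    rw [lintegral_subtype_comap (measurableSet_singleton _).compl (fun x => H ‖x‖),
      restrict_compl_singleton]
  have h2 : ∫⁻ x : ({(0)}ᶜ : Set E), H ‖x.1‖ ∂(μ.comap (↑)) =
      ∫⁻ x, H x.2 ∂μ.toSphere.prod (.volumeIoiPow (Module.finrank ℝ E - 1)) := by
    rw [← (μ.measurePreserving_homeomorphUnitSphereProd).lintegral_comp hH2]
    simp
  have h3 : ∫⁻ x, H x.2 ∂μ.toSphere.prod (.volumeIoiPow (Module.finrank ℝ E - 1)) =
      μ.toSphere Set.univ * ∫⁻ r, H r ∂(.volumeIoiPow (Module.finrank ℝ E - 1)) := by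
    rw [lintegral_prod _ hH2.aemeasurable]
    dsimp only
    rw [lintegral_const, mul_comm]
  have h4 : ∫⁻ r, H r ∂(.volumeIoiPow (Module.finrank ℝ E - 1)) =
      ∫⁻ r in Set.Ioi (0 : ℝ), ENNReal.ofReal (r ^ (Module.finrank ℝ E - 1)) * H r := by
    rw [Measure.volumeIoiPow, lintegral_withDensity_eq_lintegral_mul _
      ((measurable_subtype_coe.pow_const _).ennreal_ofReal) hH1, ← lintegral_subtype_comap measurableSet_Ioi
        (fun r : ℝ => ENNReal.ofReal (r ^ (Module.finrank ℝ E - 1)) * H r)]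
    rfl
  -- The substitution r = eᵗ contributes one more factor eᵗ, raising the exponent from d - 1 to the
  -- real dimension d, which is positive since `E` is nontrivial.
  have h5 : ∫⁻ r in Set.Ioi (0 : ℝ), ENNReal.ofReal (r ^ (Module.finrank ℝ E - 1)) * H r =
      ∫⁻ t : ℝ, ENNReal.ofReal (Real.exp t) ^ Module.finrank ℝ E * H (Real.exp t) := by
    rw [← Real.range_exp, ← Set.image_univ, lintegral_image_eq_lintegral_abs_deriv_mul
      MeasurableSet.univ (fun x _ => (Real.hasDerivAt_exp x).hasDerivWithinAt)
      Real.exp_injective.injOn, Measure.restrict_univ]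
    refine lintegral_congr fun t => ?_
    rw [← mul_assoc, abs_of_pos (Real.exp_pos t), ENNReal.ofReal_pow (Real.exp_pos t).le,
      ← pow_succ', Nat.sub_add_cancel Module.finrank_pos]
  rw [h1, h2, h3, h4, h5]

/-- The total mass of the unit sphere of `ℂⁿ`. -/
def sphereMass (n : ℕ) : ℝ≥0∞ :=
  (Measure.map (EuclideanSpace.equiv (Fin n) ℂ).symm volume).toSphere Set.univ

/-- A linear isomorphism over ℝ carries Haar measure to Haar measure. The transport is needed
because `Fin n → ℂ` carries the supremum norm, while polar coordinates are wanted for the Euclidean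
one. -/
instance (n : ℕ) : (Measure.map (EuclideanSpace.equiv (Fin n) ℂ).symm
    (volume : Measure (Fin n → ℂ))).IsAddHaarMeasure :=
  ContinuousLinearEquiv.isAddHaarMeasure_map
    (PiLp.continuousLinearEquiv 2 ℝ (fun _ : Fin n => ℂ)).symm volume

theorem sphereMass_ne_zero (n : ℕ) [NeZero n] : sphereMass n ≠ 0 := by
  rw [sphereMass, Ne, Measure.measure_univ_eq_zero]
  exact Measure.toSphere_ne_zero _

theorem sphereMass_ne_top (n : ℕ) : sphereMass n ≠ ∞ := measure_ne_top _ _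

theorem norm_det_unitary {n : ℕ} (u : Matrix.unitaryGroup (Fin n) ℂ) :
    ‖(u : Matrix (Fin n) (Fin n) ℂ).det‖ = 1 :=
  CStarRing.norm_of_mem_unitary (Matrix.det_of_mem_unitary u.2)

theorem det_unitary_ne_zero {n : ℕ} (u : Matrix.unitaryGroup (Fin n) ℂ) :
    (u : Matrix (Fin n) (Fin n) ℂ).det ≠ 0 := by
  rw [← norm_ne_zero_iff, norm_det_unitary]; exact one_ne_zero

/-- Integration on `ℂⁿ` in logarithmic polar coordinates. -/
theorem lintegral_polar {n : ℕ} [NeZero n] {h : (Fin n → ℂ) → ℝ≥0∞} (hh : Measurable h) :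
    ∫⁻ z, h z = sphereMass n * ∫⁻ u : Matrix.unitaryGroup (Fin n) ℂ, ∫⁻ t : ℝ,
      ENNReal.ofReal (Real.exp t) ^ (2 * n) *
        h ((Real.exp t : ℂ) • col0 (u : Matrix (Fin n) (Fin n) ℂ)) ∂volume ∂(haarU n) := by
  have hcont : Continuous fun x : Matrix.unitaryGroup (Fin n) ℂ × (Fin n → ℂ) =>
      (x.1 : Matrix (Fin n) (Fin n) ℂ).mulVec x.2 :=
    (continuous_subtype_val.comp continuous_fst).matrix_mulVec continuous_snd
  have hmeas : Measurable fun x : ℝ × Matrix.unitaryGroup (Fin n) ℂ =>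
      h ((x.1 : ℂ) • col0 (x.2 : Matrix (Fin n) (Fin n) ℂ)) :=
    hh.comp ((Complex.measurable_ofReal.comp measurable_fst).smul
      (measurable_col0.comp measurable_snd))
  set H : ℝ → ℝ≥0∞ := fun r => ∫⁻ u : Matrix.unitaryGroup (Fin n) ℂ,
    h ((r : ℂ) • col0 (u : Matrix (Fin n) (Fin n) ℂ)) ∂(haarU n) with hHdef
  have hH : Measurable H := hmeas.lintegral_prod_right'
  have hrot : ∀ u : Matrix.unitaryGroup (Fin n) ℂ,
      ∫⁻ z, h ((u : Matrix (Fin n) (Fin n) ℂ).mulVec z) = ∫⁻ z, h z := by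
    intro u
    rw [← lintegral_mulVec (det_unitary_ne_zero u) hh, ← ofReal_norm, norm_det_unitary]
    simp
  -- Averaging over rotations makes `h` radial: z = |z| v e₁ for a unitary v, which right invariance
  -- of Haar measure absorbs. At z = 0 both sides are the value of `h` at 0.
  have hrad : ∀ z : Fin n → ℂ, ∫⁻ u : Matrix.unitaryGroup (Fin n) ℂ,
      h ((u : Matrix (Fin n) (Fin n) ℂ).mulVec z) ∂(haarU n) = H (euclNorm z) := by
    intro z
    by_cases hz : z = 0
    · subst hz
      simp [hHdef, euclNorm]
    · obtain ⟨v, hv⟩ := exists_unitary_col0 z hz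
      have h2 : ∀ u : Matrix.unitaryGroup (Fin n) ℂ,
          h ((u : Matrix (Fin n) (Fin n) ℂ).mulVec z) = h ((euclNorm z : ℂ) •
            col0 ((u * v : Matrix.unitaryGroup (Fin n) ℂ) : Matrix (Fin n) (Fin n) ℂ)) := by
        intro u
        conv_lhs => rw [hv]
        rw [Matrix.mulVec_smul]; rfl
      simp only [h2]
      exact lintegral_mul_right_eq_self (μ := haarU n) (fun u =>
        h ((euclNorm z : ℂ) • col0 (u : Matrix (Fin n) (Fin n) ℂ))) v
  have hdim : Module.finrank ℝ (EuclideanSpace ℂ (Fin n)) = 2 * n := by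
    rw [← Module.finrank_mul_finrank ℝ ℂ, Complex.finrank_real_complex, finrank_euclideanSpace_fin]
  calc ∫⁻ z, h z
      = ∫⁻ u : Matrix.unitaryGroup (Fin n) ℂ, (∫⁻ z,
          h ((u : Matrix (Fin n) (Fin n) ℂ).mulVec z)) ∂(haarU n) := by simp [hrot]
    _ = ∫⁻ z, ∫⁻ u : Matrix.unitaryGroup (Fin n) ℂ,
          h ((u : Matrix (Fin n) (Fin n) ℂ).mulVec z) ∂(haarU n) :=
        lintegral_lintegral_swap (hh.comp hcont.measurable).aemeasurable
    _ = ∫⁻ z : Fin n → ℂ, H (euclNorm z) := by simp only [hrad]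
    _ = ∫⁻ x, H ‖x‖ ∂(Measure.map (EuclideanSpace.equiv (Fin n) ℂ).symm volume) :=
        (lintegral_map (hH.comp measurable_norm)
          (EuclideanSpace.equiv (Fin n) ℂ).symm.continuous.measurable).symm
    _ = sphereMass n * ∫⁻ t : ℝ, ENNReal.ofReal (Real.exp t) ^ (2 * n) * H (Real.exp t) := by
        rw [lintegral_fun_norm _ hH, hdim]; rfl
    _ = _ := by
        congr 1
        have h3 : ∀ t : ℝ, ENNReal.ofReal (Real.exp t) ^ (2 * n) * H (Real.exp t) =
            ∫⁻ u : Matrix.unitaryGroup (Fin n) ℂ, ENNReal.ofReal (Real.exp t) ^ (2 * n) *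
              h ((Real.exp t : ℂ) • col0 (u : Matrix (Fin n) (Fin n) ℂ)) ∂(haarU n) := fun t =>
          (lintegral_const_mul _ (hmeas.comp (measurable_const.prodMk measurable_id))).symm
        simp only [h3]
        refine lintegral_lintegral_swap (Measurable.aemeasurable ?_)
        refine ((Real.measurable_exp.comp measurable_fst).ennreal_ofReal.pow_const _).mul ?_
        exact hmeas.comp ((Real.measurable_exp.comp measurable_fst).prodMk measurable_snd)

/-! ### Concatenated vectors and block diagonal matrices -/

/-- The concatenation of two vectors. -/
def joinVec {p q : ℕ} (x : Fin p → ℂ) (y : Fin q → ℂ) : Fin (p + q) → ℂ :=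
  Sum.elim x y ∘ finSumFinEquiv.symm

section join
variable {p q : ℕ}

theorem smul_joinVec (c : ℂ) (x : Fin p → ℂ) (y : Fin q → ℂ) :
    c • joinVec x y = joinVec (c • x) (c • y) := by
  ext i
  obtain ⟨j, rfl⟩ := finSumFinEquiv.surjective i
  rcases j with j | j <;> simp [joinVec]

theorem joinVec_castAdd (x : Fin p → ℂ) (y : Fin q → ℂ) (i : Fin p) :
    joinVec x y (Fin.castAdd q i) = x i := by simp [joinVec]

theorem joinVec_natAdd (x : Fin p → ℂ) (y : Fin q → ℂ) (i : Fin q) :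
    joinVec x y (Fin.natAdd p i) = y i := by simp [joinVec]

theorem continuous_joinVec :
    Continuous fun z : (Fin p → ℂ) × (Fin q → ℂ) => joinVec z.1 z.2 := by
  refine continuous_pi fun i => ?_
  obtain ⟨j, rfl⟩ := finSumFinEquiv.surjective i
  rcases j with j | j <;> simp only [joinVec, Function.comp_apply, Equiv.symm_apply_apply] <;>
    simp only [Sum.elim_inl, Sum.elim_inr] <;> fun_prop

theorem euclNorm_sq {n : ℕ} (z : Fin n → ℂ) : euclNorm z ^ 2 = ∑ i, ‖z i‖ ^ 2 := by
  simp [euclNorm, EuclideanSpace.norm_sq_eq]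

theorem euclNorm_joinVec_sq (x : Fin p → ℂ) (y : Fin q → ℂ) :
    euclNorm (joinVec x y) ^ 2 = euclNorm x ^ 2 + euclNorm y ^ 2 := by
  simp only [euclNorm_sq, Fin.sum_univ_add, joinVec_castAdd, joinVec_natAdd]

theorem coe_blockDiag (g : GL (Fin p) ℂ) (h : GL (Fin q) ℂ) :
    (blockDiag p q (g, h) : Matrix (Fin (p + q)) (Fin (p + q)) ℂ) =
      Matrix.reindex finSumFinEquiv finSumFinEquiv
        (Matrix.fromBlocks (g : Matrix (Fin p) (Fin p) ℂ) 0 0 (h : Matrix (Fin q) (Fin q) ℂ)) :=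
  rfl

theorem blockDiag_mulVec (g : GL (Fin p) ℂ) (h : GL (Fin q) ℂ) (x : Fin p → ℂ) (y : Fin q → ℂ) :
    (blockDiag p q (g, h) : Matrix (Fin (p + q)) (Fin (p + q)) ℂ).mulVec (joinVec x y) =
      joinVec ((g : Matrix (Fin p) (Fin p) ℂ).mulVec x)
        ((h : Matrix (Fin q) (Fin q) ℂ).mulVec y) := by
  rw [coe_blockDiag, Matrix.reindex_apply, Matrix.submatrix_mulVec_equiv, joinVec, joinVec]
  congr 1
  simp [Matrix.fromBlocks_mulVec, Function.comp_assoc]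

theorem det_blockDiag (g : GL (Fin p) ℂ) (h : GL (Fin q) ℂ) :
    (blockDiag p q (g, h) : Matrix (Fin (p + q)) (Fin (p + q)) ℂ).det =
      (g : Matrix (Fin p) (Fin p) ℂ).det * (h : Matrix (Fin q) (Fin q) ℂ).det := by
  rw [coe_blockDiag, Matrix.det_reindex_self, Matrix.det_fromBlocks_zero₂₁]

theorem lintegral_joinVec {h : (Fin (p + q) → ℂ) → ℝ≥0∞} (hh : Measurable h) :
    ∫⁻ z, h z = ∫⁻ x : Fin p → ℂ, ∫⁻ y : Fin q → ℂ, h (joinVec x y) := by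
  have e1 := volume_measurePreserving_sumPiEquivProdPi_symm
    (fun _ : Fin p ⊕ Fin q => ℂ)
  have e2 := volume_measurePreserving_piCongrLeft (fun _ : Fin (p + q) => ℂ)
    (finSumFinEquiv (m := p) (n := q))
  have e3 := e2.comp e1
  rw [← e3.lintegral_comp hh, Measure.volume_eq_prod, lintegral_prod]
  · refine lintegral_congr fun x => lintegral_congr fun y => ?_
    congr 1
    ext i
    obtain ⟨j, rfl⟩ := finSumFinEquiv.surjective i
    simp only [Function.comp_apply, MeasurableEquiv.coe_piCongrLeft, Equiv.piCongrLeft_apply_apply]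
    rcases j with j | j <;> simp only [joinVec, Function.comp_apply, Equiv.symm_apply_apply] <;> rfl
  · exact (hh.comp e3.measurable).aemeasurable

end join

/-! ### Integration over U(p + q) through U(p) × U(q) × ℝ -/

/-- The constant relating the invariant measure of `U(p + q)` to those of `U(p)` and `U(q)`. -/
def branchConst (p q : ℕ) : ℝ≥0∞ := sphereMass p * sphereMass q / sphereMass (p + q)

theorem branchConst_ne_zero (p q : ℕ) [NeZero p] [NeZero q] : branchConst p q ≠ 0 :=
  ENNReal.div_ne_zero.2 ⟨mul_ne_zero (sphereMass_ne_zero p) (sphereMass_ne_zero q),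
    sphereMass_ne_top _⟩

theorem branchConst_ne_top (p q : ℕ) [NeZero p] [NeZero q] : branchConst p q ≠ ∞ :=
  ENNReal.div_ne_top (ENNReal.mul_ne_top (sphereMass_ne_top p) (sphereMass_ne_top q))
    (sphereMass_ne_zero _)

/-- The length of `{t | 1 ≤ eᵗ < 2}`. -/
def logLength : ℝ≥0∞ := ∫⁻ t : ℝ, (Set.Ico (1 : ℝ) 2).indicator 1 (Real.exp t)

theorem logLength_eq : logLength = ENNReal.ofReal (Real.log 2) := by
  have h : ∀ t : ℝ, (Set.Ico (1 : ℝ) 2).indicator (1 : ℝ → ℝ≥0∞) (Real.exp t) =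
      (Set.Ico (0 : ℝ) (Real.log 2)).indicator 1 t := by
    intro t
    have : Real.exp t ∈ Set.Ico (1 : ℝ) 2 ↔ t ∈ Set.Ico (0 : ℝ) (Real.log 2) := by
      rw [Set.mem_Ico, Set.mem_Ico, Real.one_le_exp_iff, Real.lt_log_iff_exp_lt two_pos]
    by_cases ht : t ∈ Set.Ico (0 : ℝ) (Real.log 2)
    · rw [Set.indicator_of_mem ht, Set.indicator_of_mem (this.2 ht)]; rfl
    · rw [Set.indicator_of_notMem ht, Set.indicator_of_notMem (mt this.1 ht)]
  simp only [logLength, h]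
  rw [lintegral_indicator_one measurableSet_Ico, Real.volume_Ico, sub_zero]

theorem logLength_ne_zero : logLength ≠ 0 := by
  rw [logLength_eq, Ne, ENNReal.ofReal_eq_zero, not_le]
  exact Real.log_pos one_lt_two

theorem logLength_ne_top : logLength ≠ ∞ := by
  rw [logLength_eq]; exact ENNReal.ofReal_ne_top

/-- In the logarithmic variable, scaling by c is a translation. -/
theorem lintegral_logLength {c : ℝ} (hc : 0 < c) :
    ∫⁻ t : ℝ, (Set.Ico (1 : ℝ) 2).indicator 1 (Real.exp t * c) = logLength := by
  rw [logLength, ← lintegral_add_right_eq_self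
    (fun t : ℝ => (Set.Ico (1 : ℝ) 2).indicator (1 : ℝ → ℝ≥0∞) (Real.exp t)) (Real.log c)]
  simp only [Real.exp_add, Real.exp_log hc]

theorem euclNorm_col0_coe {n : ℕ} [NeZero n] (u : Matrix.unitaryGroup (Fin n) ℂ) :
    euclNorm (col0 (u : Matrix (Fin n) (Fin n) ℂ)) = 1 := euclNorm_col0_unitary u

theorem euclNorm_exp_smul {n : ℕ} (t : ℝ) (z : Fin n → ℂ) :
    euclNorm ((Real.exp t : ℂ) • z) = Real.exp t * euclNorm z := by
  rw [euclNorm_smul, Complex.norm_real, Real.norm_of_nonneg (Real.exp_pos t).le]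

theorem euclNorm_joinVec_pos {p q : ℕ} (x : Fin p → ℂ) {y : Fin q → ℂ} (hy : 0 < euclNorm y) :
    0 < euclNorm (joinVec x y) := by
  refine lt_of_le_of_ne (norm_nonneg _) fun h => ?_
  have := euclNorm_joinVec_sq x y
  rw [← h] at this
  nlinarith [sq_nonneg (euclNorm x)]

section
variable {p q : ℕ} [NeZero p] [NeZero q]

/-- The vector `(eᵗ u e₁, v e₁)`. -/
def branchVec (x : Matrix.unitaryGroup (Fin p) ℂ × Matrix.unitaryGroup (Fin q) ℂ × ℝ) :
    Fin (p + q) → ℂ :=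
  joinVec ((Real.exp x.2.2 : ℂ) • col0 (x.1 : Matrix (Fin p) (Fin p) ℂ))
    (col0 (x.2.1 : Matrix (Fin q) (Fin q) ℂ))

theorem measurable_branchVec : Measurable (branchVec (p := p) (q := q)) :=
  continuous_joinVec.measurable.comp
    (((Complex.measurable_ofReal.comp (Real.measurable_exp.comp
      (measurable_snd.comp measurable_snd))).smul (measurable_col0.comp measurable_fst)).prodMk
      (measurable_col0.comp (measurable_fst.comp measurable_snd)))

theorem euclNorm_branchVec_pos
    (x : Matrix.unitaryGroup (Fin p) ℂ × Matrix.unitaryGroup (Fin q) ℂ × ℝ) :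
    0 < euclNorm (branchVec x) :=
  euclNorm_joinVec_pos _ (by rw [euclNorm_col0_coe]; exact one_pos)

/-- The invariant measure on `U(p) × U(q) × ℝ`. -/
def branchMeasure (p q : ℕ) :
    Measure (Matrix.unitaryGroup (Fin p) ℂ × Matrix.unitaryGroup (Fin q) ℂ × ℝ) :=
  (haarU p).prod ((haarU q).prod volume)

instance (p q : ℕ) : SFinite (branchMeasure p q) := by unfold branchMeasure; infer_instance

/-- Homogeneity cancels the Jacobian e^(2nt), so that the radial integral only sees the logarithmic
thickness of the shell. Unlike in `lintegral_shell_eq`, scaling by positive reals suffices; this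
admits functions without any invariance under phases. -/
theorem lintegral_shell_homogeneous {n : ℕ} [NeZero n] {φ : (Fin n → ℂ) → ℝ≥0∞}
    (hφ : Measurable φ)
    (hom : ∀ (r : ℝ) (z : Fin n → ℂ), 0 < r →
      ENNReal.ofReal r ^ (2 * n) * φ ((r : ℂ) • z) = φ z) :
    ∫⁻ z, (Set.Ico (1 : ℝ) 2).indicator 1 (euclNorm z) * φ z = sphereMass n * logLength *
      ∫⁻ u, φ (col0 (u : Matrix (Fin n) (Fin n) ℂ)) ∂(haarU n) := by
  have hind : Measurable ((Set.Ico (1 : ℝ) 2).indicator (1 : ℝ → ℝ≥0∞)) :=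
    measurable_one.indicator measurableSet_Ico
  have hm : Measurable fun z : Fin n → ℂ =>
      (Set.Ico (1 : ℝ) 2).indicator (1 : ℝ → ℝ≥0∞) (euclNorm z) * φ z :=
    (hind.comp continuous_euclNorm.measurable).mul hφ
  have hc : Measurable fun u : Matrix.unitaryGroup (Fin n) ℂ =>
      φ (col0 (u : Matrix (Fin n) (Fin n) ℂ)) := hφ.comp measurable_col0
  rw [lintegral_polar hm, mul_assoc, ← lintegral_const_mul _ hc]
  congr 1
  refine lintegral_congr fun u => ?_
  simp only [euclNorm_exp_smul, euclNorm_col0_coe, mul_one]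
  rw [logLength, ← lintegral_mul_const _ (show Measurable fun t : ℝ =>
    (Set.Ico (1 : ℝ) 2).indicator (1 : ℝ → ℝ≥0∞) (Real.exp t) from hind.comp Real.measurable_exp)]
  refine lintegral_congr fun t => ?_
  rw [mul_left_comm, hom _ _ (Real.exp_pos t)]

set_option maxHeartbeats 1000000 in
/-- Integration over `U(p + q)` of a function on `ℂ^(p + q)` homogeneous of degree `-2(p + q)`, in
terms of `U(p) × U(q) × ℝ`. -/
theorem lintegral_branch {φ : (Fin (p + q) → ℂ) → ℝ≥0∞} (hφ : Measurable φ)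
    (hom : ∀ (r : ℝ) (z : Fin (p + q) → ℂ), 0 < r →
      ENNReal.ofReal r ^ (2 * (p + q)) * φ ((r : ℂ) • z) = φ z) :
    ∫⁻ u, φ (col0 (u : Matrix (Fin (p + q)) (Fin (p + q)) ℂ)) ∂(haarU (p + q)) =
      branchConst p q * ∫⁻ x, ENNReal.ofReal (Real.exp x.2.2) ^ (2 * p) * φ (branchVec x)
        ∂(branchMeasure p q) := by
  have hind : Measurable ((Set.Ico (1 : ℝ) 2).indicator (1 : ℝ → ℝ≥0∞)) :=
    measurable_one.indicator measurableSet_Ico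
  set B : ℝ → ℝ≥0∞ := (Set.Ico (1 : ℝ) 2).indicator 1 with hB
  have hexp : Measurable fun t : ℝ => ENNReal.ofReal (Real.exp t) :=
    Real.measurable_exp.ennreal_ofReal
  have hψ : Measurable fun z : Fin (p + q) → ℂ => B (euclNorm z) * φ z :=
    (hind.comp continuous_euclNorm.measurable).mul hφ
  -- With t = s - r the vector is eʳ (eᵗ u e₁, v e₁). Homogeneity removes eʳ from φ, and the
  -- remaining integral over r measures a shell, giving `logLength` for every t.
  have hinner : ∀ (u : Matrix.unitaryGroup (Fin p) ℂ) (v : Matrix.unitaryGroup (Fin q) ℂ),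
      ∫⁻ s : ℝ, ENNReal.ofReal (Real.exp s) ^ (2 * p) * ∫⁻ r : ℝ,
        ENNReal.ofReal (Real.exp r) ^ (2 * q) *
          (B (euclNorm (joinVec ((Real.exp s : ℂ) • col0 (u : Matrix (Fin p) (Fin p) ℂ))
            ((Real.exp r : ℂ) • col0 (v : Matrix (Fin q) (Fin q) ℂ)))) *
          φ (joinVec ((Real.exp s : ℂ) • col0 (u : Matrix (Fin p) (Fin p) ℂ))
            ((Real.exp r : ℂ) • col0 (v : Matrix (Fin q) (Fin q) ℂ)))) =
      logLength * ∫⁻ t : ℝ, ENNReal.ofReal (Real.exp t) ^ (2 * p) * φ (branchVec (u, v, t)) := by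
    intro u v
    have hjm : Measurable fun x : ℝ × ℝ =>
        joinVec ((Real.exp x.1 : ℂ) • col0 (u : Matrix (Fin p) (Fin p) ℂ))
          ((Real.exp x.2 : ℂ) • col0 (v : Matrix (Fin q) (Fin q) ℂ)) :=
      (continuous_joinVec.comp (Continuous.prodMk (by fun_prop) (by fun_prop))).measurable
    set K : ℝ × ℝ → ℝ≥0∞ := fun x => ENNReal.ofReal (Real.exp x.1) ^ (2 * p) *
      (ENNReal.ofReal (Real.exp x.2) ^ (2 * q) *
        (B (euclNorm (joinVec ((Real.exp x.1 : ℂ) • col0 (u : Matrix (Fin p) (Fin p) ℂ))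
            ((Real.exp x.2 : ℂ) • col0 (v : Matrix (Fin q) (Fin q) ℂ)))) *
          φ (joinVec ((Real.exp x.1 : ℂ) • col0 (u : Matrix (Fin p) (Fin p) ℂ))
            ((Real.exp x.2 : ℂ) • col0 (v : Matrix (Fin q) (Fin q) ℂ))))) with hK
    have hKm : Measurable K := ((hexp.comp measurable_fst).pow_const _).mul
      (((hexp.comp measurable_snd).pow_const _).mul (hψ.comp hjm))
    -- At s = t + r the weight e^(2ps) e^(2qr) is e^(2pt) e^(2(p+q)r), and its second factor is the
    -- one that homogeneity absorbs.
    have hKeq : ∀ t r : ℝ, K (t + r, r) = ENNReal.ofReal (Real.exp t) ^ (2 * p) *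
        φ (branchVec (u, v, t)) * B (Real.exp r * euclNorm (branchVec (u, v, t))) := by
      intro t r
      have e1 : joinVec ((Real.exp (t + r) : ℂ) • col0 (u : Matrix (Fin p) (Fin p) ℂ))
          ((Real.exp r : ℂ) • col0 (v : Matrix (Fin q) (Fin q) ℂ)) =
            (Real.exp r : ℂ) • branchVec (u, v, t) := by
        rw [branchVec, smul_joinVec, smul_smul, ← Complex.ofReal_mul, ← Real.exp_add, add_comm t r]
      simp only [hK]
      rw [e1, euclNorm_exp_smul, ← hom _ (branchVec (u, v, t)) (Real.exp_pos r), Real.exp_add,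
        ENNReal.ofReal_mul (Real.exp_pos t).le, mul_pow, mul_add 2 p q, pow_add]
      ring
    calc _ = ∫⁻ s : ℝ, ∫⁻ r : ℝ, K (s, r) := by
            refine lintegral_congr fun s => ?_
            rw [← lintegral_const_mul]
            exact ((hexp.pow_const _).mul
              (hψ.comp (hjm.comp measurable_prodMk_left)))
      _ = ∫⁻ r : ℝ, ∫⁻ s : ℝ, K (s, r) := lintegral_lintegral_swap hKm.aemeasurable
      _ = ∫⁻ r : ℝ, ∫⁻ t : ℝ, K (t + r, r) := lintegral_congr fun r =>
            (lintegral_add_right_eq_self (fun s => K (s, r)) r).symm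
      _ = ∫⁻ t : ℝ, ∫⁻ r : ℝ, K (t + r, r) :=
            lintegral_lintegral_swap (hKm.comp ((measurable_snd.add measurable_fst).prodMk
              measurable_fst)).aemeasurable
      _ = _ := by
            rw [← lintegral_const_mul]
            · refine lintegral_congr fun t => ?_
              simp only [hKeq]
              rw [lintegral_const_mul, lintegral_logLength (euclNorm_branchVec_pos _), mul_comm]
              exact hind.comp (Real.measurable_exp.mul_const _)
            · exact (hexp.pow_const _).mul (hφ.comp (measurable_branchVec.comp
                (measurable_const.prodMk measurable_prodMk_left)))
  have hfull : Measurable fun x : Matrix.unitaryGroup (Fin p) ℂ ×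
      Matrix.unitaryGroup (Fin q) ℂ × ℝ =>
        ENNReal.ofReal (Real.exp x.2.2) ^ (2 * p) * φ (branchVec x) :=
    ((hexp.comp (measurable_snd.comp measurable_snd)).pow_const _).mul
      (hφ.comp measurable_branchVec)
  have hfull' : Measurable fun x : Matrix.unitaryGroup (Fin p) ℂ ×
      Matrix.unitaryGroup (Fin q) ℂ =>
        ∫⁻ t : ℝ, ENNReal.ofReal (Real.exp t) ^ (2 * p) * φ (branchVec (x.1, x.2, t)) := by
    refine Measurable.lintegral_prod_right' (f := fun y : (Matrix.unitaryGroup (Fin p) ℂ ×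
      Matrix.unitaryGroup (Fin q) ℂ) × ℝ => ENNReal.ofReal (Real.exp y.2) ^ (2 * p) *
        φ (branchVec (y.1.1, y.1.2, y.2))) ?_
    exact hfull.comp (MeasurableEquiv.prodAssoc.measurable)
  -- The integral over the shell of ℂ^(p+q) is evaluated twice: in polar coordinates of the whole
  -- space, and in polar coordinates of ℂ^p and ℂ^q separately.
  have key := lintegral_shell_homogeneous hφ hom
  rw [lintegral_joinVec hψ] at key
  have hstep1 : ∀ x : Fin p → ℂ, ∫⁻ y : Fin q → ℂ, B (euclNorm (joinVec x y)) * φ (joinVec x y) =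
      sphereMass q * ∫⁻ v : Matrix.unitaryGroup (Fin q) ℂ, ∫⁻ r : ℝ,
        ENNReal.ofReal (Real.exp r) ^ (2 * q) *
          (B (euclNorm (joinVec x ((Real.exp r : ℂ) • col0 (v : Matrix (Fin q) (Fin q) ℂ)))) *
            φ (joinVec x ((Real.exp r : ℂ) • col0 (v : Matrix (Fin q) (Fin q) ℂ))))
          ∂volume ∂(haarU q) := fun x =>
    lintegral_polar (h := fun y => B (euclNorm (joinVec x y)) * φ (joinVec x y))
      (hψ.comp (continuous_joinVec.measurable.comp measurable_prodMk_left))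
  obtain ⟨G, hG⟩ : ∃ G : (Fin p → ℂ) × Matrix.unitaryGroup (Fin q) ℂ → ℝ≥0∞, ∀ z, G z =
      ∫⁻ r : ℝ, ENNReal.ofReal (Real.exp r) ^ (2 * q) *
        (B (euclNorm (joinVec z.1 ((Real.exp r : ℂ) • col0 (z.2 : Matrix (Fin q) (Fin q) ℂ)))) *
          φ (joinVec z.1 ((Real.exp r : ℂ) • col0 (z.2 : Matrix (Fin q) (Fin q) ℂ)))) :=
    ⟨_, fun _ => rfl⟩
  have hGm : Measurable G := by
    rw [funext hG]
    refine Measurable.lintegral_prod_right' (f := fun y : ((Fin p → ℂ) ×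
      Matrix.unitaryGroup (Fin q) ℂ) × ℝ => ENNReal.ofReal (Real.exp y.2) ^ (2 * q) *
          (B (euclNorm (joinVec y.1.1
            ((Real.exp y.2 : ℂ) • col0 (y.1.2 : Matrix (Fin q) (Fin q) ℂ)))) *
            φ (joinVec y.1.1 ((Real.exp y.2 : ℂ) • col0 (y.1.2 : Matrix (Fin q) (Fin q) ℂ))))) ?_
    refine ((hexp.comp measurable_snd).pow_const _).mul (hψ.comp
      (continuous_joinVec.measurable.comp ((measurable_fst.comp measurable_fst).prodMk
        ((Complex.measurable_ofReal.comp (Real.measurable_exp.comp measurable_snd)).smul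
          (measurable_col0.comp (measurable_snd.comp measurable_fst))))))
  have hstep1' : ∀ x : Fin p → ℂ,
      ∫⁻ y : Fin q → ℂ, B (euclNorm (joinVec x y)) * φ (joinVec x y) =
        sphereMass q * ∫⁻ v, G (x, v) ∂(haarU q) := fun x => by
    rw [hstep1]; simp only [hG]
  have hGi : Measurable fun x => ∫⁻ v, G (x, v) ∂(haarU q) := hGm.lintegral_prod_right'
  simp only [hstep1'] at key
  rw [lintegral_const_mul _ hGi, lintegral_polar hGi] at key
  have hstep2 : ∀ u : Matrix.unitaryGroup (Fin p) ℂ,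
      ∫⁻ s : ℝ, ENNReal.ofReal (Real.exp s) ^ (2 * p) *
        ∫⁻ v, G ((Real.exp s : ℂ) • col0 (u : Matrix (Fin p) (Fin p) ℂ), v) ∂(haarU q) =
      logLength * ∫⁻ v : Matrix.unitaryGroup (Fin q) ℂ,
        ∫⁻ t : ℝ, ENNReal.ofReal (Real.exp t) ^ (2 * p) * φ (branchVec (u, v, t))
          ∂volume ∂(haarU q) := by
    intro u
    have hfu : Measurable fun v : Matrix.unitaryGroup (Fin q) ℂ =>
        ∫⁻ t : ℝ, ENNReal.ofReal (Real.exp t) ^ (2 * p) * φ (branchVec (u, v, t)) :=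
      hfull'.comp measurable_prodMk_left
    have hm2 : Measurable fun y : ℝ × Matrix.unitaryGroup (Fin q) ℂ =>
        ((Real.exp y.1 : ℂ) • col0 (u : Matrix (Fin p) (Fin p) ℂ), y.2) :=
      ((Complex.measurable_ofReal.comp (Real.measurable_exp.comp measurable_fst)).smul_const
        _).prodMk measurable_snd
    have hKm : Measurable fun y : ℝ × Matrix.unitaryGroup (Fin q) ℂ =>
        ENNReal.ofReal (Real.exp y.1) ^ (2 * p) *
          G ((Real.exp y.1 : ℂ) • col0 (u : Matrix (Fin p) (Fin p) ℂ), y.2) :=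
      ((hexp.comp measurable_fst).pow_const _).mul (hGm.comp hm2)
    calc _ = ∫⁻ s : ℝ, ∫⁻ v, ENNReal.ofReal (Real.exp s) ^ (2 * p) *
            G ((Real.exp s : ℂ) • col0 (u : Matrix (Fin p) (Fin p) ℂ), v) ∂(haarU q) :=
          lintegral_congr fun s =>
            (lintegral_const_mul _ (hGm.comp measurable_prodMk_left)).symm
      _ = ∫⁻ v, ∫⁻ s : ℝ, ENNReal.ofReal (Real.exp s) ^ (2 * p) *
            G ((Real.exp s : ℂ) • col0 (u : Matrix (Fin p) (Fin p) ℂ), v) ∂volume ∂(haarU q) :=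
          lintegral_lintegral_swap hKm.aemeasurable
      _ = ∫⁻ v : Matrix.unitaryGroup (Fin q) ℂ, logLength * ∫⁻ t : ℝ,
            ENNReal.ofReal (Real.exp t) ^ (2 * p) * φ (branchVec (u, v, t)) ∂volume ∂(haarU q) :=
          lintegral_congr fun v => by simp only [hG, hinner u v]
      _ = _ := lintegral_const_mul _ hfu
  simp only [hstep2] at key
  have hfull2 : Measurable fun u : Matrix.unitaryGroup (Fin p) ℂ =>
      ∫⁻ v : Matrix.unitaryGroup (Fin q) ℂ,
        ∫⁻ t : ℝ, ENNReal.ofReal (Real.exp t) ^ (2 * p) * φ (branchVec (u, v, t))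
          ∂volume ∂(haarU q) := hfull'.lintegral_prod_right'
  rw [lintegral_const_mul _ hfull2] at key
  have hprod : ∫⁻ x, ENNReal.ofReal (Real.exp x.2.2) ^ (2 * p) * φ (branchVec x)
        ∂(branchMeasure p q) = ∫⁻ u : Matrix.unitaryGroup (Fin p) ℂ,
      ∫⁻ v : Matrix.unitaryGroup (Fin q) ℂ,
        ∫⁻ t : ℝ, ENNReal.ofReal (Real.exp t) ^ (2 * p) * φ (branchVec (u, v, t))
          ∂volume ∂(haarU q) ∂(haarU p) := by
    rw [branchMeasure, lintegral_prod _ hfull.aemeasurable]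
    refine lintegral_congr fun u => ?_
    exact lintegral_prod _ (hfull.comp measurable_prodMk_left).aemeasurable
  rw [hprod, branchConst, ENNReal.div_eq_inv_mul]
  set I := ∫⁻ u : Matrix.unitaryGroup (Fin p) ℂ,
      ∫⁻ v : Matrix.unitaryGroup (Fin q) ℂ,
        ∫⁻ t : ℝ, ENNReal.ofReal (Real.exp t) ^ (2 * p) * φ (branchVec (u, v, t))
          ∂volume ∂(haarU q) ∂(haarU p)
  set J := ∫⁻ u, φ (col0 (u : Matrix (Fin (p + q)) (Fin (p + q)) ℂ)) ∂(haarU (p + q))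
  have h1 : logLength * (sphereMass p * sphereMass q * I) =
      logLength * (sphereMass (p + q) * J) := by
    calc _ = sphereMass q * (sphereMass p * (logLength * I)) := by ring
      _ = sphereMass (p + q) * logLength * J := key
      _ = _ := by ring
  have h2 := (ENNReal.mul_right_inj logLength_ne_zero logLength_ne_top).1 h1
  rw [mul_assoc, h2, ← mul_assoc, ENNReal.inv_mul_cancel (sphereMass_ne_zero _)
    (sphereMass_ne_top _), one_mul]

end

/-! ### The invariant measure of the unit sphere as an image measure -/

section
variable {p q : ℕ} [NeZero p] [NeZero q]

/-- The density on `U(p) × U(q) × ℝ` of the invariant measure of `U(p + q)`. -/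
def branchDensity (x : Matrix.unitaryGroup (Fin p) ℂ × Matrix.unitaryGroup (Fin q) ℂ × ℝ) : ℝ :=
  (branchConst p q).toReal *
    (Real.exp x.2.2 ^ (2 * p) * (euclNorm (branchVec x))⁻¹ ^ (2 * (p + q)))

theorem measurable_branchDensity : Measurable (branchDensity (p := p) (q := q)) :=
  measurable_const.mul (((Real.measurable_exp.comp (measurable_snd.comp measurable_snd)).pow_const
    _).mul (((continuous_euclNorm.measurable.comp measurable_branchVec).inv).pow_const _))

theorem branchDensity_nonneg
    (x : Matrix.unitaryGroup (Fin p) ℂ × Matrix.unitaryGroup (Fin q) ℂ × ℝ) :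
    0 ≤ branchDensity x := by
  have := (euclNorm_branchVec_pos x).le
  unfold branchDensity
  positivity

/-- The unit vector in the direction of `branchVec`. -/
def branchDir (x : Matrix.unitaryGroup (Fin p) ℂ × Matrix.unitaryGroup (Fin q) ℂ × ℝ) :
    Fin (p + q) → ℂ := ((euclNorm (branchVec x))⁻¹ : ℝ) • branchVec x

theorem measurable_branchDir : Measurable (branchDir (p := p) (q := q)) :=
  (continuous_euclNorm.measurable.comp measurable_branchVec).inv.smul measurable_branchVec

theorem ofReal_smul_vec {n : ℕ} (r : ℝ) (z : Fin n → ℂ) : (r : ℂ) • z = r • z := by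
  ext i; simp

/-- The invariant measure on the unit sphere of `ℂ^(p + q)` in terms of `U(p) × U(q) × ℝ`. -/
theorem map_col0_haarU :
    Measure.map (fun u : Matrix.unitaryGroup (Fin (p + q)) ℂ =>
      col0 (u : Matrix (Fin (p + q)) (Fin (p + q)) ℂ)) (haarU (p + q)) =
    Measure.map branchDir ((branchMeasure p q).withDensity
      fun x => ENNReal.ofReal (branchDensity x)) := by
  ext S hS
  have hind : Measurable (S.indicator (1 : (Fin (p + q) → ℂ) → ℝ≥0∞)) :=
    measurable_one.indicator hS
  have hind' : Measurable fun x : Matrix.unitaryGroup (Fin p) ℂ × Matrix.unitaryGroup (Fin q) ℂ ×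
      ℝ => S.indicator (1 : (Fin (p + q) → ℂ) → ℝ≥0∞) (branchDir x) :=
    hind.comp measurable_branchDir
  rw [← lintegral_indicator_one hS, ← lintegral_indicator_one hS, lintegral_map hind
    measurable_col0, lintegral_map hind measurable_branchDir,
    lintegral_withDensity_eq_lintegral_mul _ measurable_branchDensity.ennreal_ofReal hind']
  -- The extension of the indicator of `S` from unit vectors with degree -2(p + q); it is
  -- homogeneous under positive scalars only.
  set φ : (Fin (p + q) → ℂ) → ℝ≥0∞ := fun z => ENNReal.ofReal (euclNorm z)⁻¹ ^ (2 * (p + q)) *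
    S.indicator 1 ((euclNorm z)⁻¹ • z) with hφ
  have hφm : Measurable φ :=
    (continuous_euclNorm.measurable.inv.ennreal_ofReal.pow_const _).mul
      (hind.comp (continuous_euclNorm.measurable.inv.smul measurable_id))
  have hom : ∀ (r : ℝ) (z : Fin (p + q) → ℂ), 0 < r →
      ENNReal.ofReal r ^ (2 * (p + q)) * φ ((r : ℂ) • z) = φ z := by
    intro r z hr
    have e1 : euclNorm ((r : ℂ) • z) = r * euclNorm z := by
      rw [euclNorm_smul, Complex.norm_real, Real.norm_of_nonneg hr.le]
    simp only [hφ, e1]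
    rw [← mul_assoc, ← mul_pow, ← ENNReal.ofReal_mul hr.le, mul_inv,
      mul_inv_cancel_left₀ hr.ne', ofReal_smul_vec, smul_smul, mul_comm r⁻¹, mul_assoc,
      inv_mul_cancel₀ hr.ne', mul_one]
  have key := lintegral_branch hφm hom
  have e1 : ∀ u : Matrix.unitaryGroup (Fin (p + q)) ℂ,
      φ (col0 (u : Matrix (Fin (p + q)) (Fin (p + q)) ℂ)) =
        S.indicator 1 (col0 (u : Matrix (Fin (p + q)) (Fin (p + q)) ℂ)) := by
    intro u
    simp [hφ, euclNorm_col0_coe]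
  simp only [e1] at key
  rw [key, ← lintegral_const_mul]
  · refine lintegral_congr fun x => ?_
    rw [Pi.mul_apply, branchDensity,
      ENNReal.ofReal_mul ENNReal.toReal_nonneg, ENNReal.ofReal_toReal (branchConst_ne_top p q),
      ENNReal.ofReal_mul (by positivity), ENNReal.ofReal_pow (Real.exp_pos _).le,
      ENNReal.ofReal_pow (inv_nonneg.2 (euclNorm_branchVec_pos x).le)]
    simp only [hφ, branchDir]
    ring
  · exact ((Real.measurable_exp.comp (measurable_snd.comp measurable_snd)).ennreal_ofReal.pow_const
      _).mul (hφm.comp measurable_branchVec)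

/-- Integration over `U(p + q)` of a complex function on `ℂ^(p + q)` homogeneous of degree
`-2(p + q)`, in terms of `U(p) × U(q) × ℝ`. -/
theorem integral_branch {φ : (Fin (p + q) → ℂ) → ℂ} (hφ : Measurable φ)
    (hom : ∀ (r : ℝ) (z : Fin (p + q) → ℂ), 0 < r →
      (r : ℂ) ^ (2 * (p + q)) * φ ((r : ℂ) • z) = φ z) :
    ∫ u, φ (col0 (u : Matrix (Fin (p + q)) (Fin (p + q)) ℂ)) ∂(haarU (p + q)) =
      (branchConst p q).toReal * ∫ x, (Real.exp x.2.2 : ℂ) ^ (2 * p) * φ (branchVec x)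
        ∂(branchMeasure p q) := by
  -- An equality of measures transfers Bochner integrals without an integrability hypothesis.
  -- Homogeneity at r = 1 / |z| then passes from unit directions back to the vectors themselves.
  rw [← integral_map measurable_col0.aemeasurable hφ.aestronglyMeasurable, map_col0_haarU,
    integral_map measurable_branchDir.aemeasurable hφ.aestronglyMeasurable,
    integral_withDensity_eq_integral_toReal_smul measurable_branchDensity.ennreal_ofReal
      (Filter.Eventually.of_forall fun x => ENNReal.ofReal_lt_top), ← integral_const_mul]
  refine integral_congr_ae (Filter.Eventually.of_forall fun x => ?_)
  have hpos := euclNorm_branchVec_pos x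
  beta_reduce
  rw [ENNReal.toReal_ofReal (branchDensity_nonneg x), branchDir, ← ofReal_smul_vec,
    ← hom _ (branchVec x) (inv_pos.2 hpos), branchDensity, Complex.real_smul]
  push_cast
  ring

end

/-! ### Homogeneous functions -/

/-- The functions `f` on `ℂⁿ` such that `g ↦ |det g| f(g e₁)` belongs to the induced space. -/
structure IsSection {n : ℕ} [NeZero n] (lam : ℝ) (k : ℤ) (f : (Fin n → ℂ) → ℂ) : Prop where
  measurable : Measurable f
  map_smul : ∀ (c : ℂ) (z : Fin n → ℂ), c ≠ 0 → f (c • z) =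
    ((‖c‖ : ℂ) ^ n * ((‖c‖ : ℂ) ^ (Complex.I * lam) * (c / (‖c‖ : ℂ)) ^ k))⁻¹ * f z
  memLp : MemLp (fun u : Matrix.unitaryGroup (Fin n) ℂ =>
    f (col0 (u : Matrix (Fin n) (Fin n) ℂ))) 2 (haarU n)

theorem measurable_det_GL {n : ℕ} :
    Measurable fun g : GL (Fin n) ℂ => (g : Matrix (Fin n) (Fin n) ℂ).det := by
  have h1 : Measurable fun A : Matrix (Fin n) (Fin n) ℂ => A.det :=
    (Continuous.matrix_det continuous_id).measurable
  exact h1.comp (comap_measurable _)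

section
variable {n : ℕ} [NeZero n]

theorem measurable_col0_GL :
    Measurable fun g : GL (Fin n) ℂ => col0 (g : Matrix (Fin n) (Fin n) ℂ) := by
  have h1 : Measurable fun A : Matrix (Fin n) (Fin n) ℂ => col0 A :=
    (continuous_pi fun i => continuous_id.matrix_elem i 0).measurable
  exact h1.comp (comap_measurable _)

theorem col0_mul_of_mem_parabolic (g : GL (Fin n) ℂ) {r : GL (Fin n) ℂ} (hr : r ∈ parabolic n) :
    col0 ((g * r : GL (Fin n) ℂ) : Matrix (Fin n) (Fin n) ℂ) =
      r 0 0 • col0 (g : Matrix (Fin n) (Fin n) ℂ) := by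
  ext i
  rw [Units.val_mul]
  simp only [col0, Matrix.mul_apply, Pi.smul_apply, smul_eq_mul]
  rw [Finset.sum_eq_single 0]
  · ring
  · intro j _ hj
    rw [hr j hj, mul_zero]
  · simp

theorem coe_toUnits {m : ℕ} (u : Matrix.unitaryGroup (Fin m) ℂ) :
    ((Unitary.toUnits u : GL (Fin m) ℂ) : Matrix (Fin m) (Fin m) ℂ) = u := rfl

namespace IsSection
variable {lam : ℝ} {k : ℤ} {f : (Fin n → ℂ) → ℂ}

theorem map_pos_smul (hf : IsSection lam k f) {r : ℝ} (hr : 0 < r) (z : Fin n → ℂ) :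
    f ((r : ℂ) • z) = ((r : ℂ) ^ n * (r : ℂ) ^ (Complex.I * lam))⁻¹ * f z := by
  have hr' : (r : ℂ) ≠ 0 := by exact_mod_cast hr.ne'
  rw [hf.map_smul _ z hr', Complex.norm_real, Real.norm_of_nonneg hr.le, div_self hr', one_zpow,
    mul_one]

/-- Scaling by 2 fixes the origin but multiplies the value by a factor of absolute value 2⁻ⁿ, and n
is positive. -/
theorem map_zero (hf : IsSection lam k f) : f 0 = 0 := by
  have h := congrArg norm (hf.map_pos_smul two_pos 0)
  rw [smul_zero, norm_mul, norm_inv, norm_mul, norm_pow,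
    Complex.norm_cpow_eq_rpow_re_of_pos two_pos] at h
  have e : (Complex.I * (lam : ℂ)).re = 0 := by simp
  rw [e, Real.rpow_zero, mul_one, Complex.norm_real, Real.norm_ofNat] at h
  by_contra h0
  have h1 : (2 : ℝ) ^ n = 1 := by
    have h2 := norm_ne_zero_iff.2 h0
    field_simp at h
    linarith
  exact absurd h1 (one_lt_pow₀ one_lt_two (NeZero.ne n)).ne'

theorem map_circle_smul (hf : IsSection lam k f) {c : ℂ} (hc : ‖c‖ = 1) (z : Fin n → ℂ) :
    f (c • z) = (c ^ k)⁻¹ * f z := by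
  have hc' : c ≠ 0 := by rw [← norm_ne_zero_iff, hc]; exact one_ne_zero
  rw [hf.map_smul _ z hc', hc]
  simp

/-- The element of the induced space defined by a homogeneous function. -/
def toInd (hf : IsSection lam k f) : IndSpace n lam k :=
  ⟨fun g => (‖(g : Matrix (Fin n) (Fin n) ℂ).det‖ : ℂ) * f (col0 (g : Matrix (Fin n) (Fin n) ℂ)),
    (Complex.measurable_ofReal.comp measurable_det_GL.norm).mul
      (hf.measurable.comp measurable_col0_GL),
    fun g r hr => by
      have hd : (‖(r : Matrix (Fin n) (Fin n) ℂ).det‖ : ℂ) ≠ 0 := by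
        exact_mod_cast norm_ne_zero_iff.2 (Matrix.GeneralLinearGroup.det r).ne_zero
      beta_reduce
      rw [col0_mul_of_mem_parabolic g hr, hf.map_smul _ _ (entry_ne_zero hr), Units.val_mul,
        Matrix.det_mul, halfModulus_eq, chi, norm_mul]
      push_cast
      simp only [mul_inv, inv_div]
      field_simp, by
    refine hf.memLp.ae_eq (Filter.Eventually.of_forall fun u => ?_)
    beta_reduce
    rw [coe_toUnits, norm_det_unitary, Complex.ofReal_one, one_mul]⟩

theorem toInd_apply (hf : IsSection lam k f) (g : GL (Fin n) ℂ) : hf.toInd.1 g =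
    (‖(g : Matrix (Fin n) (Fin n) ℂ).det‖ : ℂ) * f (col0 (g : Matrix (Fin n) (Fin n) ℂ)) := rfl

theorem toInd_unitary (hf : IsSection lam k f) (u : Matrix.unitaryGroup (Fin n) ℂ) :
    hf.toInd.1 (Unitary.toUnits u) = f (col0 (u : Matrix (Fin n) (Fin n) ℂ)) := by
  rw [toInd_apply, coe_toUnits, norm_det_unitary, Complex.ofReal_one, one_mul]

end IsSection

theorem inner_indSpace {lam : ℝ} {k : ℤ} (F F' : IndSpace n lam k) : ⟪F, F'⟫_ℂ =
    ∫ u, star (F.1 (Unitary.toUnits u)) * F'.1 (Unitary.toUnits u) ∂(haarU n) := by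
  change ⟪restrictK F, restrictK F'⟫_ℂ = _
  rw [L2.inner_def]
  refine integral_congr_ae ?_
  filter_upwards [F.2.2.2.coeFn_toLp, F'.2.2.2.coeFn_toLp] with u h1 h2
  change ⟪F.2.2.2.toLp _ u, F'.2.2.2.toLp _ u⟫_ℂ = _
  rw [h1, h2, RCLike.inner_apply, mul_comm]
  rfl

open Classical in
/-- Every element of the induced space is almost everywhere given by a homogeneous function. -/
theorem exists_isSection {lam : ℝ} {k : ℤ} (F : IndSpace n lam k) :
    ∃ (f : (Fin n → ℂ) → ℂ) (hf : IsSection lam k f),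
      (F : Completion (IndSpace n lam k)) = hf.toInd := by
  -- F(g) / |det g| depends on g only through its first column, and `withCol0 z` has determinant z
  -- 0. The default value 0 on the hyperplane z 0 = 0 is harmless, since this meets the sphere in a
  -- null set.
  set f : (Fin n → ℂ) → ℂ := fun z =>
    if hz : z 0 ≠ 0 then F.1 (withCol0 z hz) / (‖z 0‖ : ℂ) else 0 with hfdef
  have hs : MeasurableSet {z : Fin n → ℂ | z 0 ≠ 0} :=
    (measurableSet_singleton (0 : ℂ)).compl.preimage (measurable_pi_apply 0)
  have hfm : Measurable f := by
    refine Measurable.dite (s := {z : Fin n → ℂ | z 0 ≠ 0})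
      (f := fun z => F.1 (withCol0 z.1 z.2) / (‖z.1 0‖ : ℂ)) (g := fun _ => 0) ?_
      measurable_const hs
    have h1 : Measurable fun z : {z : Fin n → ℂ | z 0 ≠ 0} => withCol0 z.1 z.2 :=
      Measurable.of_comap_le (by
        rw [Units.instMeasurableSpace, MeasurableSpace.comap_comp]
        have : Measurable fun z : {z : Fin n → ℂ | z 0 ≠ 0} =>
            (1 : Matrix (Fin n) (Fin n) ℂ).updateCol 0 z.1 :=
          (continuous_const.matrix_updateCol 0 continuous_subtype_val).measurable
        exact this.comap_le)
    exact (F.2.1.comp h1).div (Complex.measurable_ofReal.comp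
      ((measurable_pi_apply 0).comp measurable_subtype_coe).norm)
  -- Here g = g' r with r in the parabolic subgroup and upper left entry c; the determinant of r
  -- cancels the one in `halfModulus`.
  have key : ∀ (g g' : GL (Fin n) ℂ) (c : ℂ), col0 (g : Matrix (Fin n) (Fin n) ℂ) =
      c • col0 (g' : Matrix (Fin n) (Fin n) ℂ) →
      F.1 g / (‖(g : Matrix (Fin n) (Fin n) ℂ).det‖ : ℂ) =
        ((‖c‖ : ℂ) ^ n * ((‖c‖ : ℂ) ^ (Complex.I * lam) * (c / (‖c‖ : ℂ)) ^ k))⁻¹ *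
          (F.1 g' / (‖(g' : Matrix (Fin n) (Fin n) ℂ).det‖ : ℂ)) := by
    intro g g' c h
    set r := g'⁻¹ * g with hr
    have hcol : col0 (r : Matrix (Fin n) (Fin n) ℂ) = c • Pi.single 0 1 := by
      rw [hr, Units.val_mul, col0_mul, h, Matrix.mulVec_smul, ← col0_mul, ← Units.val_mul,
        inv_mul_cancel]
      congr 1
      ext i
      by_cases hi : i = 0
      · subst hi; simp [col0]
      · simp [col0, hi]
    have hP : r ∈ parabolic n := fun i hi => by
      have := congrFun hcol i
      simpa [col0, hi] using this
    have hc : r 0 0 = c := by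
      have := congrFun hcol 0
      simpa [col0] using this
    have hg : g = g' * r := by rw [hr, mul_inv_cancel_left]
    have hd : (‖(r : Matrix (Fin n) (Fin n) ℂ).det‖ : ℂ) ≠ 0 := by
      exact_mod_cast norm_ne_zero_iff.2 (Matrix.GeneralLinearGroup.det r).ne_zero
    have hF : F.1 g = ((halfModulus r : ℂ) * chi (Complex.I * lam) k r)⁻¹ * F.1 g' := by
      conv_lhs => rw [hg]
      exact F.2.2.1 g' r hP
    rw [hF, hg, Units.val_mul, Matrix.det_mul, halfModulus_eq, chi, hc, norm_mul]
    push_cast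
    simp only [mul_inv, inv_div]
    field_simp
  have hsmul : ∀ (c : ℂ) (z : Fin n → ℂ), c ≠ 0 → f (c • z) =
      ((‖c‖ : ℂ) ^ n * ((‖c‖ : ℂ) ^ (Complex.I * lam) * (c / (‖c‖ : ℂ)) ^ k))⁻¹ * f z := by
    intro c z hc
    by_cases hz : z 0 ≠ 0
    · have hcz : (c • z) 0 ≠ 0 := mul_ne_zero hc hz
      have := key (withCol0 (c • z) hcz) (withCol0 z hz) c (by rw [col0_withCol0, col0_withCol0])
      rw [det_withCol0, det_withCol0] at this
      simp only [hfdef]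
      rw [dif_pos hz, dif_pos hcz, this]
    · have hcz : ¬ (c • z) 0 ≠ 0 := by
        simp only [ne_eq, not_not] at hz
        simp [hz]
      simp only [hfdef]
      rw [dif_neg hz, dif_neg hcz, mul_zero]
  have hae : ∀ᵐ u : Matrix.unitaryGroup (Fin n) ℂ ∂(haarU n), F.1 (Unitary.toUnits u) =
      f (col0 (u : Matrix (Fin n) (Fin n) ℂ)) := by
    filter_upwards [ae_entry_ne_zero (1 : GL (Fin n) ℂ)] with u hu
    have hz : (col0 (u : Matrix (Fin n) (Fin n) ℂ)) 0 ≠ 0 := by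
      simpa [col0] using hu
    have := key (Unitary.toUnits u) (withCol0 _ hz) 1 (by
      rw [col0_withCol0, one_smul, coe_toUnits])
    simp only [hfdef]
    rw [dif_pos hz]
    rw [det_withCol0, coe_toUnits, norm_det_unitary] at this
    simpa using this
  have hf : IsSection lam k f := ⟨hfm, hsmul, F.2.2.2.ae_eq hae⟩
  refine ⟨f, hf, ?_⟩
  rw [← sub_eq_zero, ← Completion.coe_sub, ← norm_eq_zero, Completion.norm_coe, norm_indSpace,
    eLpNorm_congr_ae (g := 0), eLpNorm_zero, ENNReal.toReal_zero]
  filter_upwards [hae] with u hu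
  change F.1 (Unitary.toUnits u) - hf.toInd.1 (Unitary.toUnits u) = 0
  rw [hf.toInd_unitary, hu, sub_self]

end

/-! ### Elementary functions on ℂ^p × ℂ^q -/

section
variable {p q : ℕ}

/-- The first `p` coordinates. -/
def fstVec (z : Fin (p + q) → ℂ) : Fin p → ℂ := fun i => z (Fin.castAdd q i)

/-- The last `q` coordinates. -/
def sndVec (z : Fin (p + q) → ℂ) : Fin q → ℂ := fun i => z (Fin.natAdd p i)

theorem joinVec_fstVec_sndVec (z : Fin (p + q) → ℂ) : joinVec (fstVec z) (sndVec z) = z := by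
  ext i
  obtain ⟨j, rfl⟩ := finSumFinEquiv.surjective i
  rcases j with j | j <;> simp [joinVec, fstVec, sndVec]

@[simp] theorem fstVec_joinVec (x : Fin p → ℂ) (y : Fin q → ℂ) : fstVec (joinVec x y) = x :=
  funext fun i => joinVec_castAdd x y i

@[simp] theorem sndVec_joinVec (x : Fin p → ℂ) (y : Fin q → ℂ) : sndVec (joinVec x y) = y :=
  funext fun i => joinVec_natAdd x y i

theorem fstVec_smul (c : ℂ) (z : Fin (p + q) → ℂ) : fstVec (c • z) = c • fstVec z := rfl

theorem sndVec_smul (c : ℂ) (z : Fin (p + q) → ℂ) : sndVec (c • z) = c • sndVec z := rfl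

theorem measurable_fstVec : Measurable (fstVec (p := p) (q := q)) :=
  measurable_pi_lambda _ fun _ => measurable_pi_apply _

theorem measurable_sndVec : Measurable (sndVec (p := p) (q := q)) :=
  measurable_pi_lambda _ fun _ => measurable_pi_apply _

/-- The function `|y|^{-iλ} f₁(x) f₂(y) ψ((log |x| - log |y|) / 2π)` of `(x, y)`. -/
def branchFun (lam : ℝ) (f₁ : (Fin p → ℂ) → ℂ) (f₂ : (Fin q → ℂ) → ℂ) (ψ : ℝ → ℂ)
    (z : Fin (p + q) → ℂ) : ℂ :=
  (euclNorm (sndVec z) : ℂ) ^ (-(Complex.I * lam)) * (f₁ (fstVec z) * f₂ (sndVec z)) *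
    ψ ((Real.log (euclNorm (fstVec z)) - Real.log (euclNorm (sndVec z))) / (2 * Real.pi))

variable {lam : ℝ} {f₁ : (Fin p → ℂ) → ℂ} {f₂ : (Fin q → ℂ) → ℂ} {ψ : ℝ → ℂ}

theorem measurable_branchFun (h₁ : Measurable f₁) (h₂ : Measurable f₂) (hψ : Measurable ψ) :
    Measurable (branchFun lam f₁ f₂ ψ) := by
  have m1 : Measurable fun z : Fin (p + q) → ℂ => euclNorm (fstVec z) :=
    continuous_euclNorm.measurable.comp measurable_fstVec
  have m2 : Measurable fun z : Fin (p + q) → ℂ => euclNorm (sndVec z) :=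
    continuous_euclNorm.measurable.comp measurable_sndVec
  exact (((Complex.measurable_ofReal.comp m2).pow_const _).mul
    ((h₁.comp measurable_fstVec).mul (h₂.comp measurable_sndVec))).mul
    (hψ.comp (((Real.measurable_log.comp m1).sub (Real.measurable_log.comp m2)).div_const _))

theorem lintegral_comp_div {g : ℝ → ℝ≥0∞} (hg : Measurable g) {a : ℝ} (ha : 0 < a) :
    ∫⁻ t : ℝ, g (t / a) = ENNReal.ofReal a * ∫⁻ t : ℝ, g t := by
  have h := Real.map_volume_mul_right (a := a⁻¹) (inv_ne_zero ha.ne')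
  rw [inv_inv, abs_of_pos ha] at h
  calc ∫⁻ t : ℝ, g (t / a) = ∫⁻ t : ℝ, g (t * a⁻¹) := by simp only [div_eq_mul_inv]
    _ = ∫⁻ t : ℝ, g t ∂(Measure.map (fun t : ℝ => t * a⁻¹) volume) :=
      (lintegral_map hg (measurable_mul_const _)).symm
    _ = _ := by rw [h, lintegral_smul_measure, smul_eq_mul]

variable [NeZero p] [NeZero q] {k k' : ℤ}

/-- The degrees -p and -q add up to -(p + q), the phases of parameters k' and k - k' combine to that
of k, the power of |y| supplies λ, and |x| / |y| is scale invariant. If x or y is zero the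
logarithms do not scale, but then both sides vanish by `IsSection.map_zero`. -/
theorem branchFun_smul (h₁ : IsSection 0 k' f₁) (h₂ : IsSection 0 (k - k') f₂) (c : ℂ)
    (z : Fin (p + q) → ℂ) (hc : c ≠ 0) : branchFun lam f₁ f₂ ψ (c • z) =
    ((‖c‖ : ℂ) ^ (p + q) * ((‖c‖ : ℂ) ^ (Complex.I * lam) * (c / (‖c‖ : ℂ)) ^ k))⁻¹ *
      branchFun lam f₁ f₂ ψ z := by
  by_cases hx : fstVec z = 0
  · simp [branchFun, fstVec_smul, hx, h₁.map_zero]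
  by_cases hy : sndVec z = 0
  · simp [branchFun, sndVec_smul, hy, h₂.map_zero]
  have hc' : ‖c‖ ≠ 0 := norm_ne_zero_iff.2 hc
  have hcc : (‖c‖ : ℂ) ≠ 0 := by exact_mod_cast hc'
  have hx' := euclNorm_pos hx
  have hy' := euclNorm_pos hy
  have hlog : Real.log (euclNorm (fstVec (c • z))) - Real.log (euclNorm (sndVec (c • z))) =
      Real.log (euclNorm (fstVec z)) - Real.log (euclNorm (sndVec z)) := by
    rw [fstVec_smul, sndVec_smul, euclNorm_smul, euclNorm_smul, Real.log_mul hc' hx'.ne',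
      Real.log_mul hc' hy'.ne']
    ring
  have hphase : (c / (‖c‖ : ℂ)) ^ k = (c / (‖c‖ : ℂ)) ^ k' * (c / (‖c‖ : ℂ)) ^ (k - k') := by
    rw [← zpow_add₀ (div_ne_zero hc hcc)]; congr 1; ring
  rw [branchFun, branchFun, hlog, fstVec_smul, sndVec_smul, h₁.map_smul c _ hc,
    h₂.map_smul c _ hc, euclNorm_smul, Complex.ofReal_mul,
    Complex.mul_cpow_ofReal_nonneg (norm_nonneg c) hy'.le, hphase, pow_add, Complex.cpow_neg]
  simp only [Complex.ofReal_zero, mul_zero, Complex.cpow_zero, one_mul, mul_inv]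
  ring

/-- The vectors x and y are not normalized, since the formula is also needed after translation by
(g, h). -/
theorem branchFun_joinVec {q : ℕ} {f₂ : (Fin q → ℂ) → ℂ} (h₁ : IsSection 0 k' f₁) (t : ℝ) {x : Fin p → ℂ} (hx : x ≠ 0)
    (y : Fin q → ℂ) : branchFun lam f₁ f₂ ψ (joinVec ((Real.exp t : ℂ) • x) y) =
    ((Real.exp t : ℂ) ^ p)⁻¹ * ((euclNorm y : ℂ) ^ (-(Complex.I * lam)) * (f₁ x * f₂ y) *
      ψ ((t + (Real.log (euclNorm x) - Real.log (euclNorm y))) / (2 * Real.pi))) := by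
  rw [branchFun, fstVec_joinVec, sndVec_joinVec, h₁.map_pos_smul (Real.exp_pos t),
    euclNorm_exp_smul, Real.log_mul (Real.exp_pos t).ne' (euclNorm_pos hx).ne', Real.log_exp]
  simp only [Complex.ofReal_zero, mul_zero, Complex.cpow_zero, mul_one, add_sub_assoc]
  ring

theorem branchFun_branchVec (h₁ : IsSection 0 k' f₁)
    (x : Matrix.unitaryGroup (Fin p) ℂ × Matrix.unitaryGroup (Fin q) ℂ × ℝ) :
    branchFun lam f₁ f₂ ψ (branchVec x) = ((Real.exp x.2.2 : ℂ) ^ p)⁻¹ *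
      (f₁ (col0 (x.1 : Matrix (Fin p) (Fin p) ℂ)) *
        f₂ (col0 (x.2.1 : Matrix (Fin q) (Fin q) ℂ)) * ψ (x.2.2 / (2 * Real.pi))) := by
  have hx : col0 (x.1 : Matrix (Fin p) (Fin p) ℂ) ≠ 0 := by
    intro h
    have := euclNorm_col0_coe x.1
    rw [h] at this
    simp [euclNorm] at this
  rw [branchVec, branchFun_joinVec h₁ _ hx, euclNorm_col0_coe, euclNorm_col0_coe]
  simp

/-- The Jacobian e^(2pt) of `lintegral_branch` cancels |e^(-pt)|², so that the integral splits into
three factors. This yields square integrability for ψ in L², and continuity in ψ. -/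
theorem lintegral_branchFun (h₁ : IsSection 0 k' f₁) (h₂ : IsSection 0 (k - k') f₂)
    (hψ : Measurable ψ) :
    ∫⁻ u, ‖branchFun lam f₁ f₂ ψ (col0 (u : Matrix (Fin (p + q)) (Fin (p + q)) ℂ))‖ₑ ^ 2
      ∂(haarU (p + q)) = branchConst p q *
      ((∫⁻ u, ‖f₁ (col0 (u : Matrix (Fin p) (Fin p) ℂ))‖ₑ ^ 2 ∂(haarU p)) *
        ((∫⁻ v, ‖f₂ (col0 (v : Matrix (Fin q) (Fin q) ℂ))‖ₑ ^ 2 ∂(haarU q)) *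
          (ENNReal.ofReal (2 * Real.pi) * ∫⁻ t, ‖ψ t‖ₑ ^ 2))) := by
  have hm := measurable_branchFun (lam := lam) h₁.measurable h₂.measurable hψ
  rw [lintegral_branch (φ := fun z => ‖branchFun lam f₁ f₂ ψ z‖ₑ ^ 2) (hm.enorm.pow_const 2)]
  · have m1 : Measurable fun u : Matrix.unitaryGroup (Fin p) ℂ =>
        ‖f₁ (col0 (u : Matrix (Fin p) (Fin p) ℂ))‖ₑ ^ 2 :=
      (h₁.measurable.comp measurable_col0).enorm.pow_const 2
    have m2 : Measurable fun u : Matrix.unitaryGroup (Fin q) ℂ =>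
        ‖f₂ (col0 (u : Matrix (Fin q) (Fin q) ℂ))‖ₑ ^ 2 :=
      (h₂.measurable.comp measurable_col0).enorm.pow_const 2
    have m3 : Measurable fun t : ℝ => ‖ψ (t / (2 * Real.pi))‖ₑ ^ 2 :=
      (hψ.comp (measurable_id.div_const _)).enorm.pow_const 2
    have m4 : Measurable fun x : Matrix.unitaryGroup (Fin q) ℂ × ℝ =>
        ‖f₂ (col0 (x.1 : Matrix (Fin q) (Fin q) ℂ))‖ₑ ^ 2 * ‖ψ (x.2 / (2 * Real.pi))‖ₑ ^ 2 :=
      (m2.comp measurable_fst).mul (m3.comp measurable_snd)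
    rw [← lintegral_comp_div (hψ.enorm.pow_const 2) Real.two_pi_pos,
      ← lintegral_prod_mul m2.aemeasurable m3.aemeasurable,
      ← lintegral_prod_mul m1.aemeasurable m4.aemeasurable, branchMeasure]
    congr 1
    refine lintegral_congr fun x => ?_
    rw [branchFun_branchVec h₁]
    have he : ‖((Real.exp x.2.2 : ℂ) ^ p)⁻¹‖ₑ = (ENNReal.ofReal (Real.exp x.2.2) ^ p)⁻¹ := by
      rw [enorm_inv (pow_ne_zero _ (by exact_mod_cast (Real.exp_pos _).ne')), enorm_pow,
        ← ofReal_norm, Complex.norm_real, Real.norm_of_nonneg (Real.exp_pos _).le]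
    rw [enorm_mul, he, enorm_mul, enorm_mul, mul_pow, ← mul_assoc, ← ENNReal.inv_pow, ← pow_mul,
      mul_comm p 2, ENNReal.mul_inv_cancel, one_mul]
    · ring
    · exact pow_ne_zero _ (by simpa using Real.exp_pos _)
    · exact ENNReal.pow_ne_top ENNReal.ofReal_ne_top
  · intro r z hr
    have hr' : (r : ℂ) ≠ 0 := by exact_mod_cast hr.ne'
    have hn : ‖branchFun lam f₁ f₂ ψ z‖ = r ^ (p + q) * ‖branchFun lam f₁ f₂ ψ ((r : ℂ) • z)‖ := by
      rw [branchFun_smul h₁ h₂ _ z hr', Complex.norm_real, Real.norm_of_nonneg hr.le,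
        div_self hr', one_zpow, mul_one, norm_mul, norm_inv, norm_mul,
        Complex.norm_cpow_eq_rpow_re_of_pos hr, norm_pow, Complex.norm_real,
        Real.norm_of_nonneg hr.le]
      have : (Complex.I * (lam : ℂ)).re = 0 := by simp
      rw [this, Real.rpow_zero, mul_one, mul_inv_cancel_left₀ (pow_ne_zero _ hr.ne')]
    rw [← ofReal_norm (branchFun lam f₁ f₂ ψ z), hn, ENNReal.ofReal_mul (by positivity),
      ofReal_norm, ENNReal.ofReal_pow hr.le]
    ring

theorem isSection_branchFun (h₁ : IsSection 0 k' f₁) (h₂ : IsSection 0 (k - k') f₂)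
    (hψ : Measurable ψ) (hψ2 : MemLp ψ 2) : IsSection lam k (branchFun lam f₁ f₂ ψ) where
  measurable := measurable_branchFun h₁.measurable h₂.measurable hψ
  map_smul := branchFun_smul h₁ h₂
  memLp := by
    have key : ∀ {α : Type} [MeasurableSpace α] (μ : Measure α) (f : α → ℂ), MemLp f 2 μ →
        ∫⁻ x, ‖f x‖ₑ ^ 2 ∂μ ≠ ∞ := fun μ f hf => by
      have := lintegral_rpow_enorm_lt_top_of_eLpNorm_lt_top two_ne_zero ENNReal.ofNat_ne_top hf.2
      simpa using this.ne
    refine ⟨((measurable_branchFun h₁.measurable h₂.measurable hψ).comp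
      measurable_col0).aestronglyMeasurable, ?_⟩
    rw [eLpNorm_two, lintegral_branchFun h₁ h₂ hψ]
    refine ENNReal.rpow_lt_top_of_nonneg (by norm_num) ?_
    refine ENNReal.mul_ne_top (branchConst_ne_top p q) (ENNReal.mul_ne_top (key _ _ h₁.memLp)
      (ENNReal.mul_ne_top (key _ _ h₂.memLp) (ENNReal.mul_ne_top ENNReal.ofReal_ne_top
        (key _ _ hψ2))))

end

/-! ### Integrands of matrix coefficients -/

section
variable {n : ℕ} [NeZero n]

theorem measurable_star_comp {α : Type*} [MeasurableSpace α] {f : α → ℂ} (hf : Measurable f) :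
    Measurable fun x => star (f x) :=
  continuous_star.measurable.comp hf

theorem mulVec_ne_zero {m : ℕ} (a : GL (Fin m) ℂ) {z : Fin m → ℂ} (hz : z ≠ 0) :
    (a : Matrix (Fin m) (Fin m) ℂ).mulVec z ≠ 0 := fun h =>
  hz (Matrix.eq_zero_of_mulVec_eq_zero (Matrix.GeneralLinearGroup.det a).ne_zero h)

theorem col0_coe_ne_zero (u : Matrix.unitaryGroup (Fin n) ℂ) :
    col0 (u : Matrix (Fin n) (Fin n) ℂ) ≠ 0 := by
  intro h
  have := euclNorm_col0_coe u
  rw [h] at this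
  simp [euclNorm] at this

theorem euclNorm_mulVec_pos (a : GL (Fin n) ℂ) (u : Matrix.unitaryGroup (Fin n) ℂ) :
    0 < euclNorm ((a : Matrix (Fin n) (Fin n) ℂ).mulVec (col0 (u : Matrix (Fin n) (Fin n) ℂ))) :=
  euclNorm_pos (mulVec_ne_zero a (col0_coe_ne_zero u))

theorem measurable_mulVec_col0 (a : GL (Fin n) ℂ) :
    Measurable fun u : Matrix.unitaryGroup (Fin n) ℂ =>
      (a : Matrix (Fin n) (Fin n) ℂ).mulVec (col0 (u : Matrix (Fin n) (Fin n) ℂ)) :=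
  (measurable_mulVec _).comp measurable_col0

theorem ofReal_cpow_neg_I_mul {r : ℝ} (hr : 0 < r) (s : ℝ) :
    (r : ℂ) ^ (-(Complex.I * s)) = Complex.exp (-(Real.log r * s : ℝ) * Complex.I) := by
  rw [Complex.cpow_def_of_ne_zero (by exact_mod_cast hr.ne'), ← Complex.ofReal_log hr.le]
  congr 1
  push_cast
  ring

theorem norm_ofReal_cpow_neg_I_mul {r : ℝ} (hr : 0 < r) (s : ℝ) :
    ‖(r : ℂ) ^ (-(Complex.I * s))‖ = 1 := by
  rw [ofReal_cpow_neg_I_mul hr, ← Complex.ofReal_neg, Complex.norm_exp_ofReal_mul_I]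

/-- The integrand of a matrix coefficient of the compact picture of the principal series. -/
def coeffFun (a : GL (Fin n) ℂ) (s : ℝ) (f f' : (Fin n → ℂ) → ℂ)
    (u : Matrix.unitaryGroup (Fin n) ℂ) : ℂ :=
  star (f' (col0 (u : Matrix (Fin n) (Fin n) ℂ))) *
    ((euclNorm ((a : Matrix (Fin n) (Fin n) ℂ).mulVec
      (col0 (u : Matrix (Fin n) (Fin n) ℂ))) : ℂ) ^ (-(Complex.I * s)) *
    ((‖(a : Matrix (Fin n) (Fin n) ℂ).det‖ : ℂ) *
      f ((a : Matrix (Fin n) (Fin n) ℂ).mulVec (col0 (u : Matrix (Fin n) (Fin n) ℂ)))))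

/-- The matrix coefficient of the compact picture of the principal series. -/
def sectionCoeff (a : GL (Fin n) ℂ) (s : ℝ) (f f' : (Fin n → ℂ) → ℂ) : ℂ :=
  ∫ u, coeffFun a s f f' u ∂(haarU n)

variable {lam : ℝ} {k k' : ℤ} {f f' : (Fin n → ℂ) → ℂ}

theorem memLp_translate (F : IndSpace n lam k) (a : GL (Fin n) ℂ) :
    MemLp (fun u : Matrix.unitaryGroup (Fin n) ℂ => F.1 (a * Unitary.toUnits u)) 2 (haarU n) := by
  have := (leftRegular lam k a⁻¹ F).2.2.2
  change MemLp (fun u : Matrix.unitaryGroup (Fin n) ℂ => F.1 (a⁻¹⁻¹ * Unitary.toUnits u)) 2 _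
    at this
  rwa [inv_inv] at this

theorem IsSection.toInd_mul_unitary (hf : IsSection lam k f) (a : GL (Fin n) ℂ)
    (u : Matrix.unitaryGroup (Fin n) ℂ) : hf.toInd.1 (a * Unitary.toUnits u) =
      (‖(a : Matrix (Fin n) (Fin n) ℂ).det‖ : ℂ) *
      f ((a : Matrix (Fin n) (Fin n) ℂ).mulVec (col0 (u : Matrix (Fin n) (Fin n) ℂ))) := by
  rw [hf.toInd_apply, Units.val_mul, coe_toUnits, Matrix.det_mul, norm_mul, norm_det_unitary,
    mul_one, col0_mul]

theorem measurable_coeffFun (a : GL (Fin n) ℂ) (s : ℝ) (hf : Measurable f) (hf' : Measurable f') :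
    Measurable (coeffFun a s f f') := by
  have hm := measurable_mulVec_col0 a
  exact (measurable_star_comp (hf'.comp measurable_col0)).mul
    (((Complex.measurable_ofReal.comp (continuous_euclNorm.measurable.comp hm)).pow_const _).mul
      (measurable_const.mul (hf.comp hm)))

/-- The complex power is unimodular, which leaves the product of two functions in L²(U(n)), one of
them a translated section. -/
theorem integrable_coeffFun (hf : IsSection lam k f) (hf' : IsSection lam k' f')
    (a : GL (Fin n) ℂ) (s : ℝ) : Integrable (coeffFun a s f f') (haarU n) := by
  have h1 := memLp_translate hf.toInd a
  have h2 := (hf'.memLp.star.integrable_mul h1)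
  refine h2.mono (measurable_coeffFun a s hf.measurable hf'.measurable).aestronglyMeasurable
    (Filter.Eventually.of_forall fun u => ?_)
  rw [Pi.mul_apply, Pi.star_apply, hf.toInd_mul_unitary, coeffFun, norm_mul, norm_mul,
    norm_ofReal_cpow_neg_I_mul (euclNorm_mulVec_pos a u), one_mul, ← norm_mul]

end

/-! ### Matrix coefficients of the restriction to GL(p) × GL(q) -/

section
variable {p q : ℕ} [NeZero p] [NeZero q] {lam : ℝ} {k k' k'' : ℤ}
  {f₁ f₁' : (Fin p → ℂ) → ℂ} {f₂ f₂' : (Fin q → ℂ) → ℂ}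

theorem isSection_branchFun_schwartz (h₁ : IsSection 0 k' f₁) (h₂ : IsSection 0 (k - k') f₂)
    (ψ : SchwartzMap ℝ ℂ) : IsSection lam k (branchFun lam f₁ f₂ ψ) :=
  isSection_branchFun h₁ h₂ ψ.continuous.measurable (ψ.memLp 2)

/-- The integral over `U(p + q)` defining a matrix coefficient in terms of `U(p) × U(q) × ℝ`. -/
theorem inner_leftRegular_branchFun (h₁ : IsSection 0 k' f₁) (h₂ : IsSection 0 (k - k') f₂)
    (h₁' : IsSection 0 k'' f₁') (h₂' : IsSection 0 (k - k'') f₂') (ψ ψ' : SchwartzMap ℝ ℂ)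
    (g : GL (Fin p) ℂ) (h : GL (Fin q) ℂ) :
    ⟪(isSection_branchFun_schwartz (lam := lam) h₁' h₂' ψ').toInd,
      leftRegular lam k (blockDiag p q (g, h))
        (isSection_branchFun_schwartz h₁ h₂ ψ).toInd⟫_ℂ =
    (branchConst p q).toReal * ∫ x, coeffFun g⁻¹ 0 f₁ f₁' x.1 * (coeffFun h⁻¹ lam f₂ f₂' x.2.1 *
      (star (ψ' (x.2.2 / (2 * Real.pi))) * ψ ((x.2.2 + (
        Real.log (euclNorm (((g⁻¹ : GL (Fin p) ℂ) : Matrix (Fin p) (Fin p) ℂ).mulVec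
          (col0 (x.1 : Matrix (Fin p) (Fin p) ℂ)))) -
        Real.log (euclNorm (((h⁻¹ : GL (Fin q) ℂ) : Matrix (Fin q) (Fin q) ℂ).mulVec
          (col0 (x.2.1 : Matrix (Fin q) (Fin q) ℂ)))))) / (2 * Real.pi))))
        ∂(branchMeasure p q) := by
  set hs := isSection_branchFun_schwartz (lam := lam) h₁ h₂ ψ
  set hs' := isSection_branchFun_schwartz (lam := lam) h₁' h₂' ψ'
  set a := g⁻¹
  set b := h⁻¹
  -- The conjugate of a section times a translated section has degree -2(p + q), because the
  -- imaginary exponents cancel; hence `integral_branch` applies.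
  set φ : (Fin (p + q) → ℂ) → ℂ := fun z => star (branchFun lam f₁' f₂' ψ' z) *
    ((‖(blockDiag p q (a, b) : Matrix (Fin (p + q)) (Fin (p + q)) ℂ).det‖ : ℂ) *
      branchFun lam f₁ f₂ ψ
        ((blockDiag p q (a, b) : Matrix (Fin (p + q)) (Fin (p + q)) ℂ).mulVec z)) with hφ
  have hinv : (blockDiag p q (g, h))⁻¹ = blockDiag p q (a, b) := by
    rw [← map_inv]; rfl
  have hφm : Measurable φ := (measurable_star_comp hs'.measurable).mul
    (measurable_const.mul (hs.measurable.comp (measurable_mulVec _)))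
  have e1 : ⟪hs'.toInd, leftRegular lam k (blockDiag p q (g, h)) hs.toInd⟫_ℂ =
      ∫ u, φ (col0 (u : Matrix (Fin (p + q)) (Fin (p + q)) ℂ)) ∂(haarU (p + q)) := by
    rw [inner_indSpace]
    refine integral_congr_ae (Filter.Eventually.of_forall fun u => ?_)
    change star (hs'.toInd.1 _) * hs.toInd.1 ((blockDiag p q (g, h))⁻¹ * Unitary.toUnits u) = _
    rw [hs'.toInd_unitary, hinv, hs.toInd_mul_unitary]
  rw [e1, integral_branch hφm]
  · congr 1
    refine integral_congr_ae (Filter.Eventually.of_forall fun x => ?_)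
    have hexp : (Real.exp x.2.2 : ℂ) ≠ 0 := by exact_mod_cast (Real.exp_pos _).ne'
    have hcol : branchVec x = joinVec ((Real.exp x.2.2 : ℂ) •
      col0 (x.1 : Matrix (Fin p) (Fin p) ℂ)) (col0 (x.2.1 : Matrix (Fin q) (Fin q) ℂ)) := rfl
    have e2 : (blockDiag p q (a, b) : Matrix (Fin (p + q)) (Fin (p + q)) ℂ).mulVec (branchVec x) =
        joinVec ((Real.exp x.2.2 : ℂ) • (a : Matrix (Fin p) (Fin p) ℂ).mulVec
          (col0 (x.1 : Matrix (Fin p) (Fin p) ℂ)))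
          ((b : Matrix (Fin q) (Fin q) ℂ).mulVec (col0 (x.2.1 : Matrix (Fin q) (Fin q) ℂ))) := by
      rw [hcol, blockDiag_mulVec, Matrix.mulVec_smul]
    simp only [hφ]
    rw [e2, branchFun_branchVec h₁', branchFun_joinVec h₁ _
      (mulVec_ne_zero a (col0_coe_ne_zero x.1)), det_blockDiag, coeffFun, coeffFun, norm_mul]
    have hst : star ((Real.exp x.2.2 : ℂ) ^ p)⁻¹ = ((Real.exp x.2.2 : ℂ) ^ p)⁻¹ := by
      rw [← starRingEnd_apply, map_inv₀, map_pow, Complex.conj_ofReal]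
    rw [star_mul', star_mul', star_mul', hst]
    rw [Complex.ofReal_zero, mul_zero, neg_zero, Complex.cpow_zero, one_mul, Complex.ofReal_mul,
      two_mul, pow_add]
    -- Each of the two functions contributes e^(-pt), and together they cancel the Jacobian e^(2pt).
    have hE : (Real.exp x.2.2 : ℂ) ^ p * ((Real.exp x.2.2 : ℂ) ^ p)⁻¹ = 1 :=
      mul_inv_cancel₀ (pow_ne_zero _ hexp)
    generalize ((Real.exp x.2.2 : ℂ) ^ p)⁻¹ = E' at hE ⊢
    generalize (Real.exp x.2.2 : ℂ) ^ p = E at hE ⊢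
    have hEE : E * E * (E' * E') = 1 := by linear_combination (E * E' + 1) * hE
    refine Eq.trans ?_ (one_mul _)
    rw [← hEE]
    ring
  · intro r z hr
    have hr' : (r : ℂ) ≠ 0 := by exact_mod_cast hr.ne'
    have hX : (r : ℂ) ^ (2 * (p + q)) = star ((r : ℂ) ^ (p + q) * (r : ℂ) ^ (Complex.I * lam)) *
        ((r : ℂ) ^ (p + q) * (r : ℂ) ^ (Complex.I * lam)) := by
      rw [← starRingEnd_apply, Complex.conj_mul', norm_mul,
        Complex.norm_cpow_eq_rpow_re_of_pos hr, norm_pow, Complex.norm_real,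
        Real.norm_of_nonneg hr.le]
      have : (Complex.I * (lam : ℂ)).re = 0 := by simp
      rw [this, Real.rpow_zero, mul_one, mul_comm 2, pow_mul]
      push_cast
      rfl
    have hX0 : (r : ℂ) ^ (p + q) * (r : ℂ) ^ (Complex.I * lam) ≠ 0 :=
      mul_ne_zero (pow_ne_zero _ hr') (by simp [Complex.cpow_eq_zero_iff, hr'])
    have hX1 := star_ne_zero.2 hX0
    simp only [hφ]
    rw [Matrix.mulVec_smul, hs'.map_pos_smul hr, hs.map_pos_smul hr, hX]
    generalize (r : ℂ) ^ (p + q) * (r : ℂ) ^ (Complex.I * lam) = X at hX0 hX1 ⊢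
    have hst : star X⁻¹ = (star X)⁻¹ := by
      rw [← starRingEnd_apply, map_inv₀, starRingEnd_apply]
    rw [star_mul' X⁻¹, hst]
    field_simp

/-- The rescaling by 2π turns a shift by s into the phase e^(-isξ), so that ξ is the spectral
parameter λ' itself. -/
theorem integral_schwartz_translate (φ φ' : SchwartzMap ℝ ℂ) (s : ℝ) :
    ∫ t : ℝ, star (FourierTransform.fourier φ' (t / (2 * Real.pi))) *
      FourierTransform.fourier φ ((t + s) / (2 * Real.pi)) =
    2 * Real.pi * ∫ ξ : ℝ, star (φ' ξ) * φ ξ * Complex.exp (-(s * ξ : ℝ) * Complex.I) := by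
  have h := integral_conj_fourier_mul_translate φ φ' (s / (2 * Real.pi))
  have h2 := Measure.integral_comp_div (fun τ : ℝ => star (FourierTransform.fourier φ' τ) *
      FourierTransform.fourier φ (τ + s / (2 * Real.pi))) (2 * Real.pi)
  simp only [← add_div] at h2
  rw [h2, h, abs_of_pos Real.two_pi_pos, Complex.real_smul]
  push_cast
  congr 1
  refine integral_congr_ae (Filter.Eventually.of_forall fun ξ => ?_)
  have : (2 * Real.pi * (s / (2 * Real.pi)) * ξ : ℂ) = s * ξ := by
    have : (Real.pi : ℂ) ≠ 0 := by exact_mod_cast Real.pi_ne_zero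
    field_simp
  beta_reduce
  rw [this]

/-- The matrix coefficients of the restriction to `GL(p) × GL(q)`, in spectral form. -/
theorem inner_leftRegular_branchFun_fourier (h₁ : IsSection 0 k' f₁)
    (h₂ : IsSection 0 (k - k') f₂) (h₁' : IsSection 0 k'' f₁') (h₂' : IsSection 0 (k - k'') f₂')
    (φ φ' : SchwartzMap ℝ ℂ) (g : GL (Fin p) ℂ) (h : GL (Fin q) ℂ) :
    ⟪(isSection_branchFun_schwartz (lam := lam) h₁' h₂' (FourierTransform.fourier φ')).toInd,
      leftRegular lam k (blockDiag p q (g, h))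
        (isSection_branchFun_schwartz h₁ h₂ (FourierTransform.fourier φ)).toInd⟫_ℂ =
    (branchConst p q).toReal * (2 * Real.pi) * ∫ ξ : ℝ, star (φ' ξ) * φ ξ *
      (sectionCoeff g⁻¹ ξ f₁ f₁' * sectionCoeff h⁻¹ (lam - ξ) f₂ f₂') := by
  rw [inner_leftRegular_branchFun h₁ h₂ h₁' h₂', mul_assoc]
  congr 1
  set a := g⁻¹
  set b := h⁻¹
  set ψ := FourierTransform.fourier φ
  set ψ' := FourierTransform.fourier φ'
  set la : Matrix.unitaryGroup (Fin p) ℂ → ℝ := fun u =>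
    Real.log (euclNorm ((a : Matrix (Fin p) (Fin p) ℂ).mulVec
      (col0 (u : Matrix (Fin p) (Fin p) ℂ)))) with hla
  set lb : Matrix.unitaryGroup (Fin q) ℂ → ℝ := fun v =>
    Real.log (euclNorm ((b : Matrix (Fin q) (Fin q) ℂ).mulVec
      (col0 (v : Matrix (Fin q) (Fin q) ℂ)))) with hlb
  have hlam : Measurable la := Real.measurable_log.comp
    (continuous_euclNorm.measurable.comp (measurable_mulVec_col0 a))
  have hlbm : Measurable lb := Real.measurable_log.comp
    (continuous_euclNorm.measurable.comp (measurable_mulVec_col0 b))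
  have hA := integrable_coeffFun h₁ h₁' a 0
  have hB := integrable_coeffFun h₂ h₂' b lam
  have hAm := measurable_coeffFun a 0 h₁.measurable h₁'.measurable
  have hBm := measurable_coeffFun b lam h₂.measurable h₂'.measurable
  set ν := (haarU p).prod (haarU q)
  have hAB : Integrable (fun y : Matrix.unitaryGroup (Fin p) ℂ × Matrix.unitaryGroup (Fin q) ℂ =>
      coeffFun a 0 f₁ f₁' y.1 * coeffFun b lam f₂ f₂' y.2) ν := hA.mul_prod hB
  have hABm : Measurable (fun y : Matrix.unitaryGroup (Fin p) ℂ × Matrix.unitaryGroup (Fin q) ℂ =>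
      coeffFun a 0 f₁ f₁' y.1 * coeffFun b lam f₂ f₂' y.2) :=
    (hAm.comp measurable_fst).mul (hBm.comp measurable_snd)
  -- Regrouped so that the integral over ℝ can be carried out first.
  have hreassoc : ∫ x, coeffFun a 0 f₁ f₁' x.1 * (coeffFun b lam f₂ f₂' x.2.1 *
      (star (ψ' (x.2.2 / (2 * Real.pi))) * ψ ((x.2.2 + (la x.1 - lb x.2.1)) / (2 * Real.pi))))
        ∂(branchMeasure p q) =
      ∫ y : (Matrix.unitaryGroup (Fin p) ℂ × Matrix.unitaryGroup (Fin q) ℂ) × ℝ,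
        coeffFun a 0 f₁ f₁' y.1.1 * coeffFun b lam f₂ f₂' y.1.2 *
      (star (ψ' (y.2 / (2 * Real.pi))) * ψ ((y.2 + (la y.1.1 - lb y.1.2)) / (2 * Real.pi)))
        ∂(ν.prod volume) := by
    rw [branchMeasure, ← (measurePreserving_prodAssoc (haarU p) (haarU q)
      (volume : Measure ℝ)).integral_comp']
    simp only [MeasurableEquiv.prodAssoc, MeasurableEquiv.coe_mk, Equiv.prodAssoc_apply, mul_assoc]
    rfl
  rw [hreassoc]
  obtain ⟨C, hC⟩ : ∃ C, ∀ t, ‖ψ t‖ ≤ C :=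
    ⟨_, fun t => ψ.toBoundedContinuousFunction.norm_coe_le_norm t⟩
  have hψ'i : Integrable fun t : ℝ => ψ' (t / (2 * Real.pi)) :=
    ψ'.integrable.comp_div Real.two_pi_pos.ne'
  rw [integral_prod]
  · simp only [integral_const_mul]
    -- For fixed unit vectors the integral over the line is Plancherel's formula with shift log |a u
    -- e₁| - log |b v e₁|.
    have hswap : ∀ y : Matrix.unitaryGroup (Fin p) ℂ × Matrix.unitaryGroup (Fin q) ℂ,
        coeffFun a 0 f₁ f₁' y.1 * coeffFun b lam f₂ f₂' y.2 * ∫ t : ℝ,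
          star (ψ' (t / (2 * Real.pi))) * ψ ((t + (la y.1 - lb y.2)) / (2 * Real.pi)) =
        2 * Real.pi * ∫ ξ : ℝ, coeffFun a 0 f₁ f₁' y.1 * coeffFun b lam f₂ f₂' y.2 *
          (star (φ' ξ) * φ ξ * Complex.exp (-((la y.1 - lb y.2) * ξ : ℝ) * Complex.I)) := by
      intro y
      rw [integral_schwartz_translate, integral_const_mul]
      ring
    simp only [hswap]
    rw [integral_const_mul]
    congr 1
    have hφφ : Integrable fun ξ : ℝ => star (φ' ξ) * φ ξ :=
      (φ'.memLp 2).star.integrable_mul (φ.memLp 2)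
    rw [integral_integral_swap (f := fun (y : Matrix.unitaryGroup (Fin p) ℂ ×
      Matrix.unitaryGroup (Fin q) ℂ) (ξ : ℝ) =>
        coeffFun a 0 f₁ f₁' y.1 * coeffFun b lam f₂ f₂' y.2 *
          (star (φ' ξ) * φ ξ * Complex.exp (-((la y.1 - lb y.2) * ξ : ℝ) * Complex.I)))]
    · refine integral_congr_ae (Filter.Eventually.of_forall fun ξ => ?_)
      beta_reduce
      rw [sectionCoeff, sectionCoeff, ← integral_prod_mul, ← integral_const_mul]
      refine integral_congr_ae (Filter.Eventually.of_forall fun y => ?_)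
      beta_reduce
      simp only [coeffFun]
      rw [ofReal_cpow_neg_I_mul (euclNorm_mulVec_pos a y.1),
        ofReal_cpow_neg_I_mul (euclNorm_mulVec_pos a y.1),
        ofReal_cpow_neg_I_mul (euclNorm_mulVec_pos b y.2),
        ofReal_cpow_neg_I_mul (euclNorm_mulVec_pos b y.2)]
      -- The phase of the shift and the factor |b v e₁|^(-iλ) recombine into |a u e₁|^(-iξ) and |b v
      -- e₁|^(-i(λ - ξ)), the twists of the two compact pictures.
      have hexp : Complex.exp (-((la y.1 - lb y.2) * ξ : ℝ) * Complex.I) *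
          Complex.exp (-(lb y.2 * lam : ℝ) * Complex.I) =
          Complex.exp (-(la y.1 * ξ : ℝ) * Complex.I) *
          Complex.exp (-(lb y.2 * (lam - ξ) : ℝ) * Complex.I) := by
        rw [← Complex.exp_add, ← Complex.exp_add]
        congr 1
        push_cast
        ring
      simp only [hla, hlb] at hexp ⊢
      simp only [mul_zero, Complex.ofReal_zero, neg_zero, zero_mul, Complex.exp_zero, one_mul]
      linear_combination (star (f₁' (col0 (y.1 : Matrix (Fin p) (Fin p) ℂ))) *
        ((‖(a : Matrix (Fin p) (Fin p) ℂ).det‖ : ℂ) *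
          f₁ ((a : Matrix (Fin p) (Fin p) ℂ).mulVec (col0 (y.1 : Matrix (Fin p) (Fin p) ℂ)))) *
        star (f₂' (col0 (y.2 : Matrix (Fin q) (Fin q) ℂ))) *
        ((‖(b : Matrix (Fin q) (Fin q) ℂ).det‖ : ℂ) *
          f₂ ((b : Matrix (Fin q) (Fin q) ℂ).mulVec (col0 (y.2 : Matrix (Fin q) (Fin q) ℂ)))) *
        (star (φ' ξ) * φ ξ)) * hexp
    · refine (hAB.mul_prod hφφ).mono (Measurable.aestronglyMeasurable ?_)
        (Filter.Eventually.of_forall fun y => ?_)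
      · refine (hABm.comp measurable_fst).mul ((((measurable_star_comp φ'.continuous.measurable).mul
          φ.continuous.measurable).comp measurable_snd).mul (Complex.measurable_exp.comp
            ((Complex.measurable_ofReal.comp (((hlam.comp (measurable_fst.comp measurable_fst)).sub
              (hlbm.comp (measurable_snd.comp measurable_fst))).mul measurable_snd)).neg.mul_const
              _)))
      · simp only [Function.uncurry, norm_mul]
        rw [← Complex.ofReal_neg, Complex.norm_exp_ofReal_mul_I, mul_one]
  -- A majorant for Fubini's theorem: of the two transforms one is bounded and the other is
  -- integrable over the line.
  · refine ((hAB.mul_prod hψ'i).const_mul (C : ℂ)).mono (Measurable.aestronglyMeasurable ?_)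
      (Filter.Eventually.of_forall fun y => ?_)
    · refine (hABm.comp measurable_fst).mul
        ((measurable_star_comp (ψ'.continuous.measurable.comp (measurable_snd.div_const _))).mul
        (ψ.continuous.measurable.comp ((measurable_snd.add ((hlam.comp (measurable_fst.comp
          measurable_fst)).sub (hlbm.comp (measurable_snd.comp measurable_fst)))).div_const _)))
    · simp only [norm_mul, norm_star, Complex.norm_real,
        Real.norm_of_nonneg ((norm_nonneg _).trans (hC 0))]
      calc _ = ‖coeffFun a 0 f₁ f₁' y.1.1‖ * ‖coeffFun b lam f₂ f₂' y.1.2‖ *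
            ‖ψ' (y.2 / (2 * Real.pi))‖ * ‖ψ ((y.2 + (la y.1.1 - lb y.1.2)) / (2 * Real.pi))‖ := by
            ring
        _ ≤ ‖coeffFun a 0 f₁ f₁' y.1.1‖ * ‖coeffFun b lam f₂ f₂' y.1.2‖ *
            ‖ψ' (y.2 / (2 * Real.pi))‖ * C := by gcongr; exact hC _
        _ = _ := by ring

end

/-! ### Total families -/

/-- The closed linear span of the family is the whole space. -/
def IsTotal {ι E : Type*} [SeminormedAddCommGroup E] [NormedSpace ℂ E] (v : ι → E) : Prop :=
  (Submodule.span ℂ (Set.range v)).topologicalClosure = ⊤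

section total
variable {ι κ X E F : Type*} [NormedAddCommGroup E] [NormedSpace ℂ E]
  [NormedAddCommGroup F] [NormedSpace ℂ F]

theorem IsTotal.mem {v : ι → E} (hv : IsTotal v) {S : Submodule ℂ E}
    (hS : IsClosed (S : Set E)) (h : ∀ i, v i ∈ S) (x : E) : x ∈ S := by
  have h1 : (Submodule.span ℂ (Set.range v)).topologicalClosure ≤ S :=
    Submodule.topologicalClosure_minimal _
      (Submodule.span_le.2 (Set.range_subset_iff.2 h)) hS
  rw [hv] at h1
  exact h1 trivial

theorem isTotal_of_forall {v : ι → E}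
    (h : ∀ S : Submodule ℂ E, IsClosed (S : Set E) → (∀ i, v i ∈ S) → ∀ x, x ∈ S) : IsTotal v :=
  Submodule.eq_top_iff'.2 fun x => h _ (Submodule.isClosed_topologicalClosure _)
    (fun i => Submodule.le_topologicalClosure _ (Submodule.subset_span (Set.mem_range_self i))) x

theorem isTotal_of_denseRange {v : ι → E} (h : DenseRange v) : IsTotal v :=
  isTotal_of_forall fun S hS hv x => by
    have : closure (Set.range v) ⊆ S := closure_minimal (Set.range_subset_iff.2 hv) hS
    exact this (h x)

/-- The vectors with continuous orbit map form a subspace, which is closed because the uniform bound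
on the operators makes approximation uniform in s. -/
theorem continuous_clm_apply_of_isTotal [TopologicalSpace X] {T : X → E →L[ℂ] F} {C : ℝ}
    (hT : ∀ s, ‖T s‖ ≤ C) {v : ι → E} (hv : IsTotal v) (h : ∀ i, Continuous fun s => T s (v i))
    (x : E) : Continuous fun s => T s x := by
  let S : Submodule ℂ E :=
    { carrier := {x | Continuous fun s => T s x}
      add_mem' := fun {x y} hx hy => by
        simp only [Set.mem_ofPred_eq, map_add] at hx hy ⊢
        exact hx.add hy
      zero_mem' := by
        simp only [Set.mem_ofPred_eq, map_zero]
        exact continuous_const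
      smul_mem' := fun c x hx => by
        simp only [Set.mem_ofPred_eq, map_smul] at hx ⊢
        exact hx.const_smul c }
  refine hv.mem (S := S) ?_ h x
  refine isClosed_of_closure_subset fun y hy => ?_
  refine continuous_of_uniform_approx_of_continuous fun u hu => ?_
  obtain ⟨ε, hε, hu⟩ := Metric.mem_uniformity_dist.1 hu
  obtain ⟨z, hz, hyz⟩ := Metric.mem_closure_iff.1 hy (ε / (|C| + 1)) (by positivity)
  refine ⟨fun s => T s z, hz, fun s => hu ?_⟩
  rw [dist_eq_norm, ← map_sub]
  rw [dist_eq_norm, lt_div_iff₀ (by positivity)] at hyz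
  calc ‖T s (y - z)‖ ≤ C * ‖y - z‖ := (T s).le_of_opNorm_le (hT s) _
    _ ≤ ‖y - z‖ * (|C| + 1) := by
      nlinarith [norm_nonneg (y - z), le_abs_self C]
    _ < ε := hyz

end total

/-- A family of unitary operators whose matrix coefficients with respect to a total family are
continuous is strongly continuous. -/
theorem continuous_unitary_apply {ι X H : Type*} [TopologicalSpace X] [NormedAddCommGroup H]
    [InnerProductSpace ℂ H] (U : X → H ≃ₗᵢ[ℂ] H) {v : ι → H} (hv : IsTotal v)
    (h : ∀ i j, Continuous fun s => ⟪v i, U s (v j)⟫_ℂ) (x : H) : Continuous fun s => U s x := by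
  -- Totality, applied in the second slot, extends the hypothesis from pairs of family members to
  -- arbitrary y.
  have hweak : ∀ j y, Continuous fun s => ⟪U s (v j), y⟫_ℂ := by
    intro j y
    refine continuous_clm_apply_of_isTotal (T := fun s => innerSL ℂ (U s (v j))) (C := ‖v j‖)
      (fun s => ?_) hv (fun i => ?_) y
    · simp
    · have := continuous_star.comp (h i j)
      refine this.congr fun s => ?_
      simp only [Function.comp, innerSL_apply_apply]
      exact inner_conj_symm _ _
  refine continuous_clm_apply_of_isTotal
    (T := fun s => (U s).toContinuousLinearEquiv.toContinuousLinearMap) (C := 1)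
    (fun s => ?_) hv (fun j => ?_) x
  · refine ContinuousLinearMap.opNorm_le_bound _ zero_le_one fun x => ?_
    rw [one_mul]
    exact ((U s).norm_map x).le
  · change Continuous fun s => U s (v j)
    refine continuous_iff_continuousAt.2 fun s₀ => ?_
    rw [ContinuousAt, tendsto_iff_norm_sub_tendsto_zero]
    -- Weak continuity becomes strong continuity: the norms are constant, so the distance is a
    -- function of one inner product.
    have h1 : ∀ s, ‖U s (v j) - U s₀ (v j)‖ =
        Real.sqrt (2 * ‖v j‖ ^ 2 - 2 * RCLike.re ⟪U s (v j), U s₀ (v j)⟫_ℂ) := by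
      intro s
      rw [← Real.sqrt_sq (norm_nonneg (U s (v j) - U s₀ (v j))), @norm_sub_sq ℂ]
      congr 1
      rw [(U s).norm_map, (U s₀).norm_map]
      ring
    simp only [h1]
    have h2 : Continuous fun s => Real.sqrt (2 * ‖v j‖ ^ 2 -
        2 * RCLike.re ⟪U s (v j), U s₀ (v j)⟫_ℂ) :=
      Real.continuous_sqrt.comp (continuous_const.sub
        (continuous_const.mul (RCLike.continuous_re.comp (hweak j _))))
    have h3 := h2.tendsto s₀
    rwa [← h1, sub_self, norm_zero] at h3

/-- Elementary tensors of total families are total in the Hilbert space tensor product. -/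
theorem isTotal_tmul {ι κ H H' : Type*} [NormedAddCommGroup H] [InnerProductSpace ℂ H]
    [NormedAddCommGroup H'] [InnerProductSpace ℂ H'] {v : ι → H} {w : κ → H'}
    (hv : IsTotal v) (hw : IsTotal w) :
    IsTotal fun i : ι × κ => ((v i.1 ⊗ₜ[ℂ] w i.2 : H ⊗[ℂ] H') : HilbertTensor H H') := by
  refine isTotal_of_forall fun S hS h x => ?_
  let B : H →L[ℂ] H' →L[ℂ] H ⊗[ℂ] H' := TensorProduct.mkL ℂ H H'
  let J : H ⊗[ℂ] H' →L[ℂ] HilbertTensor H H' := Completion.toComplL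
  have h1 : ∀ i y, J (B (v i) y) ∈ S := fun i y =>
    hw.mem (S := S.comap (J.comp (B (v i))).toLinearMap) (hS.preimage (J.comp (B (v i))).continuous)
      (fun j => h (i, j)) y
  have h2 : ∀ x y, J (B x y) ∈ S := fun x y =>
    hv.mem (S := S.comap (J.comp (B.flip y)).toLinearMap)
      (hS.preimage (J.comp (B.flip y)).continuous) (fun i => h1 i y) x
  have h3 : ∀ t : H ⊗[ℂ] H', J t ∈ S := by
    intro t
    induction t with
    | zero => rw [map_zero]; exact S.zero_mem
    | tmul x y => exact h2 x y
    | add x y hx hy => rw [map_add]; exact S.add_mem hx hy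
  induction x using Completion.induction_on with
  | hp => exact hS
  | ih t => exact h3 t

theorem completionCongr_symm_coe {V W : Type*} [SeminormedAddCommGroup V]
    [InnerProductSpace ℂ V] [SeminormedAddCommGroup W] [InnerProductSpace ℂ W]
    (f : V ≃ₗᵢ[ℂ] W) (x : W) :
    (completionCongr f).symm (x : Completion W) = (f.symm x : Completion V) := by
  rw [LinearIsometryEquiv.symm_apply_eq, completionCongr_coe, f.apply_symm_apply]

theorem transport_apply {G H H' : Type*} [Group G] [NormedAddCommGroup H] [InnerProductSpace ℂ H]
    [NormedAddCommGroup H'] [InnerProductSpace ℂ H'] (U : H ≃ₗᵢ[ℂ] H') (π : UnitaryRep G H)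
    (g : G) (x : H') : transport U π g x = U (π g (U.symm x)) := rfl

theorem completionRep_coe {G V : Type*} [Group G] [SeminormedAddCommGroup V]
    [InnerProductSpace ℂ V] (ρ : G →* (V ≃ₗᵢ[ℂ] V)) (g : G) (x : V) :
    completionRep ρ g (x : Completion V) = (ρ g x : Completion V) :=
  completionCongr_coe _ _

theorem outerTensor_tmul {G G' H H' : Type*} [Group G] [Group G']
    [NormedAddCommGroup H] [InnerProductSpace ℂ H] [NormedAddCommGroup H'] [InnerProductSpace ℂ H']
    (π : UnitaryRep G H) (τ : UnitaryRep G' H') (g : G × G') (x : H) (y : H') :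
    outerTensor π τ g ((x ⊗ₜ[ℂ] y : H ⊗[ℂ] H') : HilbertTensor H H') =
      ((π g.1 x ⊗ₜ[ℂ] τ g.2 y : H ⊗[ℂ] H') : HilbertTensor H H') :=
  completionRep_coe _ _ _

/-! ### The compact picture -/

section
variable {n : ℕ} [NeZero n]

/-- By `exists_isSection` the homogeneous functions have the same image in the completion as the
whole induced space. -/
theorem isTotal_toInd (lam : ℝ) (k : ℤ) : IsTotal fun f : {f : (Fin n → ℂ) → ℂ //
    IsSection lam k f} => (f.2.toInd : PrincipalSeriesSpace n lam k) := by
  refine isTotal_of_denseRange ?_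
  have h := Completion.denseRange_coe (α := IndSpace n lam k)
  refine h.mono (Set.range_subset_iff.2 fun F => ?_)
  obtain ⟨f, hf, h⟩ := exists_isSection F
  exact ⟨⟨f, hf⟩, h.symm⟩

variable (n) in
/-- The principal series on the space of `π_{0,k}` by restriction to `K`. -/
def compactRep (s : ℝ) (k : ℤ) : UnitaryRep (GL (Fin n) ℂ) (PrincipalSeriesSpace n 0 k) :=
  transport (trivialization n s k) (principalSeries n s k)

theorem compactRep_coe (s : ℝ) (k : ℤ) (g : GL (Fin n) ℂ) (F : IndSpace n 0 k) :
    compactRep n s k g (F : PrincipalSeriesSpace n 0 k) =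
      (changeParameterLinear s 0 k (leftRegular s k g (changeParameterLinear 0 s k F)) :
        IndSpace n 0 k) := by
  rw [compactRep, transport_apply, trivialization, completionCongr_symm_coe, principalSeries,
    completionRep_coe, completionCongr_coe]
  rfl

variable {k k' : ℤ} {f f' : (Fin n → ℂ) → ℂ}

/-- On U(n) the factor of `changeParameter` is 1, while at g⁻¹ u it equals |g⁻¹ u e₁|^(-is), the
twist in `coeffFun`. -/
theorem inner_compactRep (hf : IsSection 0 k f) (hf' : IsSection 0 k f') (s : ℝ)
    (g : GL (Fin n) ℂ) : ⟪(hf'.toInd : PrincipalSeriesSpace n 0 k),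
      compactRep n s k g (hf.toInd : PrincipalSeriesSpace n 0 k)⟫_ℂ = sectionCoeff g⁻¹ s f f' := by
  rw [compactRep_coe, Completion.inner_coe, inner_indSpace, sectionCoeff]
  refine integral_congr_ae (Filter.Eventually.of_forall fun u => ?_)
  change star (hf'.toInd.1 (Unitary.toUnits u)) *
    ((euclNorm (col0 ((Unitary.toUnits u : GL (Fin n) ℂ) : Matrix (Fin n) (Fin n) ℂ)) : ℂ) ^
        (Complex.I * ((s : ℂ) - ((0 : ℝ) : ℂ))) *
      ((euclNorm (col0 ((g⁻¹ * Unitary.toUnits u : GL (Fin n) ℂ) :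
        Matrix (Fin n) (Fin n) ℂ)) : ℂ) ^ (Complex.I * (((0 : ℝ) : ℂ) - s)) *
        hf.toInd.1 (g⁻¹ * Unitary.toUnits u))) = _
  rw [hf'.toInd_unitary, euclNorm_col0_unitary, hf.toInd_mul_unitary, coeffFun, Units.val_mul,
    col0_mul, Complex.ofReal_one, Complex.one_cpow, one_mul, Complex.ofReal_zero, zero_sub,
    mul_neg, coe_toUnits]

/-- The parameter s enters only through a unimodular factor, so the integrand at s = 0 dominates all
the others. -/
theorem continuous_sectionCoeff (hf : IsSection 0 k f) (hf' : IsSection 0 k' f')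
    (a : GL (Fin n) ℂ) : Continuous fun s => sectionCoeff a s f f' := by
  refine continuous_of_dominated (bound := fun u => ‖coeffFun a 0 f f' u‖)
    (fun s => (measurable_coeffFun a s hf.measurable hf'.measurable).aestronglyMeasurable)
    (fun s => Filter.Eventually.of_forall fun u => le_of_eq ?_)
    (integrable_coeffFun hf hf' a 0).norm (Filter.Eventually.of_forall fun u => ?_)
  · simp only [coeffFun, norm_mul, norm_ofReal_cpow_neg_I_mul (euclNorm_mulVec_pos a u)]
  · simp only [coeffFun, ofReal_cpow_neg_I_mul (euclNorm_mulVec_pos a u)]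
    fun_prop

/-- The scalar unitary matrix. -/
def scalarUnitary (n : ℕ) (c : ℂ) (hc : ‖c‖ = 1) : Matrix.unitaryGroup (Fin n) ℂ :=
  ⟨c • 1, by
    rw [Matrix.mem_unitaryGroup_iff, star_smul, star_one, smul_mul_smul_comm, mul_one,
      ← starRingEnd_apply, Complex.mul_conj', hc]
    simp⟩

theorem col0_scalarUnitary_mul {c : ℂ} (hc : ‖c‖ = 1) (u : Matrix.unitaryGroup (Fin n) ℂ) :
    col0 ((scalarUnitary n c hc * u : Matrix.unitaryGroup (Fin n) ℂ) : Matrix (Fin n) (Fin n) ℂ) =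
      c • col0 (u : Matrix (Fin n) (Fin n) ℂ) := by
  change col0 ((c • 1 : Matrix (Fin n) (Fin n) ℂ) * (u : Matrix (Fin n) (Fin n) ℂ)) = _
  rw [smul_mul_assoc, one_mul]
  rfl

/-- Translation by a scalar matrix c with cᵐ = -1 shows that the integral equals its own negative;
integrability plays no role. -/
theorem integral_eq_zero_of_phase {φ : (Fin n → ℂ) → ℂ} {m : ℤ} (hm : m ≠ 0)
    (h : ∀ (c : ℂ) (u : Matrix.unitaryGroup (Fin n) ℂ), ‖c‖ = 1 →
      φ (c • col0 (u : Matrix (Fin n) (Fin n) ℂ)) =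
        c ^ m * φ (col0 (u : Matrix (Fin n) (Fin n) ℂ))) :
    ∫ u, φ (col0 (u : Matrix (Fin n) (Fin n) ℂ)) ∂(haarU n) = 0 := by
  set c : ℂ := Complex.exp ((Real.pi / m : ℝ) * Complex.I) with hcdef
  have hc : ‖c‖ = 1 := Complex.norm_exp_ofReal_mul_I _
  have hcm : c ^ m = -1 := by
    rw [hcdef, ← Complex.exp_int_mul]
    have : (m : ℂ) * ((Real.pi / m : ℝ) * Complex.I) = Real.pi * Complex.I := by
      have : (m : ℂ) ≠ 0 := by exact_mod_cast hm
      push_cast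
      field_simp
    rw [this, Complex.exp_pi_mul_I]
  have h1 := integral_mul_left_eq_self (μ := haarU n)
    (fun u : Matrix.unitaryGroup (Fin n) ℂ => φ (col0 (u : Matrix (Fin n) (Fin n) ℂ)))
    (scalarUnitary n c hc)
  simp only [col0_scalarUnitary_mul, h c _ hc, hcm] at h1
  rw [integral_const_mul] at h1
  linear_combination (-1 / 2 : ℂ) * h1

/-- Scalar unitary matrices act on the two sections by different characters. This is what separates
distinct k' in the source space. -/
theorem sectionCoeff_eq_zero (hkk' : k ≠ k') (hf : IsSection 0 k f) (hf' : IsSection 0 k' f')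
    (a : GL (Fin n) ℂ) (s : ℝ) : sectionCoeff a s f f' = 0 := by
  refine integral_eq_zero_of_phase (m := k' - k) (φ := fun z => star (f' z) *
    ((euclNorm ((a : Matrix (Fin n) (Fin n) ℂ).mulVec z) : ℂ) ^ (-(Complex.I * s)) *
    ((‖(a : Matrix (Fin n) (Fin n) ℂ).det‖ : ℂ) *
      f ((a : Matrix (Fin n) (Fin n) ℂ).mulVec z)))) (sub_ne_zero.2 hkk'.symm) fun c u hc => ?_
  have hc0 : c ≠ 0 := by rw [← norm_ne_zero_iff, hc]; exact one_ne_zero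
  have hst : star (c ^ k')⁻¹ = c ^ k' := by
    have : star c = c⁻¹ := by
      rw [← starRingEnd_apply, Complex.inv_def, Complex.normSq_eq_norm_sq, hc]; simp
    rw [star_inv₀, star_zpow₀, this, inv_zpow, inv_inv]
  rw [Matrix.mulVec_smul, hf.map_circle_smul hc, hf'.map_circle_smul hc, euclNorm_smul, hc,
    one_mul, star_mul', hst, zpow_sub₀ hc0]
  field_simp

end

/-! ### Matrix coefficients and measurability of the field of representations -/

section
variable {p q : ℕ} [NeZero p] [NeZero q] {k k' : ℤ}

/-- The field is an outer tensor product of two compact pictures, which reduces its matrix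
coefficients to one factor at a time. -/
theorem branchingField_tmul (lam lam' : ℝ) (g : GL (Fin p) ℂ) (h : GL (Fin q) ℂ)
    (x : PrincipalSeriesSpace p 0 k') (y : PrincipalSeriesSpace q 0 (k - k')) :
    branchingField p q lam k k' lam' (g, h) ((x ⊗ₜ[ℂ] y :
      PrincipalSeriesSpace p 0 k' ⊗[ℂ] PrincipalSeriesSpace q 0 (k - k')) :
        HilbertTensor (PrincipalSeriesSpace p 0 k') (PrincipalSeriesSpace q 0 (k - k'))) =
      ((compactRep p lam' k' g x ⊗ₜ[ℂ] compactRep q (lam - lam') (k - k') h y :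
      PrincipalSeriesSpace p 0 k' ⊗[ℂ] PrincipalSeriesSpace q 0 (k - k')) :
        HilbertTensor (PrincipalSeriesSpace p 0 k') (PrincipalSeriesSpace q 0 (k - k'))) := by
  rw [branchingField, transport_apply, completionCongr_symm_coe, TensorProduct.congrIsometry_symm,
    TensorProduct.congrIsometry_apply, TensorProduct.congr_tmul, outerTensor_tmul,
    completionCongr_coe, TensorProduct.congrIsometry_apply, TensorProduct.congr_tmul]
  rfl

/-- The elementary tensors of homogeneous functions. -/
def sectionTensor {f₁ : (Fin p → ℂ) → ℂ} {f₂ : (Fin q → ℂ) → ℂ}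
    (h₁ : IsSection 0 k' f₁) (h₂ : IsSection 0 (k - k') f₂) :
    HilbertTensor (PrincipalSeriesSpace p 0 k') (PrincipalSeriesSpace q 0 (k - k')) :=
  (((h₁.toInd : PrincipalSeriesSpace p 0 k') ⊗ₜ[ℂ] (h₂.toInd : PrincipalSeriesSpace q 0 (k - k')) :
    PrincipalSeriesSpace p 0 k' ⊗[ℂ] PrincipalSeriesSpace q 0 (k - k')) :
      HilbertTensor (PrincipalSeriesSpace p 0 k') (PrincipalSeriesSpace q 0 (k - k')))

theorem isTotal_sectionTensor (p q : ℕ) [NeZero p] [NeZero q] (k k' : ℤ) :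
    IsTotal fun f : {f : (Fin p → ℂ) → ℂ // IsSection 0 k' f} ×
      {f : (Fin q → ℂ) → ℂ // IsSection 0 (k - k') f} => sectionTensor f.1.2 f.2.2 := by
  have h₁ := isTotal_toInd (n := p) 0 k'
  have h₂ := isTotal_toInd (n := q) 0 (k - k')
  have h := isTotal_tmul h₁ h₂
  exact h

theorem inner_branchingField {f₁ f₁' : (Fin p → ℂ) → ℂ} {f₂ f₂' : (Fin q → ℂ) → ℂ}
    (h₁ : IsSection 0 k' f₁) (h₂ : IsSection 0 (k - k') f₂) (h₁' : IsSection 0 k' f₁')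
    (h₂' : IsSection 0 (k - k') f₂') (lam lam' : ℝ) (g : GL (Fin p) ℂ) (h : GL (Fin q) ℂ) :
    ⟪sectionTensor h₁' h₂', branchingField p q lam k k' lam' (g, h) (sectionTensor h₁ h₂)⟫_ℂ =
      sectionCoeff g⁻¹ lam' f₁ f₁' * sectionCoeff h⁻¹ (lam - lam') f₂ f₂' := by
  rw [sectionTensor, sectionTensor, branchingField_tmul, Completion.inner_coe,
    TensorProduct.inner_tmul, inner_compactRep, inner_compactRep]

/-- The field is even strongly continuous: by unitarity, continuity of the matrix coefficients on a
total family is enough. -/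
theorem isMeasurableField_branchingField (p q : ℕ) [NeZero p] [NeZero q] (lam : ℝ) (k k' : ℤ) :
    IsMeasurableField (branchingField p q lam k k') volume := by
  intro g v
  refine Continuous.aestronglyMeasurable (continuous_unitary_apply
    (fun s => branchingField p q lam k k' s g) (isTotal_sectionTensor p q k k')
    (fun i j => ?_) v)
  obtain ⟨g, h⟩ := g
  simp only [inner_branchingField]
  exact (continuous_sectionCoeff j.1.2 i.1.2 _).mul
    ((continuous_sectionCoeff j.2.2 i.2.2 _).comp (continuous_const.sub continuous_id))

end

/-! ### Total families in direct integrals and direct sums -/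

theorem IsTotal.map_mem {ι E F : Type*} [NormedAddCommGroup E] [NormedSpace ℂ E]
    [NormedAddCommGroup F] [NormedSpace ℂ F] {v : ι → E} (hv : IsTotal v) (T : E →L[ℂ] F)
    {S : Submodule ℂ F} (hS : IsClosed (S : Set F)) (h : ∀ i, T (v i) ∈ S) (x : E) : T x ∈ S :=
  hv.mem (S := S.comap T.toLinearMap) (hS.preimage T.continuous) h x

section
variable {E : Type*} [NormedAddCommGroup E] [InnerProductSpace ℂ E]

/-- The multiplication `(e, f) ↦ f e` as a map `E × L²(ℝ) → L²(ℝ; E)`. -/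
def smulL2 : E →L[ℂ] Lp ℂ 2 (volume : Measure ℝ) →L[ℂ] Lp E 2 (volume : Measure ℝ) :=
  ContinuousLinearMap.compLpL₂ 2 volume (ContinuousLinearMap.lsmul ℂ ℂ : ℂ →L[ℂ] E →L[ℂ] E).flip

theorem coeFn_smulL2 (e : E) (f : Lp ℂ 2 (volume : Measure ℝ)) :
    smulL2 e f =ᵐ[volume] fun t => f t • e :=
  ContinuousLinearMap.coeFn_compLp _ f

theorem coeFn_smulL2_toLp (e : E) (φ : SchwartzMap ℝ ℂ) :
    smulL2 e (φ.toLp 2 volume) =ᵐ[volume] fun t => φ t • e := by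
  filter_upwards [coeFn_smulL2 e (φ.toLp 2 volume), φ.coeFn_toLp 2 volume] with t h1 h2
  rw [h1, h2]

theorem indicatorConst_eq_smulL2 (c : E) {s : Set ℝ} (hs : MeasurableSet s)
    (hμs : volume s ≠ ∞) : (Lp.simpleFunc.indicatorConst 2 hs hμs c : Lp E 2 (volume : Measure ℝ)) =
      smulL2 c (indicatorConstLp 2 hs hμs 1) := by
  rw [Lp.simpleFunc.coe_indicatorConst]
  ext1
  filter_upwards [coeFn_smulL2 c (indicatorConstLp 2 hs hμs 1),
    indicatorConstLp_coeFn (p := 2) (hs := hs) (hμs := hμs) (c := (1 : ℂ)),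
    indicatorConstLp_coeFn (p := 2) (hs := hs) (hμs := hμs) (c := c)] with t h1 h2 h3
  rw [h1, h2, h3]
  by_cases ht : t ∈ s <;> simp [ht]

theorem isTotal_schwartz_toLp :
    IsTotal fun φ : SchwartzMap ℝ ℂ => φ.toLp 2 (volume : Measure ℝ) :=
  isTotal_of_denseRange (SchwartzMap.denseRange_toLpCLM (p := 2) ENNReal.ofNat_ne_top)

/-- Simple functions are dense, and an indicator function with value c is c times a scalar
indicator. -/
theorem mem_of_forall_smulL2_mem {S : Submodule ℂ (Lp E 2 (volume : Measure ℝ))}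
    (hS : IsClosed (S : Set (Lp E 2 (volume : Measure ℝ)))) (h : ∀ e f, smulL2 e f ∈ S)
    (x : Lp E 2 (volume : Measure ℝ)) : x ∈ S := by
  induction x using Lp.induction (p := 2) ENNReal.ofNat_ne_top with
  | indicatorConst c hs hμs =>
    rw [indicatorConst_eq_smulL2]
    exact h _ _
  | add hf hg _ h1 h2 => exact S.add_mem h1 h2
  | isClosed => exact hS

/-- Since `smulL2` is continuous in each argument, one factor is enlarged at a time: Schwartz
functions to all of L²(ℝ), then the total family to all of `E`. -/
theorem isTotal_smulL2 {ι : Type*} {v : ι → E} (hv : IsTotal v) :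
    IsTotal fun i : SchwartzMap ℝ ℂ × ι => smulL2 (v i.2) (i.1.toLp 2 volume) := by
  refine isTotal_of_forall fun S hS h x => ?_
  have h1 : ∀ i f, smulL2 (v i) f ∈ S := fun i f =>
    isTotal_schwartz_toLp.map_mem (smulL2 (v i)) hS (fun φ => h (φ, i)) f
  have h2 : ∀ e f, smulL2 e f ∈ S := fun e f =>
    hv.map_mem ((smulL2 (E := E)).flip f) hS (fun i => by
      rw [ContinuousLinearMap.flip_apply]; exact h1 i f) e
  exact mem_of_forall_smulL2_mem hS h2 x

end

/-- Every element of a Hilbert sum is the limit of its finite partial sums. -/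
theorem isTotal_lp_single {ι : Type*} [DecidableEq ι] {E : ι → Type*}
    [∀ i, NormedAddCommGroup (E i)] [∀ i, InnerProductSpace ℂ (E i)] {κ : ι → Type*}
    {v : ∀ i, κ i → E i} (hv : ∀ i, IsTotal (v i)) :
    IsTotal fun j : Σ i, κ i => (lp.single 2 j.1 (v j.1 j.2) : lp E 2) := by
  refine isTotal_of_forall fun S hS h x => ?_
  have h1 : ∀ i e, (lp.single 2 i e : lp E 2) ∈ S := fun i e =>
    (hv i).map_mem (lp.singleContinuousLinearMap ℂ E 2 i) hS (fun j => h ⟨i, j⟩) e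
  exact hS.mem_of_tendsto (lp.hasSum_single ENNReal.ofNat_ne_top x)
    (Filter.Eventually.of_forall fun s => S.sum_mem fun i _ => h1 i _)

theorem IsTotal.const_smul {ι E : Type*} [NormedAddCommGroup E] [NormedSpace ℂ E] {v : ι → E}
    (hv : IsTotal v) {c : ℂ} (hc : c ≠ 0) : IsTotal fun i => c • v i :=
  isTotal_of_forall fun S hS h x => hv.mem hS (fun i => by
    have := S.smul_mem c⁻¹ (h i)
    rwa [smul_smul, inv_mul_cancel₀ hc, one_smul] at this) x

theorem inner_hilbertSum_single_self {G ι : Type*} [Group G] [DecidableEq ι] {E : ι → Type*}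
    [∀ i, NormedAddCommGroup (E i)] [∀ i, InnerProductSpace ℂ (E i)]
    (τ : ∀ i, UnitaryRep G (E i)) (g : G) (i : ι) (x y : E i) :
    ⟪(lp.single 2 i x : lp E 2), hilbertSum τ g (lp.single 2 i y)⟫_ℂ = ⟪x, τ i g y⟫_ℂ := by
  rw [lp.inner_single_left]
  change ⟪x, τ i g ((lp.single 2 i y : lp E 2) i)⟫_ℂ = _
  rw [lp.single_apply_self]

theorem inner_hilbertSum_single_of_ne {G ι : Type*} [Group G] [DecidableEq ι] {E : ι → Type*}
    [∀ i, NormedAddCommGroup (E i)] [∀ i, InnerProductSpace ℂ (E i)]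
    (τ : ∀ i, UnitaryRep G (E i)) (g : G) {i j : ι} (hij : i ≠ j) (x : E i) (y : E j) :
    ⟪(lp.single 2 i x : lp E 2), hilbertSum τ g (lp.single 2 j y)⟫_ℂ = 0 := by
  rw [lp.inner_single_left]
  change ⟪x, τ i g ((lp.single 2 j y : lp E 2) i)⟫_ℂ = _
  rw [lp.single_apply_ne _ _ _ hij, map_zero, inner_zero_right]

/-- The factor √C on one family absorbs the constant, so the comparison of measures need only be
known up to a positive factor. -/
theorem unitarilyEquivalent_of_proportional {G H H' ι : Type*} [Group G]
    [NormedAddCommGroup H] [InnerProductSpace ℂ H] [CompleteSpace H]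
    [NormedAddCommGroup H'] [InnerProductSpace ℂ H'] [CompleteSpace H']
    (π : UnitaryRep G H) (τ : UnitaryRep G H') {v : ι → H} {w : ι → H'} (hv : IsTotal v)
    (hw : IsTotal w) {C : ℝ} (hC : 0 < C)
    (h : ∀ g i j, ⟪v i, π g (v j)⟫_ℂ = C * ⟪w i, τ g (w j)⟫_ℂ) : UnitarilyEquivalent π τ := by
  have hs : ((Real.sqrt C : ℝ) : ℂ) ≠ 0 := by exact_mod_cast (Real.sqrt_pos.2 hC).ne'
  refine unitarilyEquivalent_of_matrixCoeff π τ v (fun i => ((Real.sqrt C : ℝ) : ℂ) • w i) hv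
    (hw.const_smul hs) fun g i j => ?_
  rw [h, map_smul, inner_smul_left, inner_smul_right, Complex.conj_ofReal, ← mul_assoc,
    ← Complex.ofReal_mul, Real.mul_self_sqrt hC.le]

theorem inner_directIntegral_smulL2 {G E : Type*} [Group G] [NormedAddCommGroup E]
    [InnerProductSpace ℂ E] (σ : ℝ → UnitaryRep G E) (hσ : IsMeasurableField σ volume)
    (g : G) (φ φ' : SchwartzMap ℝ ℂ) (e e' : E) :
    ⟪smulL2 e' (φ'.toLp 2 volume), directIntegral σ volume hσ g (smulL2 e (φ.toLp 2 volume))⟫_ℂ =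
      ∫ ξ, star (φ' ξ) * φ ξ * ⟪e', σ ξ g e⟫_ℂ := by
  rw [L2.inner_def]
  refine integral_congr_ae ?_
  filter_upwards [directIntegral_apply σ volume hσ g (smulL2 e (φ.toLp 2 volume)),
    coeFn_smulL2_toLp e φ, coeFn_smulL2_toLp e' φ'] with ξ h1 h2 h3
  rw [h1, h2, h3, map_smul, inner_smul_left, inner_smul_right, mul_assoc]
  rfl

/-! ### Elementary vectors in the two Hilbert spaces -/

section
variable {p q : ℕ} [NeZero p] [NeZero q]

/-- The index set of the families of elementary vectors. -/
abbrev BranchIndex (p q : ℕ) [NeZero p] [NeZero q] (k : ℤ) : Type :=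
  Σ k' : ℤ, SchwartzMap ℝ ℂ × {f : (Fin p → ℂ) → ℂ // IsSection 0 k' f} ×
      {f : (Fin q → ℂ) → ℂ // IsSection 0 (k - k') f}

/-- The Hilbert space of the direct sum of direct integrals. -/
abbrev BranchSpace (p q : ℕ) [NeZero p] [NeZero q] (k : ℤ) : Type :=
  lp (fun k' : ℤ => Lp (HilbertTensor (PrincipalSeriesSpace p 0 k')
    (PrincipalSeriesSpace q 0 (k - k'))) 2 (volume : Measure ℝ)) 2

/-- Elementary vectors in the direct sum of direct integrals. -/
def targetVec {k : ℤ} (i : BranchIndex p q k) : BranchSpace p q k :=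
  lp.single 2 i.1 (smulL2 (sectionTensor i.2.2.1.2 i.2.2.2.2) (i.2.1.toLp 2 volume))

theorem isTotal_targetVec (p q : ℕ) [NeZero p] [NeZero q] (k : ℤ) :
    IsTotal (targetVec (p := p) (q := q) (k := k)) := by
  have h := fun k' => isTotal_smulL2 (isTotal_sectionTensor p q k k')
  have h2 := isTotal_lp_single h
  exact h2

/-- Elementary vectors in the principal series of `GL(p + q)`. -/
def sourceVec (lam : ℝ) {k : ℤ} (i : BranchIndex p q k) : PrincipalSeriesSpace (p + q) lam k :=
  ((isSection_branchFun_schwartz (lam := lam) i.2.2.1.2 i.2.2.2.2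
    (FourierTransform.fourier i.2.1)).toInd : IndSpace (p + q) lam k)

/-- For distinct k' the left side vanishes by orthogonality of the summands and the right side by
`sectionCoeff_eq_zero`, so one formula serves all pairs of indices. -/
theorem inner_targetVec (lam : ℝ) (k : ℤ)
    (hσ : ∀ k', IsMeasurableField (branchingField p q lam k k') volume)
    (g : GL (Fin p) ℂ) (h : GL (Fin q) ℂ) (i j : BranchIndex p q k) :
    ⟪targetVec i, hilbertSum (fun k' => directIntegral (branchingField p q lam k k') volume (hσ k'))
        (g, h) (targetVec j)⟫_ℂ =
      ∫ ξ : ℝ, star (i.2.1 ξ) * j.2.1 ξ * (sectionCoeff g⁻¹ ξ j.2.2.1.1 i.2.2.1.1 *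
        sectionCoeff h⁻¹ (lam - ξ) j.2.2.2.1 i.2.2.2.1) := by
  obtain ⟨k'', φ', ⟨f₁', h₁'⟩, ⟨f₂', h₂'⟩⟩ := i
  obtain ⟨k', φ, ⟨f₁, h₁⟩, ⟨f₂, h₂⟩⟩ := j
  by_cases hk : k' = k''
  · subst hk
    refine (inner_hilbertSum_single_self _ _ _ _ _).trans
      ((inner_directIntegral_smulL2 _ _ _ _ _ _ _).trans ?_)
    simp only [inner_branchingField]
  · refine (inner_hilbertSum_single_of_ne _ _ (Ne.symm hk) _ _).trans ?_
    simp only [sectionCoeff_eq_zero hk h₁ h₁', zero_mul, mul_zero, integral_zero]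

theorem inner_sourceVec (lam : ℝ) (k : ℤ)
    (g : GL (Fin p) ℂ) (h : GL (Fin q) ℂ) (i j : BranchIndex p q k) :
    ⟪sourceVec lam i, principalSeries (p + q) lam k (blockDiag p q (g, h)) (sourceVec lam j)⟫_ℂ =
      (branchConst p q).toReal * (2 * Real.pi) *
      ∫ ξ : ℝ, star (i.2.1 ξ) * j.2.1 ξ * (sectionCoeff g⁻¹ ξ j.2.2.1.1 i.2.2.1.1 *
        sectionCoeff h⁻¹ (lam - ξ) j.2.2.2.1 i.2.2.2.1) := by
  rw [sourceVec, sourceVec, principalSeries, completionRep_coe, Completion.inner_coe]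
  exact inner_leftRegular_branchFun_fourier j.2.2.1.2 j.2.2.2.2 i.2.2.1.2 i.2.2.2.2 _ _ _ _

/-- Both families produce the same spectral integral, so only totality in the source remains to be
supplied. -/
theorem unitarilyEquivalent_branching (lam : ℝ) (k : ℤ)
    (hσ : ∀ k', IsMeasurableField (branchingField p q lam k k') volume)
    (hv : IsTotal (sourceVec (p := p) (q := q) lam (k := k))) : UnitarilyEquivalent
        ((principalSeries (p + q) lam k).comp (blockDiag p q))
        (hilbertSum fun k' : ℤ => directIntegral (branchingField p q lam k k') volume (hσ k')) := by
  have hC : 0 < (branchConst p q).toReal * (2 * Real.pi) := mul_pos (ENNReal.toReal_pos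
    (branchConst_ne_zero p q) (branchConst_ne_top p q)) Real.two_pi_pos
  refine unitarilyEquivalent_of_proportional _ _ hv (isTotal_targetVec p q k) hC ?_
  rintro ⟨g, h⟩ i j
  rw [inner_targetVec, MonoidHom.comp_apply, inner_sourceVec]
  push_cast
  rfl

end

/-! ### Homogeneous functions with polynomial growth -/

section
variable {n : ℕ}

theorem norm_apply_le_euclNorm (z : Fin n → ℂ) (i : Fin n) : ‖z i‖ ≤ euclNorm z :=
  PiLp.norm_apply_le (WithLp.toLp 2 z : EuclideanSpace ℂ (Fin n)) i

/-- Functions homogeneous of degree `d` in the absolute value and `a` in the phase. -/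
structure IsHomog (d : ℕ) (a : ℤ) (m : (Fin n → ℂ) → ℂ) : Prop where
  measurable : Measurable m
  map_smul : ∀ (c : ℂ) (z : Fin n → ℂ), c ≠ 0 →
    m (c • z) = (‖c‖ : ℂ) ^ d * (c / (‖c‖ : ℂ)) ^ a * m z
  norm_le : ∀ z, ‖m z‖ ≤ euclNorm z ^ d

namespace IsHomog

theorem one : IsHomog 0 0 (fun _ : Fin n → ℂ => (1 : ℂ)) :=
  ⟨measurable_const, by simp, by simp⟩

theorem mul {d d' : ℕ} {a a' : ℤ} {m m' : (Fin n → ℂ) → ℂ} (h : IsHomog d a m)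
    (h' : IsHomog d' a' m') : IsHomog (d + d') (a + a') fun z => m z * m' z where
  measurable := h.measurable.mul h'.measurable
  map_smul c z hc := by
    have hc' : c / (‖c‖ : ℂ) ≠ 0 := div_ne_zero hc (by exact_mod_cast norm_ne_zero_iff.2 hc)
    rw [h.map_smul c z hc, h'.map_smul c z hc, pow_add, zpow_add₀ hc']
    ring
  norm_le z := by
    rw [norm_mul, pow_add]
    exact mul_le_mul (h.norm_le z) (h'.norm_le z) (norm_nonneg _)
      (pow_nonneg (norm_nonneg _) _)

theorem coord (i : Fin n) : IsHomog 1 1 (fun z : Fin n → ℂ => z i) where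
  measurable := measurable_pi_apply i
  map_smul c z hc := by
    have hc' : (‖c‖ : ℂ) ≠ 0 := by exact_mod_cast norm_ne_zero_iff.2 hc
    simp only [Pi.smul_apply, smul_eq_mul, pow_one, zpow_one]
    field_simp
  norm_le z := by simpa using norm_apply_le_euclNorm z i

theorem star_coord (i : Fin n) : IsHomog 1 (-1) (fun z : Fin n → ℂ => star (z i)) where
  measurable := measurable_star_comp (measurable_pi_apply i)
  map_smul c z hc := by
    have hc' : (‖c‖ : ℂ) ≠ 0 := by exact_mod_cast norm_ne_zero_iff.2 hc
    have h := Complex.mul_conj' c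
    simp only [Pi.smul_apply, smul_eq_mul, pow_one, zpow_neg_one, star_mul', inv_div]
    rw [← starRingEnd_apply c, mul_div_assoc', ← sq, ← h, mul_div_cancel_left₀ _ hc]
  norm_le z := by simpa using norm_apply_le_euclNorm z i

/-- Division by |z|^(n + d) corrects the degree to -n without changing values on unit vectors. The
sign of a flips because sections transform by the inverse character. -/
theorem isSection [NeZero n] {d : ℕ} {a : ℤ} {m : (Fin n → ℂ) → ℂ} (h : IsHomog d a m) :
    IsSection 0 (-a) fun z => ((euclNorm z : ℂ)⁻¹) ^ (n + d) * m z where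
  measurable := ((Complex.measurable_ofReal.comp continuous_euclNorm.measurable).inv.pow_const
    _).mul h.measurable
  map_smul c z hc := by
    have hc' : (‖c‖ : ℂ) ≠ 0 := by exact_mod_cast norm_ne_zero_iff.2 hc
    rw [h.map_smul c z hc, euclNorm_smul, Complex.ofReal_mul, mul_inv, mul_pow, pow_add
      ((‖c‖ : ℂ)⁻¹), Complex.ofReal_zero, mul_zero, Complex.cpow_zero, one_mul, zpow_neg, mul_inv,
      inv_inv, inv_pow, inv_pow]
    have : (‖c‖ : ℂ) ^ d ≠ 0 := pow_ne_zero _ hc'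
    field_simp
  memLp := by
    refine MemLp.of_bound ((((Complex.measurable_ofReal.comp
      continuous_euclNorm.measurable).inv.pow_const _).mul h.measurable).comp
        measurable_col0).aestronglyMeasurable 1 (Filter.Eventually.of_forall fun u => ?_)
    have := h.norm_le (col0 (u : Matrix (Fin n) (Fin n) ℂ))
    simpa [euclNorm_col0_coe] using this

end IsHomog
end

section
variable {p q : ℕ}

/-- Products of homogeneous functions of the first `p` and of the last `q` coordinates. -/
def IsBihomog (m : (Fin (p + q) → ℂ) → ℂ) : Prop :=
  ∃ (d₁ d₂ : ℕ) (a₁ a₂ : ℤ) (m₁ : (Fin p → ℂ) → ℂ) (m₂ : (Fin q → ℂ) → ℂ),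
    IsHomog d₁ a₁ m₁ ∧ IsHomog d₂ a₂ m₂ ∧ ∀ z, m z = m₁ (fstVec z) * m₂ (sndVec z)

theorem IsBihomog.one : IsBihomog fun _ : Fin (p + q) → ℂ => (1 : ℂ) :=
  ⟨0, 0, 0, 0, _, _, IsHomog.one, IsHomog.one, by simp⟩

theorem IsBihomog.mul {m m' : (Fin (p + q) → ℂ) → ℂ} (h : IsBihomog m) (h' : IsBihomog m') :
    IsBihomog fun z => m z * m' z := by
  obtain ⟨_, _, _, _, _, _, h₁, h₂, e⟩ := h
  obtain ⟨_, _, _, _, _, _, h₁', h₂', e'⟩ := h'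
  exact ⟨_, _, _, _, _, _, h₁.mul h₁', h₂.mul h₂', fun z => by beta_reduce; rw [e, e']; ring⟩

theorem IsBihomog.coord (i : Fin (p + q)) : IsBihomog fun z : Fin (p + q) → ℂ => z i := by
  induction i using Fin.addCases with
  | left i => exact ⟨_, _, _, _, _, _, IsHomog.coord i, IsHomog.one, fun z => (mul_one _).symm⟩
  | right i => exact ⟨_, _, _, _, _, _, IsHomog.one, IsHomog.coord i, fun z => (one_mul _).symm⟩

theorem IsBihomog.star_coord (i : Fin (p + q)) :
    IsBihomog fun z : Fin (p + q) → ℂ => star (z i) := by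
  induction i using Fin.addCases with
  | left i =>
    exact ⟨_, _, _, _, _, _, IsHomog.star_coord i, IsHomog.one, fun z => (mul_one _).symm⟩
  | right i =>
    exact ⟨_, _, _, _, _, _, IsHomog.one, IsHomog.star_coord i, fun z => (one_mul _).symm⟩

/-! ### Density of polynomials on the unit sphere -/

section
variable (n : ℕ) [NeZero n]

/-- The set of first columns of unitary matrices. -/
def columnSet : Set (Fin n → ℂ) :=
  Set.range fun u : Matrix.unitaryGroup (Fin n) ℂ => col0 (u : Matrix (Fin n) (Fin n) ℂ)

theorem continuous_col0_unitary : Continuous fun u : Matrix.unitaryGroup (Fin n) ℂ =>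
    col0 (u : Matrix (Fin n) (Fin n) ℂ) :=
  continuous_pi fun i => continuous_subtype_val.matrix_elem i 0

instance : CompactSpace (columnSet n) :=
  isCompact_iff_compactSpace.1 (isCompact_range (continuous_col0_unitary n))

/-- The map from `U(n)` onto the first columns. -/
def toColumn (u : Matrix.unitaryGroup (Fin n) ℂ) : columnSet n :=
  ⟨col0 (u : Matrix (Fin n) (Fin n) ℂ), u, rfl⟩

theorem continuous_toColumn : Continuous (toColumn n) :=
  (continuous_col0_unitary n).subtype_mk _

/-- The invariant probability measure on the unit sphere. -/
def columnMeasure : Measure (columnSet n) := Measure.map (toColumn n) (haarU n)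

instance : IsProbabilityMeasure (columnMeasure n) :=
  Measure.isProbabilityMeasure_map (continuous_toColumn n).measurable.aemeasurable

theorem measurePreserving_toColumn :
    MeasurePreserving (toColumn n) (haarU n) (columnMeasure n) :=
  ⟨(continuous_toColumn n).measurable, rfl⟩

/-- Composition with `toColumn`. -/
def compColumn : Lp ℂ 2 (columnMeasure n) →L[ℂ] Lp ℂ 2 (haarU n) :=
  (Lp.compMeasurePreservingₗᵢ ℂ (toColumn n)
    (measurePreserving_toColumn n)).toContinuousLinearMap

theorem coeFn_compColumn (f : Lp ℂ 2 (columnMeasure n)) :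
    compColumn n f =ᵐ[haarU n] fun u => f (toColumn n u) :=
  Lp.coeFn_compMeasurePreserving f (measurePreserving_toColumn n)

/-- The coordinate functions on the unit sphere. -/
def columnCoord (i : Fin n) : C(columnSet n, ℂ) :=
  ⟨fun z => z.1 i, (continuous_apply i).comp continuous_subtype_val⟩

/-- Stone–Weierstrass: the coordinates separate points. -/
theorem adjoin_columnCoord_dense :
    (StarAlgebra.adjoin ℂ (Set.range (columnCoord n))).topologicalClosure = ⊤ := by
  refine ContinuousMap.starSubalgebra_topologicalClosure_eq_top_of_separatesPoints _ ?_
  intro x y hxy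
  have : ∃ i, x.1 i ≠ y.1 i := by
    by_contra! h
    exact hxy (Subtype.ext (funext h))
  obtain ⟨i, hi⟩ := this
  exact ⟨columnCoord n i, ⟨columnCoord n i, StarAlgebra.subset_adjoin ℂ _ ⟨i, rfl⟩, rfl⟩, hi⟩

end

/-- A closed subspace of `L²(U(n))` containing the monomials in the entries of the first column and
their conjugates contains all functions of the first column. -/
theorem mem_of_forall_bihomog_mem [NeZero (p + q)]
    {Q : Submodule ℂ (Lp ℂ 2 (haarU (p + q)))}
    (hQ : IsClosed (Q : Set (Lp ℂ 2 (haarU (p + q)))))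
    (h : ∀ (m : (Fin (p + q) → ℂ) → ℂ) (F : Lp ℂ 2 (haarU (p + q))), IsBihomog m →
      (F =ᵐ[haarU (p + q)] fun u => m (col0 (u : Matrix (Fin (p + q)) (Fin (p + q)) ℂ))) → F ∈ Q)
    {f : (Fin (p + q) → ℂ) → ℂ} (hf : Measurable f)
    (hf2 : MemLp (fun u : Matrix.unitaryGroup (Fin (p + q)) ℂ =>
      f (col0 (u : Matrix (Fin (p + q)) (Fin (p + q)) ℂ))) 2 (haarU (p + q))) :
    hf2.toLp _ ∈ Q := by
  set T : C(columnSet (p + q), ℂ) →L[ℂ] Lp ℂ 2 (haarU (p + q)) :=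
    (compColumn (p + q)).comp (ContinuousMap.toLp 2 (columnMeasure (p + q)) ℂ) with hT
  have hTg : ∀ g : C(columnSet (p + q), ℂ), T g =ᵐ[haarU (p + q)] fun u => g (toColumn _ u) := by
    intro g
    have h1 := coeFn_compColumn (p + q) (ContinuousMap.toLp 2 (columnMeasure (p + q)) ℂ g)
    have h2 := (measurePreserving_toColumn (p + q)).quasiMeasurePreserving.ae
      (ContinuousMap.coeFn_toLp (p := 2) (columnMeasure (p + q)) (𝕜 := ℂ) g)
    filter_upwards [h1, h2] with u h1 h2
    exact h1.trans h2
  -- Each coordinate or conjugate coordinate involves only x or only y, so every monomial is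
  -- bihomogeneous.
  have hmon : ∀ g ∈ Submonoid.closure
      (Set.range (columnCoord (p + q)) ∪ star (Set.range (columnCoord (p + q)))),
      ∃ m : (Fin (p + q) → ℂ) → ℂ, IsBihomog m ∧ ∀ z, g z = m z.1 := by
    intro g hg
    induction hg using Submonoid.closure_induction with
    | mem g hg =>
      rcases hg with ⟨i, rfl⟩ | hg
      · exact ⟨_, IsBihomog.coord i, fun z => rfl⟩
      · obtain ⟨i, hi⟩ := hg
        refine ⟨_, IsBihomog.star_coord i, fun z => ?_⟩
        rw [← star_star g, ← hi]
        rfl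
    | one => exact ⟨_, IsBihomog.one, fun z => rfl⟩
    | mul g g' _ _ hg hg' =>
      obtain ⟨m, hm, e⟩ := hg
      obtain ⟨m', hm', e'⟩ := hg'
      exact ⟨_, hm.mul hm', fun z => by rw [ContinuousMap.mul_apply, e, e']⟩
  -- The star algebra is the linear span of these monomials; then `hall` passes to continuous
  -- functions and `hcomp` to L² of the sphere, both by density.
  have hadj : ∀ g ∈ StarAlgebra.adjoin ℂ (Set.range (columnCoord (p + q))), T g ∈ Q := by
    intro g hg
    have hg' : g ∈ Subalgebra.toSubmodule
      (StarAlgebra.adjoin ℂ (Set.range (columnCoord (p + q)))).toSubalgebra := hg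
    rw [StarAlgebra.adjoin_eq_span] at hg'
    have hle : Submodule.span ℂ ((Submonoid.closure (Set.range (columnCoord (p + q)) ∪
        star (Set.range (columnCoord (p + q)))) : Submonoid C(columnSet (p + q), ℂ)) :
          Set C(columnSet (p + q), ℂ)) ≤ Q.comap T.toLinearMap := by
      refine Submodule.span_le.2 fun g hg => ?_
      obtain ⟨m, hm, e⟩ := hmon g hg
      refine h m (T g) hm ((hTg g).trans (Filter.Eventually.of_forall fun u => ?_))
      exact e _
    exact hle hg'
  have hall : ∀ g, T g ∈ Q := by
    intro g
    have hg : g ∈ (StarAlgebra.adjoin ℂ (Set.range (columnCoord (p + q)))).topologicalClosure := by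
      rw [adjoin_columnCoord_dense]; trivial
    have hc : closure (StarAlgebra.adjoin ℂ (Set.range (columnCoord (p + q))) :
        Set C(columnSet (p + q), ℂ)) ⊆ T ⁻¹' Q :=
      closure_minimal hadj (hQ.preimage T.continuous)
    exact hc hg
  have hcomp : ∀ F, compColumn (p + q) F ∈ Q := fun F =>
    (isTotal_of_denseRange (ContinuousMap.toLp_denseRange ℂ (columnMeasure (p + q)) ℂ
      (p := 2) ENNReal.ofNat_ne_top)).map_mem (compColumn (p + q)) hQ hall F
  have hfX : MemLp (fun z : columnSet (p + q) => f z.1) 2 (columnMeasure (p + q)) :=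
    (memLp_map_measure_iff (hf.comp measurable_subtype_coe).aestronglyMeasurable
      (continuous_toColumn _).measurable.aemeasurable).2 hf2
  have : hf2.toLp _ = compColumn (p + q) (hfX.toLp _) := by
    ext1
    filter_upwards [hf2.coeFn_toLp, coeFn_compColumn (p + q) (hfX.toLp _),
      (measurePreserving_toColumn (p + q)).quasiMeasurePreserving.ae hfX.coeFn_toLp]
      with u h1 h2 h3
    rw [h1, h2, h3]
    rfl
  rw [this]
  exact hcomp _

end

section
variable {n : ℕ} [NeZero n]

theorem enorm_coe_indSpace_sq {lam : ℝ} {k : ℤ} (F : IndSpace n lam k) :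
    ‖(F : PrincipalSeriesSpace n lam k)‖ₑ ^ 2 =
      ∫⁻ u, ‖F.1 (Unitary.toUnits u)‖ₑ ^ 2 ∂(haarU n) := by
  rw [← ofReal_norm, Completion.norm_coe, norm_indSpace, ENNReal.ofReal_toReal F.2.2.2.2.ne,
    eLpNorm_two, ← ENNReal.rpow_natCast, ← ENNReal.rpow_mul]
  norm_num

end

/-! ### Totality of the elementary vectors of the principal series -/

/-- The function of `log |x| - log |y|` that equals `|x|^A |y|^(B + iλ)` on unit vectors. -/
def branchProfile (lam : ℝ) (A B : ℕ) (t : ℝ) : ℂ :=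
  ((Real.exp (2 * Real.pi * t) * (Real.sqrt (1 + Real.exp (2 * Real.pi * t) ^ 2))⁻¹ : ℝ) : ℂ) ^ A *
    (((Real.sqrt (1 + Real.exp (2 * Real.pi * t) ^ 2))⁻¹ : ℝ) : ℂ) ^ B *
    (((Real.sqrt (1 + Real.exp (2 * Real.pi * t) ^ 2))⁻¹ : ℝ) : ℂ) ^ (Complex.I * lam)

theorem measurable_branchProfile (lam : ℝ) (A B : ℕ) : Measurable (branchProfile lam A B) := by
  have h1 : Continuous fun t : ℝ => Real.exp (2 * Real.pi * t) := by fun_prop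
  have h2 : Measurable fun t : ℝ => (Real.sqrt (1 + Real.exp (2 * Real.pi * t) ^ 2))⁻¹ :=
    (Real.continuous_sqrt.comp (continuous_const.add (h1.pow 2))).measurable.inv
  exact (((Complex.measurable_ofReal.comp (h1.measurable.mul h2)).pow_const A).mul
    ((Complex.measurable_ofReal.comp h2).pow_const B)).mul
      ((Complex.measurable_ofReal.comp h2).pow_const _)

/-- For A = B = 1 the absolute value is 1 / (2 cosh s) with s = 2πt, and larger exponents only
decrease it. Positivity of A gives decay at -∞, that of B at +∞. The quadratic bound comes from |s|
≤ |sinh s|. -/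
theorem norm_branchProfile_le (lam : ℝ) {A B : ℕ} (hA : A ≠ 0) (hB : B ≠ 0) (t : ℝ) :
    ‖branchProfile lam A B t‖ ^ 2 ≤ (1 + t ^ 2)⁻¹ := by
  set s := 2 * Real.pi * t with hs
  set e := Real.exp s with he
  have he0 : 0 < e := Real.exp_pos s
  set r := (Real.sqrt (1 + e ^ 2))⁻¹ with hr
  have hr0 : 0 < r := by positivity
  have hr2 : r ^ 2 * (1 + e ^ 2) = 1 := by
    rw [hr, inv_pow, Real.sq_sqrt (by positivity)]
    exact inv_mul_cancel₀ (by positivity)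
  have hr1 : r ≤ 1 := by nlinarith [sq_nonneg (r * e)]
  have her1 : e * r ≤ 1 := by nlinarith [sq_nonneg r, mul_pos he0 hr0]
  have h1 : ‖branchProfile lam A B t‖ ≤ e * r * r := by
    have : ‖branchProfile lam A B t‖ = (e * r) ^ A * r ^ B := by
      rw [branchProfile, norm_mul, norm_mul, norm_pow, norm_pow, Complex.norm_real,
        Complex.norm_real, Complex.norm_cpow_eq_rpow_re_of_pos hr0,
        Real.norm_of_nonneg (by positivity), Real.norm_of_nonneg hr0.le]
      simp [e, s, r]
    rw [this]
    exact mul_le_mul (pow_le_of_le_one (by positivity) her1 hA)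
      (pow_le_of_le_one hr0.le hr1 hB) (by positivity) (by positivity)
  have h2 : ‖branchProfile lam A B t‖ ^ 2 ≤ (e * r * r) ^ 2 := by gcongr
  refine h2.trans ?_
  have hcosh : e * r * r * (2 * Real.cosh s) = 1 := by
    rw [Real.cosh_eq, Real.exp_neg, ← he]
    field_simp
    linarith
  have hc : 1 + t ^ 2 ≤ (2 * Real.cosh s) ^ 2 := by
    have h3 : |s| ≤ |Real.sinh s| := by
      rw [Real.abs_sinh]; exact Real.self_le_sinh_iff.2 (abs_nonneg _)
    have h4 : s ^ 2 ≤ Real.sinh s ^ 2 := sq_le_sq.2 h3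
    have h5 := Real.cosh_sq s
    have h6 : t ^ 2 ≤ s ^ 2 := by
      rw [hs]
      have h7 : 1 ≤ (2 * Real.pi) ^ 2 := one_le_pow₀ (by linarith [Real.pi_gt_three])
      nlinarith [mul_le_mul_of_nonneg_right h7 (sq_nonneg t)]
    nlinarith
  have h7 : (e * r * r) ^ 2 = ((2 * Real.cosh s) ^ 2)⁻¹ := by
    exact eq_inv_of_mul_eq_one_left (by rw [← mul_pow, hcosh, one_pow])
  rw [h7]
  exact inv_anti₀ (by positivity) hc

theorem memLp_branchProfile (lam : ℝ) {A B : ℕ} (hA : A ≠ 0) (hB : B ≠ 0) :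
    MemLp (branchProfile lam A B) 2 := by
  rw [memLp_two_iff_integrable_sq_norm (measurable_branchProfile lam A B).aestronglyMeasurable]
  refine integrable_inv_one_add_sq.mono
    ((measurable_branchProfile lam A B).norm.pow_const 2).aestronglyMeasurable
    (Filter.Eventually.of_forall fun t => ?_)
  rw [Real.norm_of_nonneg (by positivity), Real.norm_of_nonneg (by positivity)]
  exact norm_branchProfile_le lam hA hB t

/-- On the unit circle the ratio x / y determines both coordinates, since y = (1 + (x / y)²)^(-1/2).
-/
theorem branchProfile_apply {x y : ℝ} (hx : 0 < x) (hy : 0 < y) (hxy : x ^ 2 + y ^ 2 = 1)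
    (lam : ℝ) (A B : ℕ) :
    branchProfile lam A B ((Real.log x - Real.log y) / (2 * Real.pi)) =
      (x : ℂ) ^ A * (y : ℂ) ^ B * (y : ℂ) ^ (Complex.I * lam) := by
  have hs : 2 * Real.pi * ((Real.log x - Real.log y) / (2 * Real.pi)) =
      Real.log x - Real.log y := by
    have := Real.pi_ne_zero
    field_simp
  have he : Real.exp (Real.log x - Real.log y) = x / y := by
    rw [Real.exp_sub, Real.exp_log hx, Real.exp_log hy]
  have hr : (Real.sqrt (1 + (x / y) ^ 2))⁻¹ = y := by
    have : 1 + (x / y) ^ 2 = (y⁻¹) ^ 2 := by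
      field_simp
      linarith
    rw [this, Real.sqrt_sq (by positivity), inv_inv]
  rw [branchProfile, hs, he, hr, div_mul_cancel₀ _ hy.ne']

/-- On unit vectors a product of homogeneous functions agrees with an elementary function. -/
theorem branchFun_isHomog {p q : ℕ} {lam : ℝ} {d₁ d₂ : ℕ} {m₁ : (Fin p → ℂ) → ℂ} {m₂ : (Fin q → ℂ) → ℂ}
    {z : Fin (p + q) → ℂ} (hz : euclNorm z = 1) (hx : fstVec z ≠ 0) (hy : sndVec z ≠ 0) :
    branchFun lam (fun x => ((euclNorm x : ℂ)⁻¹) ^ (p + d₁) * m₁ x)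
      (fun y => ((euclNorm y : ℂ)⁻¹) ^ (q + d₂) * m₂ y)
      (branchProfile lam (p + d₁) (q + d₂)) z = m₁ (fstVec z) * m₂ (sndVec z) := by
  have hx' := euclNorm_pos hx
  have hy' := euclNorm_pos hy
  have h1 : euclNorm (fstVec z) ^ 2 + euclNorm (sndVec z) ^ 2 = 1 := by
    rw [← euclNorm_joinVec_sq, joinVec_fstVec_sndVec, hz, one_pow]
  rw [branchFun, branchProfile_apply hx' hy' h1, Complex.cpow_neg]
  have e1 : (euclNorm (fstVec z) : ℂ) ≠ 0 := by exact_mod_cast hx'.ne'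
  have e2 : (euclNorm (sndVec z) : ℂ) ≠ 0 := by exact_mod_cast hy'.ne'
  have e3 : (euclNorm (sndVec z) : ℂ) ^ (Complex.I * lam) ≠ 0 := by
    simp [Complex.cpow_eq_zero_iff, e2]
  rw [inv_pow, inv_pow]
  field_simp

section
variable {p q : ℕ} [NeZero p] [NeZero q] {lam : ℝ} {k k' : ℤ}
  {f₁ : (Fin p → ℂ) → ℂ} {f₂ : (Fin q → ℂ) → ℂ}

theorem lintegral_section_ne_top {n : ℕ} [NeZero n] {f : (Fin n → ℂ) → ℂ}
    (hf : IsSection lam k f) :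
    ∫⁻ u, ‖f (col0 (u : Matrix (Fin n) (Fin n) ℂ))‖ₑ ^ 2 ∂(haarU n) ≠ ∞ := by
  have h := lintegral_rpow_enorm_lt_top_of_eLpNorm_lt_top two_ne_zero ENNReal.ofNat_ne_top
    hf.memLp.2
  simpa using h.ne

/-- The elementary vectors depend continuously on the `L²` function on the line. -/
theorem enorm_branchFun_sub_sq (h₁ : IsSection 0 k' f₁) (h₂ : IsSection 0 (k - k') f₂) :
    ∃ K : ℝ≥0∞, K ≠ ∞ ∧ ∀ (ψ ψ' : ℝ → ℂ) (hψ : Measurable ψ) (hψ2 : MemLp ψ 2)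
      (hψ' : Measurable ψ') (hψ2' : MemLp ψ' 2),
      ‖((isSection_branchFun (lam := lam) h₁ h₂ hψ hψ2).toInd :
          PrincipalSeriesSpace (p + q) lam k) -
        ((isSection_branchFun (lam := lam) h₁ h₂ hψ' hψ2').toInd :
          PrincipalSeriesSpace (p + q) lam k)‖ₑ ^ 2 = K * ‖hψ2.toLp ψ - hψ2'.toLp ψ'‖ₑ ^ 2 := by
  refine ⟨branchConst p q * ((∫⁻ u, ‖f₁ (col0 (u : Matrix (Fin p) (Fin p) ℂ))‖ₑ ^ 2 ∂(haarU p)) *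
    ((∫⁻ v, ‖f₂ (col0 (v : Matrix (Fin q) (Fin q) ℂ))‖ₑ ^ 2 ∂(haarU q)) *
      ENNReal.ofReal (2 * Real.pi))), ?_, fun ψ ψ' hψ hψ2 hψ' hψ2' => ?_⟩
  · exact ENNReal.mul_ne_top (branchConst_ne_top p q) (ENNReal.mul_ne_top
      (lintegral_section_ne_top h₁) (ENNReal.mul_ne_top (lintegral_section_ne_top h₂)
        ENNReal.ofReal_ne_top))
  · have e1 : ‖hψ2.toLp ψ - hψ2'.toLp ψ'‖ₑ ^ 2 = ∫⁻ t, ‖(ψ - ψ') t‖ₑ ^ 2 := by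
      rw [← MemLp.toLp_sub, Lp.enorm_toLp, eLpNorm_eq_lintegral_rpow_enorm_toReal two_ne_zero
        ENNReal.ofNat_ne_top, ← ENNReal.rpow_natCast, ← ENNReal.rpow_mul]
      norm_num
    have e2 := lintegral_branchFun (lam := lam) h₁ h₂ (hψ.sub hψ')
    rw [← Completion.coe_sub, enorm_coe_indSpace_sq, e1, mul_assoc, mul_assoc, mul_assoc, ← e2]
    refine lintegral_congr fun u => ?_
    have e3 : ((isSection_branchFun (lam := lam) h₁ h₂ hψ hψ2).toInd -
        (isSection_branchFun (lam := lam) h₁ h₂ hψ' hψ2').toInd).1 (Unitary.toUnits u) =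
        (isSection_branchFun (lam := lam) h₁ h₂ hψ hψ2).toInd.1 (Unitary.toUnits u) -
        (isSection_branchFun (lam := lam) h₁ h₂ hψ' hψ2').toInd.1 (Unitary.toUnits u) := rfl
    rw [e3, IsSection.toInd_unitary, IsSection.toInd_unitary]
    simp only [branchFun, Pi.sub_apply, mul_sub]

/-- The Fourier transform is surjective on Schwartz functions, and these are dense in L². -/
theorem denseRange_fourier_toLp : DenseRange fun φ : SchwartzMap ℝ ℂ =>
    (FourierTransform.fourier φ : SchwartzMap ℝ ℂ).toLp 2 (volume : Measure ℝ) := by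
  have h := SchwartzMap.denseRange_toLpCLM (E := ℝ) (F := ℂ) (p := 2) (μ := volume)
    ENNReal.ofNat_ne_top
  refine h.mono (Set.range_subset_iff.2 fun φ => ?_)
  refine ⟨FourierTransformInv.fourierInv φ, ?_⟩
  beta_reduce
  rw [FourierTransform.fourier_fourierInv_eq]
  rfl

/-- `sourceVec` only admits transforms of Schwartz functions as ψ. These are dense in L², and
distances of elementary vectors are a fixed multiple of distances of the ψ, so a closed subspace
contains the elementary vectors for all ψ in L², in particular for `branchProfile`. -/
theorem coe_branchFun_mem {S : Submodule ℂ (PrincipalSeriesSpace (p + q) lam k)}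
    (hS : IsClosed (S : Set (PrincipalSeriesSpace (p + q) lam k)))
    (h : ∀ i : BranchIndex p q k, sourceVec lam i ∈ S)
    (h₁ : IsSection 0 k' f₁) (h₂ : IsSection 0 (k - k') f₂) {ψ : ℝ → ℂ} (hψ : Measurable ψ)
    (hψ2 : MemLp ψ 2) : ((isSection_branchFun (lam := lam) h₁ h₂ hψ hψ2).toInd :
      PrincipalSeriesSpace (p + q) lam k) ∈ S := by
  obtain ⟨K, hK, hKe⟩ := enorm_branchFun_sub_sq (lam := lam) h₁ h₂
  obtain ⟨x, hx, hlim⟩ := mem_closure_iff_seq_limit.1 (denseRange_fourier_toLp (hψ2.toLp ψ))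
  choose φ hφ using hx
  have hmem : ∀ j, sourceVec lam (⟨k', φ j, ⟨f₁, h₁⟩, ⟨f₂, h₂⟩⟩ : BranchIndex p q k) ∈ S :=
    fun j => h _
  refine hS.mem_of_tendsto (b := Filter.atTop) (f := fun j => sourceVec lam
    (⟨k', φ j, ⟨f₁, h₁⟩, ⟨f₂, h₂⟩⟩ : BranchIndex p q k)) ?_ (Filter.Eventually.of_forall hmem)
  rw [tendsto_iff_edist_tendsto_0] at hlim ⊢
  have e : ∀ j, edist (sourceVec lam (⟨k', φ j, ⟨f₁, h₁⟩, ⟨f₂, h₂⟩⟩ : BranchIndex p q k))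
      ((isSection_branchFun (lam := lam) h₁ h₂ hψ hψ2).toInd :
        PrincipalSeriesSpace (p + q) lam k) ^ 2 = K * edist (x j) (hψ2.toLp ψ) ^ 2 := by
    intro j
    rw [edist_eq_enorm_sub, edist_eq_enorm_sub, ← hφ j]
    exact hKe _ ψ (FourierTransform.fourier (φ j)).continuous.measurable
      ((FourierTransform.fourier (φ j)).memLp 2) hψ hψ2
  have h2 : Filter.Tendsto (fun j => K * edist (x j) (hψ2.toLp ψ) ^ 2) Filter.atTop (nhds 0) := by
    have := ENNReal.Tendsto.const_mul (a := K) ((ENNReal.continuous_pow 2).tendsto 0 |>.comp hlim)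
      (Or.inr hK)
    simpa using this
  simp only [← e] at h2
  have h3 := (ENNReal.continuous_rpow_const (y := 2⁻¹)).tendsto 0 |>.comp h2
  have h4 : ∀ a : ℝ≥0∞, (a ^ 2) ^ (2⁻¹ : ℝ) = a := fun a => by
    rw [← ENNReal.rpow_natCast, ← ENNReal.rpow_mul]
    norm_num
  simpa [Function.comp_def, h4] using h3

/-- By `map_col0_haarU` the measure on the sphere is an image under `branchDir`, whose values never
have a vanishing component. -/
theorem ae_fstVec_ne_zero_and_sndVec_ne_zero (p q : ℕ) [NeZero p] [NeZero q] :
    ∀ᵐ u : Matrix.unitaryGroup (Fin (p + q)) ℂ ∂(haarU (p + q)),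
      fstVec (col0 (u : Matrix (Fin (p + q)) (Fin (p + q)) ℂ)) ≠ 0 ∧
      sndVec (col0 (u : Matrix (Fin (p + q)) (Fin (p + q)) ℂ)) ≠ 0 := by
  have hs : MeasurableSet {z : Fin (p + q) → ℂ | fstVec z ≠ 0 ∧ sndVec z ≠ 0} :=
    ((measurable_fstVec (measurableSet_singleton 0)).compl).inter
      ((measurable_sndVec (measurableSet_singleton 0)).compl)
  rw [← ae_map_iff (p := fun z : Fin (p + q) → ℂ => fstVec z ≠ 0 ∧ sndVec z ≠ 0)
    measurable_col0.aemeasurable hs, map_col0_haarU,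
    ae_map_iff measurable_branchDir.aemeasurable hs]
  refine Filter.Eventually.of_forall fun x => ?_
  have hpos : ((euclNorm (branchVec x))⁻¹ : ℝ) ≠ 0 := (inv_pos.2 (euclNorm_branchVec_pos x)).ne'
  have e : (Real.exp x.2.2 : ℂ) ≠ 0 := by exact_mod_cast (Real.exp_pos _).ne'
  constructor
  · change ((euclNorm (branchVec x))⁻¹ : ℝ) • fstVec (joinVec ((Real.exp x.2.2 : ℂ) •
      col0 (x.1 : Matrix (Fin p) (Fin p) ℂ)) (col0 (x.2.1 : Matrix (Fin q) (Fin q) ℂ))) ≠ 0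
    rw [fstVec_joinVec]
    exact smul_ne_zero hpos (smul_ne_zero e (col0_coe_ne_zero x.1))
  · change ((euclNorm (branchVec x))⁻¹ : ℝ) • sndVec (joinVec ((Real.exp x.2.2 : ℂ) •
      col0 (x.1 : Matrix (Fin p) (Fin p) ℂ)) (col0 (x.2.1 : Matrix (Fin q) (Fin q) ℂ))) ≠ 0
    rw [sndVec_joinVec]
    exact smul_ne_zero hpos (col0_coe_ne_zero x.2.1)

/-- Restriction to `K` as a linear isometry. -/
def restrictKIsometry (n : ℕ) [NeZero n] (lam : ℝ) (k : ℤ) :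
    IndSpace n lam k →ₗᵢ[ℂ] Lp ℂ 2 (haarU n) := ⟨restrictK, fun _ => rfl⟩

theorem coeFn_restrictK {n : ℕ} [NeZero n] {f : (Fin n → ℂ) → ℂ} (hf : IsSection lam k f) :
    restrictKIsometry n lam k hf.toInd =ᵐ[haarU n]
      fun u => f (col0 (u : Matrix (Fin n) (Fin n) ℂ)) := by
  filter_upwards [hf.toInd.2.2.2.coeFn_toLp] with u hu
  exact hu.trans (hf.toInd_unitary u)

/-- Functions of the wrong phase are orthogonal to the induced space. -/
theorem inner_restrictK_eq_zero {n : ℕ} [NeZero n] {m : (Fin n → ℂ) → ℂ} {a : ℤ} (hak : a ≠ -k)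
    (hm : ∀ (c : ℂ) z, ‖c‖ = 1 → m (c • z) = c ^ a * m z)
    {G : Lp ℂ 2 (haarU n)}
    (hG : G =ᵐ[haarU n] fun u => m (col0 (u : Matrix (Fin n) (Fin n) ℂ)))
    (x : PrincipalSeriesSpace n lam k) :
    ⟪completionMap (restrictKIsometry n lam k) x, (G : Completion (Lp ℂ 2 (haarU n)))⟫_ℂ = 0 := by
  have hcl : IsClosed {x : PrincipalSeriesSpace n lam k |
      ⟪completionMap (restrictKIsometry n lam k) x,
        (G : Completion (Lp ℂ 2 (haarU n)))⟫_ℂ = 0} :=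
    isClosed_eq ((LinearIsometry.continuous _).inner continuous_const) continuous_const
  induction x using Completion.induction_on with
  | hp => exact hcl
  | ih F =>
    obtain ⟨f, hf, h⟩ := exists_isSection F
    rw [h, completionMap_coe, Completion.inner_coe, L2.inner_def]
    have : ∫ u, ⟪restrictKIsometry n lam k hf.toInd u, G u⟫_ℂ ∂(haarU n) =
        ∫ u, star (f (col0 (u : Matrix (Fin n) (Fin n) ℂ))) *
          m (col0 (u : Matrix (Fin n) (Fin n) ℂ)) ∂(haarU n) := by
      refine integral_congr_ae ?_
      filter_upwards [coeFn_restrictK hf, hG] with u h1 h2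
      rw [h1, h2, RCLike.inner_apply, mul_comm]
      rfl
    rw [this]
    -- The conjugate of a section has phase k, so the integrand has the nonzero phase k + a.
    refine integral_eq_zero_of_phase (m := k + a) (φ := fun z => star (f z) * m z)
      (fun h => hak (by linarith)) fun c u hc => ?_
    have hc0 : c ≠ 0 := by rw [← norm_ne_zero_iff, hc]; exact one_ne_zero
    have hst : star (c ^ k)⁻¹ = c ^ k := by
      have : star c = c⁻¹ := by
        rw [← starRingEnd_apply, Complex.inv_def, Complex.normSq_eq_norm_sq, hc]; simp
      rw [star_inv₀, star_zpow₀, this, inv_zpow, inv_inv]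
    rw [hf.map_circle_smul hc, hm c _ hc, star_mul', hst, zpow_add₀ hc0]
    ring

theorem isTotal_sourceVec (p q : ℕ) [NeZero p] [NeZero q] (lam : ℝ) (k : ℤ) :
    IsTotal (sourceVec (p := p) (q := q) lam (k := k)) := by
  refine Submodule.topologicalClosure_eq_top_iff.2 ((Submodule.eq_bot_iff _).2 fun x hx => ?_)
  -- The double orthogonal complement is closed, contains the elementary vectors and is still
  -- orthogonal to x.
  set S := (Submodule.span ℂ (Set.range (sourceVec (p := p) (q := q) lam (k := k))))ᗮᗮ
  have hxS : ∀ y ∈ S, ⟪x, y⟫_ℂ = 0 := fun y hy => (Submodule.mem_orthogonal _ _).1 hy x hx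
  have hS : IsClosed (S : Set (PrincipalSeriesSpace (p + q) lam k)) :=
    Submodule.isClosed_orthogonal _
  have hv : ∀ i : BranchIndex p q k, sourceVec lam i ∈ S := fun i =>
    Submodule.le_orthogonal_orthogonal _ (Submodule.subset_span (Set.mem_range_self i))
  set J : Lp ℂ 2 (haarU (p + q)) →L[ℂ] Completion (Lp ℂ 2 (haarU (p + q))) := Completion.toComplL
  set R := completionMap (restrictKIsometry (p + q) lam k)
  -- The functional lives on all of L²(U(p + q)), because the monomials of the Stone–Weierstrass
  -- argument have arbitrary phase and need not come from the induced space.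
  set ℓ : Lp ℂ 2 (haarU (p + q)) →L[ℂ] ℂ := (innerSL ℂ (R x)).comp J with hℓ
  have hℓR : ∀ F : IndSpace (p + q) lam k, ℓ (restrictKIsometry _ lam k F) =
      ⟪x, (F : PrincipalSeriesSpace (p + q) lam k)⟫_ℂ := by
    intro F
    rw [← LinearIsometry.inner_map_map R, completionMap_coe]
    rfl
  have hmon : ∀ (m : (Fin (p + q) → ℂ) → ℂ) (G : Lp ℂ 2 (haarU (p + q))), IsBihomog m →
      (G =ᵐ[haarU (p + q)] fun u => m (col0 (u : Matrix (Fin (p + q)) (Fin (p + q)) ℂ))) →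
      G ∈ LinearMap.ker ℓ.toLinearMap := by
    rintro m G ⟨d₁, d₂, a₁, a₂, m₁, m₂, h₁, h₂, hm⟩ hG
    change ℓ G = 0
    by_cases hk : a₁ + a₂ = -k
    -- A monomial of phase -k is almost everywhere an elementary function with k' = -a₁, hence
    -- orthogonal to x.
    · have s₁ := h₁.isSection
      have s₂ : IsSection 0 (k - -a₁) fun z => ((euclNorm z : ℂ)⁻¹) ^ (q + d₂) * m₂ z := by
        have := h₂.isSection
        rwa [show -a₂ = k - -a₁ by linarith] at this
      -- The exponents of the profile are positive because p and q are, even for constant factors;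
      -- this makes the profile square integrable.
      have hA : p + d₁ ≠ 0 := by have := NeZero.ne p; omega
      have hB : q + d₂ ≠ 0 := by have := NeZero.ne q; omega
      have hW := coe_branchFun_mem hS hv s₁ s₂ (measurable_branchProfile lam (p + d₁) (q + d₂))
        (memLp_branchProfile lam hA hB)
      have hGW : G = restrictKIsometry (p + q) lam k (isSection_branchFun (lam := lam) s₁ s₂
          (measurable_branchProfile lam (p + d₁) (q + d₂))
          (memLp_branchProfile lam hA hB)).toInd := by
        ext1
        filter_upwards [hG, coeFn_restrictK (isSection_branchFun (lam := lam) s₁ s₂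
          (measurable_branchProfile lam (p + d₁) (q + d₂)) (memLp_branchProfile lam hA hB)),
          ae_fstVec_ne_zero_and_sndVec_ne_zero p q] with u e1 e2 e3
        rw [e1, e2, hm, branchFun_isHomog (euclNorm_col0_coe u) e3.1 e3.2]
      rw [hGW, hℓR]
      exact hxS _ hW
    -- A monomial of any other phase is orthogonal to the whole induced space.
    · refine inner_restrictK_eq_zero (a := a₁ + a₂) hk (fun c z hc => ?_) hG x
      have hc0 : c ≠ 0 := by rw [← norm_ne_zero_iff, hc]; exact one_ne_zero
      rw [hm, hm, fstVec_smul, sndVec_smul, h₁.map_smul c _ hc0, h₂.map_smul c _ hc0, hc,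
        zpow_add₀ hc0]
      simp only [Complex.ofReal_one, one_pow, div_one]
      ring
  have hker : IsClosed (LinearMap.ker ℓ.toLinearMap : Set (Lp ℂ 2 (haarU (p + q)))) :=
    isClosed_singleton.preimage ℓ.continuous
  have hall : ∀ F : IndSpace (p + q) lam k,
      ⟪x, (F : PrincipalSeriesSpace (p + q) lam k)⟫_ℂ = 0 := by
    intro F
    obtain ⟨f, hf, h⟩ := exists_isSection F
    have h1 := mem_of_forall_bihomog_mem hker hmon hf.measurable hf.memLp
    have h2 : restrictKIsometry (p + q) lam k hf.toInd = hf.memLp.toLp _ := by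
      ext1
      filter_upwards [coeFn_restrictK hf, hf.memLp.coeFn_toLp] with u e1 e2
      rw [e1, e2]
    rw [h, ← hℓR, h2]
    exact h1
  exact Completion.denseRange_coe.eq_zero_of_inner_left ℂ hall

end

end

end GLBranching

theorem theorem2p1 (p q : ℕ) [NeZero p] [NeZero q] (lam : ℝ) (k : ℤ) :
    ∃ h : ∀ k' : ℤ,
        GLBranching.IsMeasurableField (GLBranching.branchingField p q lam k k')
          MeasureTheory.volume,
      GLBranching.UnitarilyEquivalent
        ((GLBranching.principalSeries (p + q) lam k).comp (GLBranching.blockDiag p q))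
        (GLBranching.hilbertSum fun k' : ℤ =>
          GLBranching.directIntegral (GLBranching.branchingField p q lam k k')
            MeasureTheory.volume (h k')) :=
  ⟨fun k' => GLBranching.isMeasurableField_branchingField p q lam k k',
    GLBranching.unitarilyEquivalent_branching lam k _
      (GLBranching.isTotal_sourceVec p q lam k)⟩
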